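/- Let $\Theta$ be the unit ball of $\mathbb R^3$ and, for $n\ge 1$, let $e_n(x)=\frac{\sin(n\pi|x|)}{\sqrt{2\pi}\,|x|}$ be the $L^2(\Theta)$-normalized radial Dirichlet eigenfunctions, $-\mathbf\Delta e_n=(n\pi)^2e_n$. Let $E_N$ be the complex span of $e_1,\dots,e_N$, and put $\|\sum_n c_ne_n\|_{H^s(\Theta)}^2=\sum_n (n\pi)^{2s}|c_n|^2$ and $S(t)\sum_n c_ne_n=e^{-it\sqrt{-\mathbf\Delta}}\sum_n c_ne_n=\sum_n e^{-itn\pi}c_ne_n$. Let $\alpha>0$, $2\alpha<p<6$ and $s<1/2$. Fix a real-valued $\chi\in C_0^\infty(-1,1)$ equal to $1$ on $(-1/2,1/2)$ and put $S_N\sum_n c_ne_n=\sum_n\chi(n^2/N^2)c_ne_n$. Let $\rho_N$ be the measure on $E_N$ which is the image, under $\omega\mapsto\sum_{n=1}^N\frac{h_n(\omega)+il_n(\omega)}{n\pi}e_n$, of the measure $\exp\big(-\frac1{\alpha+2}\|S_N\sum_{n=1}^N\frac{h_n(\omega)}{n\pi}e_n\|_{L^{\alpha+2}(\Theta)}^{\alpha+2}\big)\,d\mathbb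 P(\omega)$, where $h_1,\dots,h_N,l_1,\dots,l_N$ are independent standard real Gaussian random variables under $\mathbb P$. For every integer $N\ge 1$ and every $u_0\in E_N$ the equation $$(i\partial_t-\sqrt{-\mathbf\Delta})u-S_N\Big(\sqrt{-\mathbf\Delta}^{-1}\big(|S_N(\Re u)|^\alpha S_N(\Re u)\big)\Big)=0,\qquad u|_{t=0}=u_0,$$ has a unique global solution $u:\mathbb R\to E_N$; write $u(t)=\Phi_N(t)(u_0)$. Moreover, there is a constant $C>0$ (depending only on $\alpha,p,s,\chi$) such that for all integers $i\ge 1$ and $N\ge 1$ there is a measurable set $\Sigma_N^i\subset E_N$ with $\rho_N(E_N\setminus\Sigma_N^i)\le 2^{-i}$ such that for every $u_0\in\Sigma_N^i$ and every $t\in\mathbb R$, $$\|S(\tau)(\Phi_N(t)(u_0))\|_{L^p(\tau\in(0,2);L^p(\Theta))}+\|\Phi_N(t)(u_0)\|_{H^s(\Theta)}\le C\,(i+\log(1+|t|))^{1/2}.$$ -/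

import Mathlib

namespace RadialWave

noncomputable section

open MeasureTheory ProbabilityTheory

/-- Physical space `ℝ³` with its Euclidean norm. -/
abbrev R3 : Type := EuclideanSpace ℝ (Fin 3)

/-- The open unit ball `Θ` of `ℝ³`. -/
def unitBall : Set R3 := Metric.ball 0 1

/-- The `L²(Θ)`-normalized radial Dirichlet eigenfunction
`e_n(x) = sin(nπ|x|) / (√(2π) |x|)` (extended continuously to `x = 0`), for `n ≥ 1`;
one has `-Δ e_n = (nπ)² e_n` on `Θ` and `e_n = 0` on `∂Θ`. -/
def eigenfun (n : ℕ) (x : R3) : ℝ :=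
  n * Real.pi / √(2 * Real.pi) * Real.sinc (n * Real.pi * ‖x‖)

theorem integral_cos_int_mul_pi (k : ℤ) : ∫ r in (0:ℝ)..1, Real.cos (k * Real.pi * r) = if k = 0 then 1 else 0 := by
  split_ifs with h
  · simp [h]
  · have : (k:ℝ) * Real.pi ≠ 0 := by positivity
    rw [intervalIntegral.integral_comp_mul_left (fun x => Real.cos x) this]
    simp [Real.sin_int_mul_pi]

/-- The `e_n` are orthonormal in `L²(Θ)`, so that `E_N` below is described by coefficients. -/
theorem eigenfun_orthonormal {m n : ℕ} (hm : 1 ≤ m) (hn : 1 ≤ n) :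
    ∫ x in unitBall, eigenfun m x * eigenfun n x = if m = n then 1 else 0 := by
  have h1 : ∫ x in unitBall, eigenfun m x * eigenfun n x = ∫ x : R3,
      (fun r : ℝ => (Set.Iio (1:ℝ)).indicator (fun r => (m * Real.pi / √(2 * Real.pi) * Real.sinc (m * Real.pi * r)) * (n * Real.pi / √(2 * Real.pi) * Real.sinc (n * Real.pi * r))) r) ‖x‖ := by
    rw [← integral_indicator (by exact measurableSet_ball)]
    congr 1
    ext x
    simp [Set.indicator, unitBall, eigenfun]
  rw [h1, integral_fun_norm_addHaar]
  have hm' : (m:ℝ) ≠ 0 := by positivity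
  have hn' : (n:ℝ) ≠ 0 := by positivity
  have h2 : ∀ y ∈ Set.Ioi (0:ℝ), y ^ (Module.finrank ℝ R3 - 1) • (Set.Iio (1:ℝ)).indicator (fun r => (m * Real.pi / √(2 * Real.pi) * Real.sinc (m * Real.pi * r)) * (n * Real.pi / √(2 * Real.pi) * Real.sinc (n * Real.pi * r))) y = (Set.Iio (1:ℝ)).indicator (fun y => (4 * Real.pi)⁻¹ * (Real.cos (((m - n : ℤ) : ℝ) * Real.pi * y) - Real.cos (((m + n : ℤ) : ℝ) * Real.pi * y))) y := by
    intro y hy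
    have hy' : y ≠ 0 := ne_of_gt hy
    simp only [Set.indicator]
    split_ifs with h
    · rw [Real.sinc_of_ne_zero (by positivity), Real.sinc_of_ne_zero (by positivity)]
      push_cast
      rw [sub_mul, sub_mul, add_mul, add_mul, Real.cos_sub, Real.cos_add]
      simp
      field_simp
      rw [Real.sq_sqrt (by positivity), Real.sq_sqrt (by positivity)]
      ring
    · simp
  rw [setIntegral_congr_fun measurableSet_Ioi h2, setIntegral_indicator measurableSet_Iio, 
    Set.Ioi_inter_Iio, ← integral_Ioc_eq_integral_Ioo, ← intervalIntegral.integral_of_le zero_le_one,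
    intervalIntegral.integral_const_mul, intervalIntegral.integral_sub
      (Continuous.intervalIntegrable (by fun_prop) _ _) (Continuous.intervalIntegrable (by fun_prop) _ _),
    integral_cos_int_mul_pi, integral_cos_int_mul_pi, measureReal_def, EuclideanSpace.volume_ball_fin_three]
  have : ((m:ℤ) + n ≠ 0) := by omega
  simp only [this, if_false, sub_eq_zero, Nat.cast_inj]
  split_ifs
  · simp [ENNReal.toReal_ofReal (show 0 ≤ Real.pi * 4 / 3 by positivity)]
    field_simp
  · simp

/-- The space `E_N` spanned over `ℂ` by the orthonormal family `e_1, …, e_N`. An element is given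
by its coefficients `(c_1, …, c_N)` in this basis (the coordinate `k : Fin N` is the coefficient of
`e_{k+1}`), and the Euclidean norm of the coefficients is its `L²(Θ)` norm. -/
abbrev E (N : ℕ) : Type := EuclideanSpace ℂ (Fin N)

/-- The function `∑ c_n e_n` that the element `c` of `E_N` stands for. -/
def toFun {N : ℕ} (c : E N) (x : R3) : ℂ :=
  ∑ k : Fin N, c k * (eigenfun (k + 1) x : ℂ)

/-- The eigenvalue `nπ` of `√(-Δ)` on `e_n`, for `n = k + 1`. -/
def freq {N : ℕ} (k : Fin N) : ℝ := ((k : ℝ) + 1) * Real.pi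

/-- `√(-Δ)` on `E_N`. -/
def sqrtLap {N : ℕ} (c : E N) : E N := WithLp.toLp 2 fun k => (freq k : ℂ) * c k

/-- `√(-Δ)⁻¹` on `E_N`. -/
def invSqrtLap {N : ℕ} (c : E N) : E N := WithLp.toLp 2 fun k => (freq k : ℂ)⁻¹ * c k

/-- The free evolution `S(t) = exp(-it√(-Δ))` on `E_N`. -/
def freeEvol {N : ℕ} (t : ℝ) (c : E N) : E N :=
  WithLp.toLp 2 fun k => Complex.exp (-Complex.I * t * freq k) * c k

/-- The `H^s(Θ)` norm of an element of `E_N`. -/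
def sobolevNorm {N : ℕ} (s : ℝ) (c : E N) : ℝ :=
  √(∑ k : Fin N, freq k ^ (2 * s) * ‖c k‖ ^ 2)

/-- The spectral cut-off `S_N = χ(-Δ / (π² N²))`, from functions on `Θ` to `E_N`:
`S_N f = ∑ χ(n² / N²) ⟨f, e_n⟩ e_n`. Only `n ≤ N` contribute when `χ` is supported in `(-1, 1)`. -/
def cutoff (χ : ℝ → ℝ) (N : ℕ) (f : R3 → ℂ) : E N :=
  WithLp.toLp 2 fun k : Fin N =>
    (χ (((k : ℝ) + 1) ^ 2 / (N : ℝ) ^ 2) : ℂ) *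
      ∫ x in unitBall, f x * (eigenfun (k + 1) x : ℂ)

/-- The nonlinear term `S_N (√(-Δ)⁻¹ (|S_N (Re u)|^α S_N (Re u)))` of the truncated equation
(`S_N` and `√(-Δ)⁻¹` commute, both being functions of `-Δ`). -/
def nonlinearity (α : ℝ) (χ : ℝ → ℝ) (N : ℕ) (u : E N) : E N :=
  let w : R3 → ℂ := toFun (cutoff χ N fun x => ((toFun u x).re : ℂ))
  invSqrtLap (cutoff χ N fun x => ((‖w x‖ ^ α : ℝ) : ℂ) * w x)

/-- `u : ℝ → E_N` is a global solution of
`(i∂_t - √(-Δ)) u - S_N (√(-Δ)⁻¹ (|S_N (Re u)|^α S_N (Re u))) = 0`, `u(0) = u₀`. -/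
structure IsTruncatedSolution (α : ℝ) (χ : ℝ → ℝ) (N : ℕ) (u₀ : E N) (u : ℝ → E N) : Prop where
  differentiable : Differentiable ℝ u
  equation : ∀ t : ℝ,
    Complex.I • deriv u t - sqrtLap (u t) - nonlinearity α χ N (u t) = 0
  initial : u 0 = u₀

/-- The flow `Φ_N(t)` of the truncated equation: `t ↦ Φ_N(t) u₀` is the solution with data `u₀`. -/
def truncatedFlow (α : ℝ) (χ : ℝ → ℝ) (N : ℕ) (t : ℝ) (u₀ : E N) : E N :=
  Classical.epsilon (fun u : ℝ → E N => IsTruncatedSolution α χ N u₀ u) t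

/-- The law of `(h_n, l_n)`, `n = 1, …, N`, all independent standard real Gaussians. -/
def gaussianLaw (N : ℕ) : Measure (Fin N → ℝ × ℝ) :=
  Measure.pi fun _ => (gaussianReal 0 1).prod (gaussianReal 0 1)

/-- The random element `∑_{n ≤ N} (h_n + i l_n) / (nπ) e_n` of `E_N`. -/
def randomSeries (N : ℕ) (g : Fin N → ℝ × ℝ) : E N :=
  WithLp.toLp 2 fun k => ((g k).1 + Complex.I * (g k).2) / (freq k : ℂ)

/-- The real part `∑_{n ≤ N} h_n / (nπ) e_n` of the random element. -/
def randomSeriesRe (N : ℕ) (g : Fin N → ℝ × ℝ) : E N :=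
  WithLp.toLp 2 fun k => ((g k).1 : ℂ) / (freq k : ℂ)

/-- The Gibbs measure `ρ_N` on `E_N`: the image under `randomSeries` of the Gaussian law weighted by
`exp(-(1/(α+2)) ‖S_N (∑ h_n / (nπ) e_n)‖_{L^{α+2}(Θ)}^{α+2})`. -/
def gibbsMeasure (α : ℝ) (χ : ℝ → ℝ) (N : ℕ) : Measure (E N) :=
  ((gaussianLaw N).withDensity fun g =>
    ENNReal.ofReal (Real.exp (-(1 / (α + 2)) *
      ∫ x in unitBall, ‖toFun (cutoff χ N (toFun (randomSeriesRe N g))) x‖ ^ (α + 2)))).map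
    (randomSeries N)

/-- The norm `‖S(τ) u‖_{L^p((0,2) × Θ)}`, in `[0, ∞]`. -/
def freeLpNorm {N : ℕ} (p : ℝ) (u : E N) : ENNReal :=
  eLpNorm (fun q : ℝ × R3 => toFun (freeEvol q.1 u) q.2) (ENNReal.ofReal p)
    ((volume.restrict (Set.Ioo (0 : ℝ) 2)).prod (volume.restrict unitBall))

end

end RadialWave

namespace RadialWave

noncomputable section

open MeasureTheory ProbabilityTheory Filter Topology
open scoped NNReal ENNReal

/-! ### Global solutions for bounded Lipschitz vector fields -/

section GlobalFlow

variable {V : Type*} [NormedAddCommGroup V] [NormedSpace ℝ V]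

/-! In the coordinates `(h, l)` with `c_k = (h_k + i l_k) / (kπ)`, the truncated equation is `h_k' =
kπ l_k`, `l_k' = -kπ h_k - force_k(h)`. It conserves the energy `(|h|² + |l|²) / 2 + potential(h)`,
whose potential part is nonnegative. The energy therefore bounds the solution for all time, which
gives the unique global flow (`existsUnique_isTruncatedSolution`). The Gibbs measure has density a
constant times `exp(-energy)` in these coordinates. The field is separable (`h'` depends on `l` only
and `l'` on `h` only), so Lebesgue measure is preserved as well: the symplectic Euler scheme is a
composition of shears and converges to the flow (`measurePreserving_flow_of_separable`). Hence the
Gibbs measure does not increase along the flow (`lintegral_truncatedFlow_le`), and at every time a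
norm of the solution has moments no larger than those of the initial data.

At a fixed time these moments are Gaussian, since the Gibbs weight is at most `1`. The variance of
the series at `x` is `O(‖x‖^(-(1+ε)))` uniformly in `N`, which is integrable to the power `r / 2` on
the ball when `r < 6` and `ε` is small. Chebyshev's inequality at a moment of order `Q` shows that a
norm exceeds a multiple of `√Q` with probability at most `32^(-Q)` (`gibbsMeasure_tail_le`).

To pass from single times to all times, consider a window `[T, T + Q⁻³]`. By Duhamel's formula and
two Strichartz estimates (`exists_freeNorm_le_sobolevNorm`, and its dual form
`sobolevNorm_duhamel_le`), the solution on the window is controlled by its value at `T` and by the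
`L^m` norm of `|w|^(α+1)` on the window, where `w = S_N Re u` (`truncatedFlow_local_bound`). No
fixed point argument is involved: invariance gives moments of that space-time norm directly. They
grow like `Q^((α+1)/2)`, and the short window contributes a factor `Q^(-3/m)`, which brings the
growth below `√Q` (`exists_gibbsMeasure_nlNorm_tail_le`). The condition `m (α + 1) < 6` leaves room
for some `m > 3/2` because `2α < p < 6` forces `α < 3`.

Finally take `Q = 8(i + j)` and a grid of step `Q⁻³` on `[-2^j, 2^j]`, for every `j`. The
exponential tail beats the number of grid points, and the exceptional probabilities add up to at
most `2^(-i)` (`measure_grid_le`). A time `t` is handled with `j` comparable to `log(1 + |t|)`, so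
that `√Q` is of the order of the bound sought (`exists_grid_point`). -/

theorem exists_hasDerivAt_of_lipschitz_of_bounded [CompleteSpace V] {X : V → V} {K : ℝ≥0} {M : ℝ≥0}
    (hX : LipschitzWith K X) (hM : ∀ y, ‖X y‖ ≤ M) (y₀ : V) :
    ∃ y : ℝ → V, y 0 = y₀ ∧ ∀ t, HasDerivAt y (X (y t)) t := by
  have hloc : ∀ n : ℕ, ∃ α : ℝ → V, α 0 = y₀ ∧
      ∀ t ∈ Set.Ioo (-((n : ℝ) + 1)) (n + 1), HasDerivAt α (X (α t)) t := by
    intro n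
    have h0 : (0 : ℝ) ∈ Set.Icc (-((n : ℝ) + 1)) (n + 1) := ⟨by linarith [n.cast_nonneg (α := ℝ)], by positivity⟩
    -- A field bounded by `M` moves a point by at most `M (n + 1)` in time `n + 1`, so with a ball
    -- of this radius Picard–Lindelöf runs over the whole window. Radius `n + 1` rather than `n`
    -- keeps the window a neighbourhood of `0` when `n = 0`.
    have hpl : IsPicardLindelof (fun _ => X) (⟨0, h0⟩ : Set.Icc (-((n : ℝ) + 1)) (n + 1)) y₀
        (M * (n + 1)) 0 M K := by
      refine ⟨fun _ _ => hX.lipschitzOnWith, fun _ _ => continuousOn_const, fun _ _ x _ => hM x, ?_⟩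
      simp
    obtain ⟨α, h1, h2⟩ := hpl.exists_eq_forall_mem_Icc_hasDerivWithinAt₀
    exact ⟨α, h1, fun t ht => (h2 t (Set.Ioo_subset_Icc_self ht)).hasDerivAt (Icc_mem_nhds ht.1 ht.2)⟩
  choose α hα0 hα using hloc
  have hagree : ∀ n m : ℕ, n ≤ m → Set.EqOn (α n) (α m) (Set.Ioo (-((n : ℝ) + 1)) (n + 1)) := by
    intro n m hnm
    have hnm' : (n : ℝ) ≤ m := by exact_mod_cast hnm
    refine ODE_solution_unique_of_mem_Ioo (v := fun _ => X) (s := fun _ => Set.univ) (K := K) (t₀ := 0)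
      (fun t _ => hX.lipschitzOnWith) ⟨by linarith [n.cast_nonneg (α := ℝ)], by positivity⟩
      (fun t ht => ⟨hα n t ht, trivial⟩)
      (fun t ht => ⟨hα m t ⟨by linarith [ht.1], by linarith [ht.2]⟩, trivial⟩) (by rw [hα0, hα0])
  refine ⟨fun t => α ⌈|t|⌉₊ t, by simp [hα0], fun t => ?_⟩
  -- The glued function changes its index with `s`. Near `t` it agrees with the single solution of
  -- index `⌈|t|⌉₊ + 1`, which is differentiable there.
  have key : ∀ s : ℝ, |s| < |t| + 1 → α ⌈|s|⌉₊ s = α (⌈|t|⌉₊ + 1) s := by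
    intro s hs
    refine hagree _ _ ?_ ?_
    · rw [Nat.ceil_le]; push_cast; linarith [Nat.le_ceil |t|]
    · have := Nat.le_ceil |s|
      exact abs_lt.1 (by linarith)
  have hev : (fun s => α ⌈|s|⌉₊ s) =ᶠ[𝓝 t] α (⌈|t|⌉₊ + 1) := by
    have : ∀ᶠ s in 𝓝 t, |s| < |t| + 1 :=
      (continuous_abs.tendsto t).eventually (gt_mem_nhds (by linarith))
    filter_upwards [this] with s hs using key s hs
  have := hα (⌈|t|⌉₊ + 1) t (abs_lt.1 (by push_cast; linarith [Nat.le_ceil |t|]))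
  rw [← key t (by linarith)] at this
  exact this.congr_of_eventuallyEq hev

end GlobalFlow

/-! ### Liouville's theorem for separable systems, through the symplectic Euler scheme -/

section SymplecticEuler

theorem lipschitzWith_separable {P : Type*} [NormedAddCommGroup P] {F₁ F₂ : P → P} {K : ℝ≥0}
    (h₁ : LipschitzWith K F₁) (h₂ : LipschitzWith K F₂) :
    LipschitzWith K (fun y : P × P => (F₁ y.2, F₂ y.1)) := by
  refine LipschitzWith.of_dist_le_mul fun y z => ?_
  rw [Prod.dist_eq]
  refine max_le ((h₁.dist_le_mul _ _).trans ?_) ((h₂.dist_le_mul _ _).trans ?_)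
  · gcongr; exact le_max_right _ _
  · gcongr; exact le_max_left _ _

variable {P : Type*} [NormedAddCommGroup P] [NormedSpace ℝ P]

/-- One step of the symplectic Euler scheme for `a' = F₁ b`, `b' = F₂ a`. -/
def eulerStep (F₁ F₂ : P → P) (τ : ℝ) (y : P × P) : P × P :=
  (y.1 + τ • F₁ y.2, y.2 + τ • F₂ (y.1 + τ • F₁ y.2))

variable {F₁ F₂ : P → P} {K M : ℝ≥0}

theorem continuous_eulerStep (h₁ : LipschitzWith K F₁) (h₂ : LipschitzWith K F₂) (τ : ℝ) :
    Continuous (eulerStep F₁ F₂ τ) := by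
  have := h₁.continuous
  have := h₂.continuous
  unfold eulerStep
  fun_prop

theorem norm_eulerStep_sub_self_le (hM₁ : ∀ b, ‖F₁ b‖ ≤ M) (hM₂ : ∀ a, ‖F₂ a‖ ≤ M) (τ : ℝ)
    (y : P × P) : ‖eulerStep F₁ F₂ τ y - y‖ ≤ |τ| * M := by
  rw [Prod.norm_def]
  simp only [eulerStep, Prod.fst_sub, Prod.snd_sub, add_sub_cancel_left, norm_smul, Real.norm_eq_abs]
  exact max_le (by gcongr; exact hM₁ _) (by gcongr; exact hM₂ _)

theorem norm_eulerStep_iterate_sub_self_le (hM₁ : ∀ b, ‖F₁ b‖ ≤ M) (hM₂ : ∀ a, ‖F₂ a‖ ≤ M) (τ : ℝ)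
    (y : P × P) (n : ℕ) : ‖(eulerStep F₁ F₂ τ)^[n] y - y‖ ≤ n * (|τ| * M) := by
  induction n with
  | zero => simp
  | succ n ih =>
    rw [Function.iterate_succ_apply']
    calc _ = ‖(eulerStep F₁ F₂ τ ((eulerStep F₁ F₂ τ)^[n] y) - (eulerStep F₁ F₂ τ)^[n] y) +
            ((eulerStep F₁ F₂ τ)^[n] y - y)‖ := by congr 1; abel
      _ ≤ |τ| * M + n * (|τ| * M) :=
        (norm_add_le _ _).trans (add_le_add (norm_eulerStep_sub_self_le hM₁ hM₂ _ _) ih)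
      _ = _ := by push_cast; ring

/-- Stability of the scheme: the expansion factor per step is `1 + O(|τ|)`, so it stays bounded
after `T / τ` steps. -/
theorem norm_eulerStep_sub_le (h₁ : LipschitzWith K F₁) (h₂ : LipschitzWith K F₂) (τ : ℝ)
    (y z : P × P) :
    ‖eulerStep F₁ F₂ τ y - eulerStep F₁ F₂ τ z‖ ≤ (1 + (2 * (K * |τ|) + (K * |τ|) ^ 2)) * ‖y - z‖ := by
  have e1 : ‖y.1 - z.1‖ ≤ ‖y - z‖ := norm_fst_le (y - z)
  have e2 : ‖y.2 - z.2‖ ≤ ‖y - z‖ := norm_snd_le (y - z)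
  have hKt : 0 ≤ K * |τ| := by positivity
  have ha : ‖(y.1 + τ • F₁ y.2) - (z.1 + τ • F₁ z.2)‖ ≤ (1 + K * |τ|) * ‖y - z‖ := by
    calc _ = ‖(y.1 - z.1) + τ • (F₁ y.2 - F₁ z.2)‖ := by congr 1; rw [smul_sub]; abel
      _ ≤ ‖y - z‖ + |τ| * (K * ‖y - z‖) := by
        refine (norm_add_le _ _).trans (add_le_add e1 ?_)
        rw [norm_smul, Real.norm_eq_abs]
        gcongr
        exact (h₁.norm_sub_le _ _).trans (by gcongr)
      _ = _ := by ring
  rw [Prod.norm_def]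
  refine max_le ?_ ?_
  · refine ha.trans ?_
    gcongr
    nlinarith
  · calc _ = ‖(y.2 - z.2) + τ • (F₂ (y.1 + τ • F₁ y.2) - F₂ (z.1 + τ • F₁ z.2))‖ := by
          congr 1; simp only [eulerStep, Prod.snd_sub, smul_sub]; abel
      _ ≤ ‖y - z‖ + |τ| * (K * ((1 + K * |τ|) * ‖y - z‖)) := by
        refine (norm_add_le _ _).trans (add_le_add e2 ?_)
        rw [norm_smul, Real.norm_eq_abs]
        gcongr
        exact (h₂.norm_sub_le _ _).trans (by gcongr)
      _ ≤ _ := by nlinarith [mul_nonneg hKt (norm_nonneg (y - z))]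

/-- Consistency: the scheme and the solution are both compared with the explicit Euler point `y t +
τ X(y t)`, and each differs from it by at most `K M |τ|²`. -/
theorem norm_eulerStep_sub_solution_le (h₁ : LipschitzWith K F₁) (h₂ : LipschitzWith K F₂)
    (hM₁ : ∀ b, ‖F₁ b‖ ≤ M) (hM₂ : ∀ a, ‖F₂ a‖ ≤ M) {y : ℝ → P × P}
    (hy : ∀ t, HasDerivAt y (F₁ (y t).2, F₂ (y t).1) t) (t τ : ℝ) :
    ‖eulerStep F₁ F₂ τ (y t) - y (t + τ)‖ ≤ 2 * K * M * |τ| ^ 2 := by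
  set X : P × P → P × P := fun y => (F₁ y.2, F₂ y.1) with hXdef
  have hX : LipschitzWith K X := lipschitzWith_separable h₁ h₂
  have hXM : ∀ z, ‖X z‖ ≤ M := fun z => max_le (hM₁ _) (hM₂ _)
  have hmove : ∀ s, ‖y s - y t‖ ≤ M * ‖s - t‖ := fun s =>
    convex_univ.norm_image_sub_le_of_norm_hasDerivWithin_le
      (fun r _ => (hy r).hasDerivWithinAt) (fun r _ => hXM _) (Set.mem_univ _) (Set.mem_univ _)
  have hloc : ‖(y (t + τ) - (t + τ) • X (y t)) - (y t - t • X (y t))‖ ≤ (K * (M * |τ|)) * ‖t + τ - t‖ := by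
    refine (convex_uIcc t (t + τ)).norm_image_sub_le_of_norm_hasDerivWithin_le (f := fun s => y s - s • X (y t))
      (f' := fun s => X (y s) - X (y t)) (fun s hs => ?_) (fun s hs => ?_) Set.left_mem_uIcc Set.right_mem_uIcc
    · have := (hy s).sub ((hasDerivAt_id s).smul_const (X (y t)))
      rw [one_smul] at this
      exact this.hasDerivWithinAt
    · refine (hX.norm_sub_le _ _).trans ?_
      gcongr
      refine (hmove s).trans ?_
      gcongr
      have := Set.abs_sub_left_of_mem_uIcc hs
      simpa [Real.norm_eq_abs] using this
  have hstep : ‖eulerStep F₁ F₂ τ (y t) - (y t + τ • X (y t))‖ ≤ K * M * |τ| ^ 2 := by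
    rw [Prod.norm_def]
    refine max_le ?_ ?_
    · simp only [eulerStep, hXdef, Prod.fst_sub, Prod.fst_add, Prod.smul_fst, sub_self, norm_zero]
      positivity
    · simp only [eulerStep, hXdef, Prod.snd_sub, Prod.snd_add, Prod.smul_snd]
      rw [add_sub_add_left_eq_sub, ← smul_sub, norm_smul, Real.norm_eq_abs]
      have := h₂.norm_sub_le ((y t).1 + τ • F₁ (y t).2) (y t).1
      rw [add_sub_cancel_left, norm_smul, Real.norm_eq_abs] at this
      calc _ ≤ |τ| * (K * (|τ| * M)) := by
            gcongr
            exact this.trans (by gcongr; exact hM₁ _)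
        _ = _ := by ring
  calc _ = ‖(eulerStep F₁ F₂ τ (y t) - (y t + τ • X (y t))) -
          ((y (t + τ) - (t + τ) • X (y t)) - (y t - t • X (y t)))‖ := by
        congr 1; rw [add_smul]; abel
    _ ≤ K * M * |τ| ^ 2 + (K * (M * |τ|)) * ‖t + τ - t‖ := (norm_sub_le _ _).trans (add_le_add hstep hloc)
    _ = _ := by rw [add_sub_cancel_left, Real.norm_eq_abs]; ring

/-- The `n` local errors of size `O(n⁻²)` are accumulated by the discrete Grönwall inequality, which
leaves a total error `O(1/n)`. -/
theorem tendsto_eulerStep_iterate (h₁ : LipschitzWith K F₁) (h₂ : LipschitzWith K F₂)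
    (hM₁ : ∀ b, ‖F₁ b‖ ≤ M) (hM₂ : ∀ a, ‖F₂ a‖ ≤ M) {y : ℝ → P × P}
    (hy : ∀ t, HasDerivAt y (F₁ (y t).2, F₂ (y t).1) t) (T : ℝ) :
    Tendsto (fun n : ℕ => (eulerStep F₁ F₂ (T / n))^[n] (y 0)) atTop (𝓝 (y T)) := by
  have herr : ∀ n : ℕ, 0 < n → ‖(eulerStep F₁ F₂ (T / n))^[n] (y 0) - y T‖ ≤
      (2 * K * M * |T| ^ 2) / n * Real.exp (2 * (K * |T|) + (K * |T|) ^ 2) := by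
    intro n hn
    have hn' : (0 : ℝ) < n := by exact_mod_cast hn
    set τ := T / n with hτ
    have hT : n * τ = T := by rw [hτ]; field_simp
    have habs : n * |τ| = |T| := by rw [← hT, abs_mul, Nat.abs_cast]
    have hrec : ∀ k ≥ 0, ‖(eulerStep F₁ F₂ τ)^[k + 1] (y 0) - y ((k + 1 : ℕ) * τ)‖ ≤
        (1 + (2 * (K * |τ|) + (K * |τ|) ^ 2)) * ‖(eulerStep F₁ F₂ τ)^[k] (y 0) - y (k * τ)‖ +
          2 * K * M * |τ| ^ 2 := by
      intro k _
      rw [Function.iterate_succ_apply']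
      have e : ((k + 1 : ℕ) : ℝ) * τ = k * τ + τ := by push_cast; ring
      rw [e]
      refine (norm_sub_le_norm_sub_add_norm_sub _ (eulerStep F₁ F₂ τ (y (k * τ))) _).trans ?_
      exact add_le_add (norm_eulerStep_sub_le h₁ h₂ _ _ _)
        (norm_eulerStep_sub_solution_le h₁ h₂ hM₁ hM₂ hy _ _)
    have := discrete_gronwall (u := fun k => ‖(eulerStep F₁ F₂ τ)^[k] (y 0) - y (k * τ)‖) (n₀ := 0)
      (norm_nonneg _) hrec (fun _ _ => by positivity) (fun _ _ => by positivity) (Nat.zero_le n)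
    simp only [Function.iterate_zero, id, Nat.cast_zero, zero_mul, sub_self, norm_zero, zero_add,
      Finset.sum_const, Nat.Ico_zero_eq_range, Finset.card_range, nsmul_eq_mul, hT] at this
    refine this.trans ?_
    have e1 : (n : ℝ) * (2 * K * M * |τ| ^ 2) = 2 * K * M * |T| ^ 2 / n := by
      rw [← habs]; field_simp
    rw [e1]
    gcongr
    have e2 : (n : ℝ) * (K * |τ|) ^ 2 ≤ (K * |T|) ^ 2 := by
      rw [← habs]
      have : (1 : ℝ) ≤ n := by exact_mod_cast hn
      have h3 : (n : ℝ) * 1 ≤ n * n := by gcongr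
      calc (n : ℝ) * (K * |τ|) ^ 2 = (n * 1) * (K * |τ|) ^ 2 := by ring
        _ ≤ (n * n) * (K * |τ|) ^ 2 := by gcongr
        _ = _ := by ring
    calc _ = 2 * (K * (n * |τ|)) + n * (K * |τ|) ^ 2 := by ring
      _ ≤ _ := by rw [habs]; gcongr
  rw [tendsto_iff_norm_sub_tendsto_zero]
  refine squeeze_zero' (Eventually.of_forall fun _ => norm_nonneg _)
    (eventually_atTop.2 ⟨1, fun n hn => herr n hn⟩) ?_
  have := (tendsto_const_div_atTop_nhds_zero_nat (2 * K * M * |T| ^ 2 : ℝ)).mul_const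
    (Real.exp (2 * (K * |T|) + (K * |T|) ^ 2))
  simpa using this

variable [FiniteDimensional ℝ P] [MeasurableSpace P] [BorelSpace P] (μ : Measure P)
  [μ.IsAddHaarMeasure]

/-- Each half-step moves one component by a function of the other one. Such a shear preserves the
product measure by Fubini and translation invariance, and no differentiability of `F₁`, `F₂` is
needed. -/
theorem measurePreserving_eulerStep (h₁ : LipschitzWith K F₁) (h₂ : LipschitzWith K F₂) (τ : ℝ) :
    MeasurePreserving (eulerStep F₁ F₂ τ) (μ.prod μ) (μ.prod μ) := by
  have hc1 := h₁.continuous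
  have hc2 := h₂.continuous
  have s2 : MeasurePreserving (fun y : P × P => (y.1, y.2 + τ • F₂ y.1)) (μ.prod μ) (μ.prod μ) := by
    refine (MeasurePreserving.id μ).skew_product (g := fun a b => b + τ • F₂ a) ?_ ?_
    · exact Continuous.measurable (by fun_prop)
    · exact Eventually.of_forall fun a => map_add_right_eq_self μ _
  have s1' : MeasurePreserving (fun y : P × P => (y.1, y.2 + τ • F₁ y.1)) (μ.prod μ) (μ.prod μ) := by
    refine (MeasurePreserving.id μ).skew_product (g := fun a b => b + τ • F₁ a) ?_ ?_
    · exact Continuous.measurable (by fun_prop)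
    · exact Eventually.of_forall fun a => map_add_right_eq_self μ _
  have hsw : MeasurePreserving (Prod.swap : P × P → P × P) (μ.prod μ) (μ.prod μ) :=
    Measure.measurePreserving_swap
  exact s2.comp (hsw.comp (s1'.comp hsw))

theorem measurable_flow_of_separable (h₁ : LipschitzWith K F₁) (h₂ : LipschitzWith K F₂)
    (hM₁ : ∀ b, ‖F₁ b‖ ≤ M) (hM₂ : ∀ a, ‖F₂ a‖ ≤ M) {Φ : ℝ → P × P → P × P}
    (h0 : ∀ y, Φ 0 y = y)
    (hΦ : ∀ y t, HasDerivAt (fun t => Φ t y) (F₁ (Φ t y).2, F₂ (Φ t y).1) t) (T : ℝ) :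
    Measurable (Φ T) := by
  refine measurable_of_tendsto_metrizable (f := fun n : ℕ => (eulerStep F₁ F₂ (T / n))^[n])
    (fun n => ((continuous_eulerStep h₁ h₂ _).iterate n).measurable) ?_
  rw [tendsto_pi_nhds]
  intro y
  have := tendsto_eulerStep_iterate h₁ h₂ hM₁ hM₂ (hΦ y) T
  simpa [h0] using this

/-- Liouville's theorem for separable Hamiltonian-type systems. -/
theorem measurePreserving_flow_of_separable (h₁ : LipschitzWith K F₁) (h₂ : LipschitzWith K F₂)
    (hM₁ : ∀ b, ‖F₁ b‖ ≤ M) (hM₂ : ∀ a, ‖F₂ a‖ ≤ M) {Φ : ℝ → P × P → P × P}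
    (h0 : ∀ y, Φ 0 y = y)
    (hΦ : ∀ y t, HasDerivAt (fun t => Φ t y) (F₁ (Φ t y).2, F₂ (Φ t y).1) t) (T : ℝ) :
    MeasurePreserving (Φ T) (μ.prod μ) (μ.prod μ) := by
  have hmeas := measurable_flow_of_separable h₁ h₂ hM₁ hM₂ h0 hΦ T
  have hlim : ∀ y, Tendsto (fun n : ℕ => (eulerStep F₁ F₂ (T / n))^[n] y) atTop (𝓝 (Φ T y)) := by
    intro y
    have := tendsto_eulerStep_iterate h₁ h₂ hM₁ hM₂ (hΦ y) T
    simpa [h0] using this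
  -- The displacement is bounded uniformly in `n`, so for a test function supported in the ball of
  -- radius `R` all the compositions vanish outside the ball of radius `R + |T| M`. This is the
  -- domination used below.
  have hdisp : ∀ (n : ℕ) y, ‖(eulerStep F₁ F₂ (T / n))^[n] y - y‖ ≤ |T| * M := by
    intro n y
    refine (norm_eulerStep_iterate_sub_self_le hM₁ hM₂ (T / n) y n).trans ?_
    rcases Nat.eq_zero_or_pos n with rfl | hn
    · simp; positivity
    · have hn' : (0 : ℝ) < n := by exact_mod_cast hn
      rw [abs_div, Nat.abs_cast]
      exact le_of_eq (by field_simp)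
  have hdisp' : ∀ y, ‖Φ T y - y‖ ≤ |T| * M := fun y =>
    le_of_tendsto ((hlim y).sub_const y).norm (Eventually.of_forall fun n => hdisp n y)
  have hint : ∀ f : CompactlySupportedContinuousMap (P × P) ℝ, ∫ y, f (Φ T y) ∂(μ.prod μ) = ∫ y, f y ∂(μ.prod μ) := by
    intro f
    have hfc : Continuous (f : P × P → ℝ) := f.continuous
    obtain ⟨C, hC⟩ := f.hasCompactSupport.exists_bound_of_continuous f.continuous
    obtain ⟨R, hR⟩ := f.hasCompactSupport.isCompact.isBounded.subset_closedBall 0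
    have hsupp : ∀ z, R < ‖z‖ → f z = 0 := by
      intro z hz
      by_contra hne
      have := hR (subset_tsupport _ hne)
      rw [mem_closedBall_zero_iff] at this
      linarith
    have hconv : Tendsto (fun n : ℕ => ∫ y, f ((eulerStep F₁ F₂ (T / n))^[n] y) ∂(μ.prod μ)) atTop
        (𝓝 (∫ y, f (Φ T y) ∂(μ.prod μ))) := by
      refine tendsto_integral_of_dominated_convergence
        ((Metric.closedBall (0 : P × P) (R + |T| * M)).indicator fun _ => C) ?_ ?_ ?_ ?_
      · intro n
        exact (f.continuous.comp ((continuous_eulerStep h₁ h₂ _).iterate n)).aestronglyMeasurable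
      · rw [integrable_indicator_iff measurableSet_closedBall]
        exact integrableOn_const (isCompact_closedBall _ _).measure_lt_top.ne
      · refine fun n => Eventually.of_forall fun y => ?_
        by_cases hy : y ∈ Metric.closedBall (0 : P × P) (R + |T| * M)
        · rw [Set.indicator_of_mem hy]; exact hC _
        · rw [Set.indicator_of_notMem hy, hsupp, norm_zero]
          rw [mem_closedBall_zero_iff, not_le] at hy
          have h1 := hdisp n y
          have h2 := norm_sub_norm_le y ((eulerStep F₁ F₂ (T / n))^[n] y)
          rw [norm_sub_rev] at h2
          linarith
      · exact Eventually.of_forall fun y => (f.continuous.tendsto _).comp (hlim y)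
    have hconst : ∀ n : ℕ, ∫ y, f ((eulerStep F₁ F₂ (T / n))^[n] y) ∂(μ.prod μ) = ∫ y, f y ∂(μ.prod μ) := by
      intro n
      have hp := (measurePreserving_eulerStep μ h₁ h₂ (T / n)).iterate n
      rw [← integral_map hp.measurable.aemeasurable hfc.aestronglyMeasurable, hp.map_eq]
    simp_rw [hconst] at hconv
    exact tendsto_nhds_unique hconv tendsto_const_nhds |>.symm ▸ rfl
  refine ⟨hmeas, ?_⟩
  -- Bounded displacement makes the preimage of a compact set bounded, so the image measure is
  -- finite on compacts and is determined by its integrals of compactly supported continuous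
  -- functions.
  have hfin : IsFiniteMeasureOnCompacts ((μ.prod μ).map (Φ T)) := by
    refine ⟨fun S hS => ?_⟩
    rw [Measure.map_apply hmeas hS.measurableSet]
    obtain ⟨R, hR⟩ := hS.isBounded.subset_closedBall 0
    refine lt_of_le_of_lt (measure_mono (t := Metric.closedBall 0 (R + |T| * M)) fun y hy => ?_)
      (isCompact_closedBall _ _).measure_lt_top
    have h1 := hR hy
    rw [mem_closedBall_zero_iff] at h1 ⊢
    have h2 := norm_sub_norm_le y (Φ T y)
    rw [norm_sub_rev] at h2
    linarith [hdisp' y]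
  refine Measure.ext_of_integral_eq_on_compactlySupported fun f => ?_
  have hfc : Continuous (f : P × P → ℝ) := f.continuous
  rw [integral_map hmeas.aemeasurable hfc.aestronglyMeasurable, hint]

end SymplecticEuler

/-! ### Pointwise bounds for the eigenfunctions -/

theorem freq_pos {N : ℕ} (k : Fin N) : 0 < freq k := by
  unfold freq; positivity

theorem one_le_freq {N : ℕ} (k : Fin N) : 1 ≤ freq k := by
  unfold freq
  nlinarith [Real.pi_gt_three, (Nat.cast_nonneg k : (0 : ℝ) ≤ (k : ℕ))]

theorem succ_le_freq {N : ℕ} (k : Fin N) : (k : ℝ) + 1 ≤ freq k := by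
  unfold freq
  nlinarith [Real.pi_gt_three, (Nat.cast_nonneg k : (0 : ℝ) ≤ (k : ℕ))]

/-- Interpolation between `|sinc y| ≤ 1` and `|sinc y| ≤ 1 / y`. -/
theorem abs_sinc_le_rpow {θ : ℝ} (h0 : 0 ≤ θ) (h1 : θ ≤ 1) {y : ℝ} (hy : 0 < y) :
    |Real.sinc y| ≤ y ^ (θ - 1) := by
  rcases le_total y 1 with h | h
  · exact (Real.abs_sinc_le_one y).trans
      (Real.one_le_rpow_of_pos_of_le_one_of_nonpos hy h (by linarith))
  · rw [Real.sinc_of_ne_zero hy.ne', abs_div, abs_of_pos hy]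
    calc |Real.sin y| / y ≤ 1 / y := by gcongr; exact Real.abs_sin_le_one y
      _ = y ^ (-1 : ℝ) := by rw [Real.rpow_neg_one, one_div]
      _ ≤ _ := Real.rpow_le_rpow_of_exponent_le h (by linarith)

/-- The parameter `θ` trades growth in the frequency against the singularity at the origin: `θ = 0`
gives `1 / ‖x‖`, and `θ = 1` gives the frequency itself. -/
theorem abs_eigenfun_le {θ : ℝ} (h0 : 0 ≤ θ) (h1 : θ ≤ 1) {N : ℕ} (k : Fin N) {x : R3} (hx : x ≠ 0) :
    |eigenfun (k + 1) x| ≤ freq k ^ θ * ‖x‖ ^ (θ - 1) := by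
  have hr : 0 < ‖x‖ := norm_pos_iff.2 hx
  have hf := freq_pos k
  have e : eigenfun (k + 1) x = freq k / √(2 * Real.pi) * Real.sinc (freq k * ‖x‖) := by
    simp [eigenfun, freq]
  have hs : 1 ≤ √(2 * Real.pi) := by
    rw [Real.one_le_sqrt]; linarith [Real.pi_gt_three]
  rw [e, abs_mul, abs_of_nonneg (by positivity)]
  calc _ ≤ freq k * (freq k * ‖x‖) ^ (θ - 1) := by
        gcongr
        · exact div_le_self hf.le hs
        · exact abs_sinc_le_rpow h0 h1 (by positivity)
    _ = _ := by
        rw [Real.mul_rpow hf.le hr.le, ← mul_assoc, Real.rpow_sub_one hf.ne', mul_div_cancel₀ _ hf.ne']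

theorem continuous_eigenfun (n : ℕ) : Continuous (eigenfun n) := by
  unfold eigenfun
  have := Real.continuous_sinc
  fun_prop

theorem ae_ne_zero_unitBall : ∀ᵐ x ∂(volume.restrict unitBall), x ≠ 0 :=
  ae_restrict_of_ae (Measure.ae_ne volume 0)

/-- The total mass of the weight `‖x‖ ^ (-β)` on the unit ball. -/
def weightMass (β : ℝ) : ℝ≥0∞ := ∫⁻ x in unitBall, ENNReal.ofReal (‖x‖ ^ (-β))

theorem weightMass_lt_top {β : ℝ} (hβ : β < 3) : weightMass β < ∞ := by
  have h : IntegrableOn (fun x : R3 => ‖x‖ ^ (-β)) (Metric.ball 0 1) := by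
    refine integrableOn_ball_of_norm_le_rpow (C := 1) (α := β) (by simp) (by simpa using hβ) ?_ ?_
    · refine Eventually.of_forall fun x => ?_
      rw [one_mul, Real.norm_of_nonneg (by positivity)]
    · exact Measurable.aestronglyMeasurable (by fun_prop)
  exact h.lintegral_lt_top

/-! ### Strichartz estimates for radial data -/

theorem toFun_freeEvol {N : ℕ} (σ : ℝ) (c : E N) (x : R3) :
    toFun (freeEvol σ c) x =
      ∑ k, Complex.exp (-Complex.I * σ * freq k) * (c k * (eigenfun (k + 1) x : ℂ)) := by
  simp [toFun, freeEvol, mul_assoc]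

theorem norm_exp_freq {N : ℕ} (σ : ℝ) (k : Fin N) : ‖Complex.exp (-Complex.I * σ * freq k)‖ = 1 := by
  have : -Complex.I * σ * freq k = ((-(σ * freq k) : ℝ) : ℂ) * Complex.I := by push_cast; ring
  rw [this, Complex.norm_exp_ofReal_mul_I]

theorem continuous_toFun_freeEvol_left {N : ℕ} (c : E N) :
    Continuous fun q : ℝ × R3 => toFun (freeEvol q.1 c) q.2 := by
  simp_rw [toFun_freeEvol]
  have := fun n => continuous_eigenfun n
  fun_prop

theorem norm_toFun_freeEvol_le {N : ℕ} (σ : ℝ) (c : E N) (x : R3) :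
    ‖toFun (freeEvol σ c) x‖ ≤ ∑ k, ‖c k‖ * |eigenfun (k + 1) x| := by
  rw [toFun_freeEvol]
  refine (norm_sum_le _ _).trans (Finset.sum_le_sum fun k _ => ?_)
  rw [norm_mul, norm_exp_freq, one_mul, norm_mul, Complex.norm_real, Real.norm_eq_abs]

/-- The frequencies are integer multiples of `π`, so all the exponentials have period `2` and are
orthogonal on any interval of that length. This periodicity replaces dispersion in the estimates
that follow. -/
theorem integral_exp_freq_sub {N : ℕ} (t₀ : ℝ) (k l : Fin N) :
    ∫ σ in t₀..(t₀ + 2), Complex.exp (-Complex.I * σ * freq k) * (starRingEnd ℂ) (Complex.exp (-Complex.I * σ * freq l)) =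
      if k = l then 2 else 0 := by
  have e : ∀ σ : ℝ, Complex.exp (-Complex.I * σ * freq k) *
      (starRingEnd ℂ) (Complex.exp (-Complex.I * σ * freq l)) =
      Complex.exp ((Complex.I * (freq l - freq k)) * σ) := by
    intro σ
    rw [← Complex.exp_conj, ← Complex.exp_add]
    simp
    ring_nf
  simp_rw [e]
  split_ifs with h
  · subst h; simp
  · have hd : (freq l : ℂ) - freq k ≠ 0 := by
      rw [sub_ne_zero]
      intro h'
      have h'' : freq l = freq k := by exact_mod_cast h'
      unfold freq at h''
      have := mul_right_cancel₀ Real.pi_ne_zero h''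
      exact h (Fin.ext (by exact_mod_cast (add_right_cancel this).symm))
    rw [integral_exp_mul_complex (mul_ne_zero Complex.I_ne_zero hd)]
    rw [div_eq_zero_iff]; left
    rw [sub_eq_zero, Complex.exp_eq_exp_iff_exists_int]
    refine ⟨(l : ℤ) - k, ?_⟩
    simp [freq]
    ring

theorem integral_norm_sq_sum_exp {N : ℕ} (t₀ : ℝ) (z : Fin N → ℂ) :
    ∫ σ in t₀..(t₀ + 2), ‖∑ k, Complex.exp (-Complex.I * σ * freq k) * z k‖ ^ 2 = 2 * ∑ k, ‖z k‖ ^ 2 := by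
  apply Complex.ofReal_injective
  rw [← intervalIntegral.integral_ofReal]
  have e : ∀ σ : ℝ, ((‖∑ k, Complex.exp (-Complex.I * σ * freq k) * z k‖ ^ 2 : ℝ) : ℂ) =
      ∑ k, ∑ l, (z k * (starRingEnd ℂ) (z l)) * (Complex.exp (-Complex.I * σ * freq k) *
        (starRingEnd ℂ) (Complex.exp (-Complex.I * σ * freq l))) := by
    intro σ
    rw [Complex.ofReal_pow, ← Complex.mul_conj', map_sum, Finset.sum_mul_sum]
    refine Finset.sum_congr rfl fun k _ => Finset.sum_congr rfl fun l _ => ?_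
    rw [map_mul]; ring
  have hc : ∀ k l : Fin N, Continuous fun σ : ℝ => (z k * (starRingEnd ℂ) (z l)) * (Complex.exp (-Complex.I * σ * freq k) *
        (starRingEnd ℂ) (Complex.exp (-Complex.I * σ * freq l))) := by
    intro k l
    have := Complex.continuous_conj
    fun_prop
  simp_rw [e]
  rw [intervalIntegral.integral_finsetSum fun k _ =>
    (continuous_finsetSum _ fun l _ => hc k l).intervalIntegrable _ _]
  simp_rw [intervalIntegral.integral_finsetSum fun l _ => (hc _ l).intervalIntegrable _ _,
    intervalIntegral.integral_const_mul, integral_exp_freq_sub]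
  simp [Complex.mul_conj', Finset.mul_sum, mul_comm]

theorem lintegral_norm_sq_sum_exp {N : ℕ} (t₀ : ℝ) (z : Fin N → ℂ) :
    ∫⁻ σ in Set.Ioo t₀ (t₀ + 2),
      ENNReal.ofReal (‖∑ k, Complex.exp (-Complex.I * σ * freq k) * z k‖ ^ 2) =
        ENNReal.ofReal (2 * ∑ k, ‖z k‖ ^ 2) := by
  have hc : Continuous fun σ : ℝ => ‖∑ k, Complex.exp (-Complex.I * σ * freq k) * z k‖ ^ 2 := by fun_prop
  rw [← integral_norm_sq_sum_exp t₀ z, intervalIntegral.integral_of_le (by linarith),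
    ofReal_integral_eq_lintegral_ofReal]
  · exact (setLIntegral_congr Ioo_ae_eq_Ioc)
  · exact (hc.integrableOn_Icc).mono_set Set.Ioc_subset_Icc_self
  · exact Eventually.of_forall fun _ => by positivity

/-- The norm of `S(σ) u` in `L^p((a, b) × Θ)`. -/
def freeNorm {N : ℕ} (p a b : ℝ) (u : E N) : ℝ≥0∞ :=
  eLpNorm (fun q : ℝ × R3 => toFun (freeEvol q.1 u) q.2) (ENNReal.ofReal p)
    ((volume.restrict (Set.Ioo a b)).prod (volume.restrict unitBall))

theorem freeNorm_eq_lintegral {N : ℕ} {p : ℝ} (hp : 0 < p) (a b : ℝ) (u : E N) :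
    freeNorm p a b u = (∫⁻ x in unitBall, ∫⁻ σ in Set.Ioo a b,
      ENNReal.ofReal (‖toFun (freeEvol σ u) x‖ ^ p)) ^ (1 / p) := by
  have hc := continuous_toFun_freeEvol_left u
  rw [freeNorm, eLpNorm_eq_lintegral_rpow_enorm_toReal (by simpa using hp) (by simp),
    ENNReal.toReal_ofReal hp.le, lintegral_prod_symm _ (by
      exact (hc.measurable.enorm.pow_const _).aemeasurable)]
  simp_rw [← ofReal_norm, ENNReal.ofReal_rpow_of_nonneg (norm_nonneg _) hp.le]

/-- At most `L` coefficients are nonzero, so Cauchy–Schwarz costs `√L`. Each eigenfunction that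
occurs has frequency at most `πL`. -/
theorem sum_norm_mul_eigenfun_le {θ : ℝ} (h0 : 0 ≤ θ) (h1 : θ ≤ 1) {N : ℕ} {c : E N} {L : ℝ}
    (hL : 1 ≤ L) (hc : ∀ k, c k ≠ 0 → (k : ℝ) + 1 ≤ L) {x : R3} (hx : x ≠ 0) :
    ∑ k, ‖c k‖ * |eigenfun (k + 1) x| ≤ ((Real.pi * L) ^ θ * ‖x‖ ^ (θ - 1)) * (√L * ‖c‖) := by
  classical
  set B := Finset.univ.filter fun k : Fin N => c k ≠ 0 with hB
  have hcard : (B.card : ℝ) ≤ L := by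
    have : B.card ≤ ⌊L⌋₊ := by
      calc B.card = (B.map ⟨fun k : Fin N => (k : ℕ), Fin.val_injective⟩).card := by simp
        _ ≤ (Finset.range ⌊L⌋₊).card := by
          refine Finset.card_le_card fun n hn => ?_
          simp only [Finset.mem_map, Function.Embedding.coeFn_mk, hB, Finset.mem_filter,
            Finset.mem_univ, true_and] at hn
          obtain ⟨k, hk, rfl⟩ := hn
          rw [Finset.mem_range, ← Nat.succ_le_iff]
          exact Nat.le_floor (by push_cast; exact hc k hk)
        _ = _ := by simp
    exact (Nat.cast_le.2 this).trans (Nat.floor_le (by linarith))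
  have hsum : ∑ k, ‖c k‖ ≤ √L * ‖c‖ := by
    have e1 : ∑ k, ‖c k‖ = ∑ k ∈ B, ‖c k‖ := by
      rw [hB, Finset.sum_filter]
      exact Finset.sum_congr rfl fun k _ => by split_ifs with h <;> simp_all
    have e2 : (∑ k ∈ B, ‖c k‖) ^ 2 ≤ L * ‖c‖ ^ 2 := by
      calc _ ≤ B.card * ∑ k ∈ B, ‖c k‖ ^ 2 := sq_sum_le_card_mul_sum_sq
        _ ≤ L * ∑ k, ‖c k‖ ^ 2 := by
          gcongr
          exact Finset.subset_univ _
        _ = _ := by rw [EuclideanSpace.norm_sq_eq]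
    rw [e1]
    refine abs_le_of_sq_le_sq' ?_ (by positivity) |>.2
    rw [mul_pow, Real.sq_sqrt (by linarith)]
    exact e2
  calc _ ≤ ∑ k, ‖c k‖ * ((Real.pi * L) ^ θ * ‖x‖ ^ (θ - 1)) := by
        refine Finset.sum_le_sum fun k _ => ?_
        by_cases hk : c k = 0
        · simp [hk]
        · gcongr
          refine (abs_eigenfun_le h0 h1 k hx).trans ?_
          gcongr
          · exact (freq_pos k).le
          · rw [freq, mul_comm]; gcongr; exact hc k hk
    _ = (∑ k, ‖c k‖) * ((Real.pi * L) ^ θ * ‖x‖ ^ (θ - 1)) := by rw [Finset.sum_mul]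
    _ ≤ (√L * ‖c‖) * ((Real.pi * L) ^ θ * ‖x‖ ^ (θ - 1)) := by gcongr
    _ = _ := mul_comm _ _

/-- At fixed `x`, the `L^q` norm in time is interpolated between `L²`, computed exactly by Parseval,
and `L^∞`, bounded by Cauchy–Schwarz: `|F|^q = |F|^(q-2) |F|²`. -/
theorem lintegral_freeEvol_rpow_le {θ q : ℝ} (h0 : 0 ≤ θ) (h1 : θ ≤ 1) (hq : 2 ≤ q) {N : ℕ} {c : E N}
    {L : ℝ} (hL : 1 ≤ L) (hc : ∀ k, c k ≠ 0 → (k : ℝ) + 1 ≤ L) {x : R3} (hx : x ≠ 0) (t₀ : ℝ) :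
    ∫⁻ σ in Set.Ioo t₀ (t₀ + 2), ENNReal.ofReal (‖toFun (freeEvol σ c) x‖ ^ q) ≤
      ENNReal.ofReal (2 * (Real.pi * L) ^ (θ * q) * L ^ ((q - 2) / 2) * ‖c‖ ^ q) *
        ENNReal.ofReal (‖x‖ ^ (-((1 - θ) * q))) := by
  have hr : 0 < ‖x‖ := norm_pos_iff.2 hx
  set W := (Real.pi * L) ^ θ * ‖x‖ ^ (θ - 1) with hW
  have hW0 : 0 ≤ W := by positivity
  have hsup : ∀ σ, ‖toFun (freeEvol σ c) x‖ ≤ W * (√L * ‖c‖) := fun σ =>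
    (norm_toFun_freeEvol_le σ c x).trans (sum_norm_mul_eigenfun_le h0 h1 hL hc hx)
  have hL2 : 2 * ∑ k, ‖c k * (eigenfun (k + 1) x : ℂ)‖ ^ 2 ≤ 2 * (W ^ 2 * ‖c‖ ^ 2) := by
    refine mul_le_mul_of_nonneg_left ?_ zero_le_two
    rw [EuclideanSpace.norm_sq_eq, Finset.mul_sum]
    refine Finset.sum_le_sum fun k _ => ?_
    rw [norm_mul, Complex.norm_real, Real.norm_eq_abs, mul_pow, mul_comm]
    by_cases hk : c k = 0
    · simp [hk]
    · gcongr
      refine (abs_eigenfun_le h0 h1 k hx).trans ?_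
      rw [hW]
      gcongr
      · exact (freq_pos k).le
      · rw [freq, mul_comm]; gcongr; exact hc k hk
  calc _ ≤ ∫⁻ σ in Set.Ioo t₀ (t₀ + 2), ENNReal.ofReal ((W * (√L * ‖c‖)) ^ (q - 2)) *
          ENNReal.ofReal (‖toFun (freeEvol σ c) x‖ ^ 2) := by
        refine lintegral_mono fun σ => ?_
        rw [← ENNReal.ofReal_mul (by positivity)]
        refine ENNReal.ofReal_le_ofReal ?_
        have e : ‖toFun (freeEvol σ c) x‖ ^ q =
            ‖toFun (freeEvol σ c) x‖ ^ (q - 2) * ‖toFun (freeEvol σ c) x‖ ^ 2 := by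
          rw [← Real.rpow_natCast, ← Real.rpow_add' (norm_nonneg _) (by push_cast; linarith)]
          congr 1; push_cast; ring
        rw [e]
        exact mul_le_mul_of_nonneg_right
          (Real.rpow_le_rpow (norm_nonneg _) (hsup σ) (by linarith)) (by positivity)
    _ = ENNReal.ofReal ((W * (√L * ‖c‖)) ^ (q - 2)) *
          ENNReal.ofReal (2 * ∑ k, ‖c k * (eigenfun (k + 1) x : ℂ)‖ ^ 2) := by
        rw [lintegral_const_mul' _ _ ENNReal.ofReal_ne_top]
        simp_rw [toFun_freeEvol]
        rw [lintegral_norm_sq_sum_exp]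
    _ ≤ ENNReal.ofReal ((W * (√L * ‖c‖)) ^ (q - 2)) * ENNReal.ofReal (2 * (W ^ 2 * ‖c‖ ^ 2)) := by
        gcongr
    _ = _ := by
        rw [← ENNReal.ofReal_mul (by positivity), ← ENNReal.ofReal_mul (by positivity)]
        congr 1
        have eW : W ^ (q - 2) * W ^ 2 = (Real.pi * L) ^ (θ * q) * ‖x‖ ^ (-((1 - θ) * q)) := by
          rw [← Real.rpow_natCast W, ← Real.rpow_add' hW0 (by push_cast; linarith), hW,
            Real.mul_rpow (by positivity) (by positivity), ← Real.rpow_mul (by positivity),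
            ← Real.rpow_mul (by positivity)]
          congr 2 <;> push_cast <;> ring
        clear_value W
        have ec : ‖c‖ ^ (q - 2) * ‖c‖ ^ 2 = ‖c‖ ^ q := by
          rw [← Real.rpow_natCast ‖c‖ 2, ← Real.rpow_add' (norm_nonneg _) (by push_cast; linarith)]
          congr 1; push_cast; ring
        have eL : √L ^ (q - 2) = L ^ ((q - 2) / 2) := by
          rw [Real.sqrt_eq_rpow, ← Real.rpow_mul (by linarith)]
          congr 1; ring
        rw [Real.mul_rpow hW0 (by positivity), Real.mul_rpow (by positivity) (by positivity), eL]
        calc _ = 2 * (W ^ (q - 2) * W ^ 2) * L ^ ((q - 2) / 2) * (‖c‖ ^ (q - 2) * ‖c‖ ^ 2) := by ring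
          _ = _ := by rw [eW, ec]; ring

/-- Bernstein-type estimate for the free evolution of frequency-localized radial data. -/
theorem freeNorm_le_of_support {θ q : ℝ} (h0 : 0 ≤ θ) (h1 : θ ≤ 1) (hq : 2 ≤ q) {N : ℕ} {c : E N}
    {L : ℝ} (hL : 1 ≤ L) (hc : ∀ k, c k ≠ 0 → (k : ℝ) + 1 ≤ L) (t₀ : ℝ) :
    freeNorm q t₀ (t₀ + 2) c ≤ (weightMass ((1 - θ) * q)) ^ (1 / q) *
      ENNReal.ofReal (2 ^ (1 / q) * Real.pi ^ θ * L ^ (θ + 1 / 2 - 1 / q) * ‖c‖) := by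
  have hq0 : 0 < q := by linarith
  have hL0 : 0 < L := by linarith
  rw [freeNorm_eq_lintegral hq0]
  have hle : ∫⁻ x in unitBall, ∫⁻ σ in Set.Ioo t₀ (t₀ + 2), ENNReal.ofReal (‖toFun (freeEvol σ c) x‖ ^ q) ≤
      ENNReal.ofReal (2 * (Real.pi * L) ^ (θ * q) * L ^ ((q - 2) / 2) * ‖c‖ ^ q) *
        weightMass ((1 - θ) * q) := by
    rw [weightMass, ← lintegral_const_mul' _ _ ENNReal.ofReal_ne_top]
    refine lintegral_mono_ae ?_
    filter_upwards [ae_ne_zero_unitBall] with x hx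
    exact lintegral_freeEvol_rpow_le h0 h1 hq hL hc hx t₀
  refine (ENNReal.rpow_le_rpow hle (by positivity)).trans (le_of_eq ?_)
  rw [ENNReal.mul_rpow_of_nonneg _ _ (by positivity), mul_comm,
    ENNReal.ofReal_rpow_of_nonneg (by positivity) (by positivity)]
  congr 2
  rw [Real.mul_rpow (by positivity) (by positivity), Real.mul_rpow (by positivity) (by positivity),
    Real.mul_rpow (by positivity) (by positivity), ← Real.rpow_mul (by positivity),
    ← Real.rpow_mul (by positivity), ← Real.rpow_mul (by positivity), mul_one_div_cancel hq0.ne',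
    Real.rpow_one, mul_assoc θ, mul_one_div_cancel hq0.ne', mul_one,
    Real.mul_rpow (by positivity) (by positivity)]
  have : L ^ (θ + 1 / 2 - 1 / q) = L ^ θ * L ^ ((q - 2) / 2 * (1 / q)) := by
    rw [← Real.rpow_add hL0]; congr 1; field_simp; ring
  rw [this]; ring

theorem toFun_freeEvol_sum {N : ℕ} {ι : Type*} (s : Finset ι) (f : ι → E N) (σ : ℝ) (x : R3) :
    toFun (freeEvol σ (∑ j ∈ s, f j)) x = ∑ j ∈ s, toFun (freeEvol σ (f j)) x := by
  simp_rw [toFun_freeEvol]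
  rw [Finset.sum_comm]
  refine Finset.sum_congr rfl fun k _ => ?_
  rw [WithLp.ofLp_sum, Finset.sum_apply, Finset.sum_mul, Finset.mul_sum]

/-- Strichartz estimate for the free evolution of radial data in the unit ball. -/
theorem exists_freeNorm_le_sobolevNorm {θ q a : ℝ} (h0 : 0 ≤ θ) (h1 : θ ≤ 1) (hq : 2 ≤ q)
    (hθq : (1 - θ) * q < 3) (ha : θ + 1 / 2 - 1 / q < a) :
    ∃ C : ℝ, 0 < C ∧ ∀ (N : ℕ) (c : E N) (t₀ : ℝ),
      freeNorm q t₀ (t₀ + 2) c ≤ ENNReal.ofReal (C * sobolevNorm a c) := by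
  have hq0 : 0 < q := by linarith
  set e := θ + 1 / 2 - 1 / q with he
  have he0 : 0 ≤ e := by
    have : 1 / q ≤ 1 / 2 := one_div_le_one_div_of_le (by norm_num) hq
    linarith
  set W := ((weightMass ((1 - θ) * q)) ^ (1 / q)).toReal with hW
  have hWtop : (weightMass ((1 - θ) * q)) ^ (1 / q) ≠ ∞ :=
    ENNReal.rpow_ne_top_of_nonneg (by positivity) (weightMass_lt_top hθq).ne
  set D := W * (2 ^ (1 / q) * Real.pi ^ θ * 2 ^ e) with hD
  have hD0 : 0 ≤ D := by positivity
  have hr1 : (2 : ℝ) ^ (e - a) < 1 := Real.rpow_lt_one_of_one_lt_of_neg (by norm_num) (by linarith)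
  have hr0 : (0 : ℝ) < 2 ^ (e - a) := by positivity
  -- A dyadic block at frequency `2^j` costs `2^(je)` and gains `2^(-ja)`, so the block estimates
  -- sum as a geometric series of ratio `2^(e - a) < 1`. The extra `1` only keeps the constant
  -- positive.
  refine ⟨D * (1 - 2 ^ (e - a))⁻¹ + 1, ?_, fun N c t₀ => ?_⟩
  · have : 0 ≤ (1 - (2 : ℝ) ^ (e - a))⁻¹ := inv_nonneg.2 (by linarith)
    positivity
  classical
  -- Dyadic decomposition: block `j` keeps the eigenfunctions `e_n` with `2^j ≤ n < 2^(j+1)`, where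
  -- `n = k + 1`.
  set f : ℕ → E N := fun j => WithLp.toLp 2 fun k => if Nat.log 2 (k + 1) = j then c k else 0 with hf
  have hfk : ∀ j k, f j k = if Nat.log 2 (k + 1) = j then c k else 0 := fun j k => rfl
  have hsum : c = ∑ j ∈ Finset.range (N + 1), f j := by
    ext k
    rw [WithLp.ofLp_sum, Finset.sum_apply]
    simp_rw [hfk]
    rw [Finset.sum_ite_eq, if_pos]
    rw [Finset.mem_range]
    exact (Nat.log_le_self 2 _).trans_lt (by omega)
  have hS : 0 ≤ sobolevNorm a c := Real.sqrt_nonneg _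
  have hblock : ∀ j, ‖f j‖ ≤ 2 ^ (-(j : ℝ) * a) * sobolevNorm a c := by
    intro j
    have ha0 : 0 ≤ a := by linarith
    refine abs_le_of_sq_le_sq' ?_ (by positivity) |>.2
    rw [mul_pow, sobolevNorm, Real.sq_sqrt (Finset.sum_nonneg fun k _ => by have := freq_pos k; positivity),
      EuclideanSpace.norm_sq_eq, Finset.mul_sum]
    refine Finset.sum_le_sum fun k _ => ?_
    rw [hfk]
    split_ifs with h
    · have hk : (2 : ℝ) ^ (j : ℝ) ≤ freq k := by
        refine le_trans ?_ (succ_le_freq k)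
        rw [Real.rpow_natCast, ← h]
        exact_mod_cast Nat.pow_log_le_self 2 (Nat.succ_ne_zero k)
      have : (1 : ℝ) ≤ (2 ^ (-(j : ℝ) * a)) ^ 2 * freq k ^ (2 * a) := by
        have h2 : (2 ^ (j : ℝ)) ^ (2 * a) ≤ freq k ^ (2 * a) := by gcongr
        calc (1 : ℝ) = (2 ^ (-(j : ℝ) * a)) ^ 2 * (2 ^ (j : ℝ)) ^ (2 * a) := by
              rw [← Real.rpow_natCast, ← Real.rpow_mul (by norm_num), ← Real.rpow_mul (by norm_num),
                ← Real.rpow_add (by norm_num)]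
              rw [show -(j : ℝ) * a * ((2 : ℕ) : ℝ) + j * (2 * a) = 0 by push_cast; ring, Real.rpow_zero]
          _ ≤ _ := by gcongr
      nlinarith [sq_nonneg ‖c k‖]
    · have := freq_pos k
      simp only [norm_zero, ne_eq, OfNat.ofNat_ne_zero, not_false_eq_true, zero_pow]
      positivity
  have hpart : ∀ j, freeNorm q t₀ (t₀ + 2) (f j) ≤
      ENNReal.ofReal (D * sobolevNorm a c * (2 ^ (e - a)) ^ j) := by
    intro j
    have hL : (1 : ℝ) ≤ 2 ^ (j + 1) := one_le_pow₀ (by norm_num)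
    refine (freeNorm_le_of_support h0 h1 hq hL (fun k hk => ?_) t₀).trans ?_
    · rw [hfk] at hk
      have h : Nat.log 2 (k + 1) = j := by by_contra h; simp [h] at hk
      have := Nat.lt_pow_succ_log_self (b := 2) (by norm_num) ((k : ℕ) + 1)
      rw [h] at this
      exact_mod_cast this.le
    · rw [← ENNReal.ofReal_toReal hWtop, ← ENNReal.ofReal_mul ENNReal.toReal_nonneg]
      refine ENNReal.ofReal_le_ofReal ?_
      calc _ ≤ W * (2 ^ (1 / q) * Real.pi ^ θ * (2 ^ (j + 1)) ^ e *
            (2 ^ (-(j : ℝ) * a) * sobolevNorm a c)) := by gcongr; exact hblock j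
        _ = _ := by
          have : (2 : ℝ) ^ (j + 1) = 2 * 2 ^ (j : ℝ) := by rw [Real.rpow_natCast]; ring
          rw [this, Real.mul_rpow (by norm_num) (by positivity), ← Real.rpow_natCast (2 ^ (e - a)),
            ← Real.rpow_mul (by norm_num), ← Real.rpow_mul (by norm_num), hD,
            show (e - a) * (j : ℝ) = j * e + -(j : ℝ) * a by ring, Real.rpow_add (by norm_num)]
          ring
  have htri : freeNorm q t₀ (t₀ + 2) c ≤
      ∑ j ∈ Finset.range (N + 1), freeNorm q t₀ (t₀ + 2) (f j) := by
    have e1 : (fun z : ℝ × R3 => toFun (freeEvol z.1 c) z.2) =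
        ∑ j ∈ Finset.range (N + 1), fun z : ℝ × R3 => toFun (freeEvol z.1 (f j)) z.2 := by
      funext z
      rw [Finset.sum_apply]
      conv_lhs => rw [hsum]
      exact toFun_freeEvol_sum _ _ _ _
    rw [freeNorm, e1]
    refine eLpNorm_sum_le (fun j _ => (continuous_toFun_freeEvol_left (f j)).aestronglyMeasurable) ?_
    exact ENNReal.one_le_ofReal.2 (by linarith)
  refine htri.trans ((Finset.sum_le_sum fun j _ => hpart j).trans ?_)
  rw [← ENNReal.ofReal_sum_of_nonneg (fun j _ => by positivity)]
  refine ENNReal.ofReal_le_ofReal ?_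
  rw [← Finset.mul_sum]
  have hg : ∑ j ∈ Finset.range (N + 1), ((2 : ℝ) ^ (e - a)) ^ j ≤ (1 - 2 ^ (e - a))⁻¹ := by
    rw [← tsum_geometric_of_lt_one hr0.le hr1]
    exact (summable_geometric_of_lt_one hr0.le hr1).sum_le_tsum _ fun j _ => by positivity
  calc _ ≤ D * sobolevNorm a c * (1 - 2 ^ (e - a))⁻¹ := by gcongr
    _ ≤ _ := by nlinarith

/-! ### Moments of random fields and Gaussian sums -/

/-- Comparison of the `L^p` and `L^q` norms (Hölder) for the measure of density `W`. -/
theorem rpow_lintegral_le_of_weight {Z : Type*} [MeasurableSpace Z] {ν : Measure Z} {h W : Z → ℝ≥0∞}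
    (hh : Measurable h) (hW : Measurable W) {p q : ℝ} (hp : 0 < p) (hpq : p ≤ q) :
    (∫⁻ z, W z * h z ^ p ∂ν) ^ (q / p) ≤ (∫⁻ z, W z * h z ^ q ∂ν) * (∫⁻ z, W z ∂ν) ^ (q / p - 1) := by
  have hq : 0 < q := hp.trans_le hpq
  have key := eLpNorm'_le_eLpNorm'_mul_rpow_measure_univ (μ := ν.withDensity W) (f := h) hp hpq
    hh.aestronglyMeasurable
  simp only [eLpNorm', enorm_eq_self] at key
  rw [lintegral_withDensity_eq_lintegral_mul _ hW (hh.pow_const p),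
    lintegral_withDensity_eq_lintegral_mul _ hW (hh.pow_const q),
    withDensity_apply _ MeasurableSet.univ, Measure.restrict_univ] at key
  have := ENNReal.rpow_le_rpow key hq.le
  rw [ENNReal.mul_rpow_of_nonneg _ _ hq.le, ← ENNReal.rpow_mul, ← ENNReal.rpow_mul,
    ← ENNReal.rpow_mul] at this
  have e1 : 1 / p * q = q / p := by ring
  have e2 : 1 / q * q = 1 := by field_simp
  have e3 : (1 / p - 1 / q) * q = q / p - 1 := by field_simp
  rw [e1, e2, e3, ENNReal.rpow_one] at this
  simpa only [Pi.mul_apply] using this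

/-- Moments of an `L^p` norm of a random field are controlled by its pointwise moments. -/
theorem lintegral_rpow_lintegral_le {Ω Z : Type*} [MeasurableSpace Ω] [MeasurableSpace Z]
    {ρ : Measure Ω} {ν : Measure Z} [SFinite ρ] [SFinite ν] {f : Ω × Z → ℝ≥0∞} (hf : Measurable f)
    {w : Z → ℝ≥0∞} (hw : Measurable w) (hw0 : ∀ᵐ z ∂ν, w z ≠ 0 ∧ w z ≠ ∞) {p q : ℝ} (hp : 0 < p)
    (hpq : p ≤ q) {B M : ℝ≥0∞} (hB : ∀ᵐ z ∂ν, ∫⁻ ω, f (ω, z) ^ q ∂ρ ≤ B * w z ^ q)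
    (hM : ∫⁻ z, w z ^ p ∂ν ≤ M) :
    ∫⁻ ω, (∫⁻ z, f (ω, z) ^ p ∂ν) ^ (q / p) ∂ρ ≤ B * M ^ (q / p) := by
  have hq : 0 < q := hp.trans_le hpq
  have hqp : 0 ≤ q / p - 1 := by rw [sub_nonneg, le_div_iff₀ hp]; linarith
  have hpt : ∀ ω, (∫⁻ z, f (ω, z) ^ p ∂ν) ^ (q / p) ≤
      (∫⁻ z, w z ^ p * (f (ω, z) / w z) ^ q ∂ν) * M ^ (q / p - 1) := by
    intro ω
    -- Dividing `f` by its size `w` turns the integral into one against `w^p ν`, a measure of mass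
    -- at most `M`. The moments of `f / w` are bounded uniformly in `z`, so Hölder followed by
    -- Tonelli loses nothing.
    have e : ∫⁻ z, f (ω, z) ^ p ∂ν = ∫⁻ z, w z ^ p * (f (ω, z) / w z) ^ p ∂ν := by
      refine lintegral_congr_ae ?_
      filter_upwards [hw0] with z hz
      rw [← ENNReal.mul_rpow_of_nonneg _ _ hp.le, ENNReal.mul_div_cancel hz.1 hz.2]
    have hm : Measurable fun z => f (ω, z) / w z := (hf.comp measurable_prodMk_left).div hw
    rw [e]
    refine (rpow_lintegral_le_of_weight hm (hw.pow_const p) hp hpq).trans ?_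
    gcongr
  have hm2 : Measurable fun y : Ω × Z => w y.2 ^ p * (f y / w y.2) ^ q :=
    ((hw.comp measurable_snd).pow_const p).mul ((hf.div (hw.comp measurable_snd)).pow_const q)
  calc _ ≤ ∫⁻ ω, (∫⁻ z, w z ^ p * (f (ω, z) / w z) ^ q ∂ν) * M ^ (q / p - 1) ∂ρ := lintegral_mono hpt
    _ = (∫⁻ ω, ∫⁻ z, w z ^ p * (f (ω, z) / w z) ^ q ∂ν ∂ρ) * M ^ (q / p - 1) := by
      exact lintegral_mul_const _ (Measurable.lintegral_prod_right' hm2)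
    _ = (∫⁻ z, ∫⁻ ω, w z ^ p * (f (ω, z) / w z) ^ q ∂ρ ∂ν) * M ^ (q / p - 1) := by
      rw [lintegral_lintegral_swap]
      exact hm2.aemeasurable
    _ ≤ (∫⁻ z, B * w z ^ p ∂ν) * M ^ (q / p - 1) := by
      gcongr ?_ * _
      refine lintegral_mono_ae ?_
      filter_upwards [hB, hw0] with z hz hz0
      have hmz : Measurable fun ω => f (ω, z) := hf.comp measurable_prodMk_right
      have hwq0 : w z ^ q ≠ 0 := by simp [ENNReal.rpow_eq_zero_iff, hz0.1, hz0.2]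
      have hwqt : w z ^ q ≠ ∞ := ENNReal.rpow_ne_top_of_nonneg hq.le hz0.2
      rw [lintegral_const_mul _ ((hmz.div_const _).pow_const q)]
      simp_rw [ENNReal.div_rpow_of_nonneg _ _ hq.le, div_eq_mul_inv]
      rw [lintegral_mul_const _ (hmz.pow_const q), mul_comm]
      gcongr
      rw [← div_eq_mul_inv]
      exact ENNReal.div_le_of_le_mul hz
    _ ≤ (B * M) * M ^ (q / p - 1) := by
      rw [lintegral_const_mul _ (hw.pow_const p)]
      gcongr
    _ = B * M ^ (q / p) := by
      rw [mul_assoc]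
      congr 1
      nth_rewrite 1 [← ENNReal.rpow_one M]
      rw [← ENNReal.rpow_add_of_nonneg _ _ zero_le_one hqp, add_sub_cancel]

theorem rpow_le_mul_exp {κ x : ℝ} (hκ : 0 < κ) (hx : 0 ≤ x) : x ^ κ ≤ κ ^ κ * Real.exp x := by
  have h : x / κ ≤ Real.exp (x / κ) := by linarith [Real.add_one_le_exp (x / κ)]
  calc x ^ κ = κ ^ κ * (x / κ) ^ κ := by
        rw [← Real.mul_rpow hκ.le (by positivity), mul_div_cancel₀ _ hκ.ne']
    _ ≤ κ ^ κ * Real.exp (x / κ) ^ κ := by gcongr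
    _ = _ := by rw [← Real.exp_mul, div_mul_cancel₀ _ hκ.ne']

/-- Powers are dominated by exponentials, `x^κ ≤ κ^κ e^x`. The resulting constant grows like
`κ^(κ/2)`, which is what makes a moment of order `Q` cost only `√Q` after taking the root. -/
theorem lintegral_abs_rpow_le_of_mgf {Ω : Type*} [MeasurableSpace Ω] {μ : Measure Ω} {X : Ω → ℝ}
    (hX : Measurable X) {V κ : ℝ} (hV : 0 < V) (hκ : 0 < κ)
    (hmgf : ∀ l : ℝ, ∫⁻ ω, ENNReal.ofReal (Real.exp (l * X ω)) ∂μ ≤ ENNReal.ofReal (Real.exp (l ^ 2 * V / 2))) :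
    ∫⁻ ω, ENNReal.ofReal (|X ω| ^ κ) ∂μ ≤ ENNReal.ofReal (2 * (Real.exp 1 * κ * V) ^ (κ / 2)) := by
  -- The choice `l² = κ / V` balances `(κ / l)^κ` against `exp(l² V / 2)`, which become `(κV)^(κ/2)`
  -- and `e^(κ/2)`.
  set l := √(κ / V) with hl
  have hl0 : 0 < l := Real.sqrt_pos.2 (by positivity)
  have hl2 : l ^ 2 = κ / V := Real.sq_sqrt (by positivity)
  have hpt : ∀ ω, |X ω| ^ κ ≤ (κ / l) ^ κ * (Real.exp (l * X ω) + Real.exp (-l * X ω)) := by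
    intro ω
    have h1 : |X ω| ^ κ = (l⁻¹) ^ κ * (l * |X ω|) ^ κ := by
      rw [← Real.mul_rpow (by positivity) (by positivity), inv_mul_cancel_left₀ hl0.ne']
    rw [h1, div_eq_mul_inv, Real.mul_rpow hκ.le (by positivity), mul_comm (κ ^ κ), mul_assoc]
    gcongr
    refine (rpow_le_mul_exp hκ (by positivity)).trans ?_
    gcongr
    rcases le_total 0 (X ω) with h | h
    · rw [abs_of_nonneg h]; linarith [Real.exp_pos (-l * X ω)]
    · rw [abs_of_nonpos h, show l * -X ω = -l * X ω by ring]; linarith [Real.exp_pos (l * X ω)]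
  calc _ ≤ ∫⁻ ω, ENNReal.ofReal ((κ / l) ^ κ) * (ENNReal.ofReal (Real.exp (l * X ω)) +
          ENNReal.ofReal (Real.exp (-l * X ω))) ∂μ := by
        refine lintegral_mono fun ω => ?_
        rw [← ENNReal.ofReal_add (by positivity) (by positivity), ← ENNReal.ofReal_mul (by positivity)]
        exact ENNReal.ofReal_le_ofReal (hpt ω)
    _ ≤ ENNReal.ofReal ((κ / l) ^ κ) * (ENNReal.ofReal (Real.exp (l ^ 2 * V / 2)) +
          ENNReal.ofReal (Real.exp (l ^ 2 * V / 2))) := by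
        rw [lintegral_const_mul _ (by fun_prop), lintegral_add_left (by fun_prop)]
        gcongr
        · exact hmgf l
        · simpa using hmgf (-l)
    _ = _ := by
        rw [← ENNReal.ofReal_add (by positivity) (by positivity), ← ENNReal.ofReal_mul (by positivity)]
        congr 1
        have e1 : l ^ 2 * V / 2 = κ / 2 := by rw [hl2]; field_simp
        have e2 : (κ / l) ^ κ = (κ * V) ^ (κ / 2) := by
          have : κ / l = √(κ * V) := by
            rw [div_eq_iff hl0.ne', hl, ← Real.sqrt_mul (by positivity),
              show κ * V * (κ / V) = κ ^ 2 by field_simp, Real.sqrt_sq hκ.le]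
          rw [this, Real.sqrt_eq_rpow, ← Real.rpow_mul (by positivity)]
          congr 1; ring
        rw [e1, e2, mul_assoc (Real.exp 1), Real.mul_rpow (x := Real.exp 1) (by positivity) (by positivity),
          ← Real.exp_mul, one_mul]
        ring

instance (N : ℕ) : IsProbabilityMeasure (gaussianLaw N) := by
  unfold gaussianLaw; infer_instance

theorem integral_exp_gaussian (l : ℝ) : ∫ x, Real.exp (l * x) ∂(gaussianReal 0 1) = Real.exp (l ^ 2 / 2) := by
  have := mgf_gaussianReal (p := gaussianReal 0 1) (X := id) (μ := 0) (v := 1) (by simp) l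
  simpa [mgf] using this

theorem integral_exp_gaussianLaw {N : ℕ} (b d : Fin N → ℝ) :
    ∫ g, Real.exp (∑ k, (b k * (g k).1 + d k * (g k).2)) ∂(gaussianLaw N) =
      Real.exp ((∑ k, (b k ^ 2 + d k ^ 2)) / 2) := by
  simp_rw [Real.exp_sum, gaussianLaw]
  rw [integral_fintype_prod_eq_prod (𝕜 := ℝ) (fun k (z : ℝ × ℝ) => Real.exp (b k * z.1 + d k * z.2)),
    Finset.sum_div, Real.exp_sum]
  refine Finset.prod_congr rfl fun k _ => ?_
  simp_rw [Real.exp_add]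
  rw [integral_prod_mul (fun x => Real.exp (b k * x)) (fun y => Real.exp (d k * y)),
    integral_exp_gaussian, integral_exp_gaussian, ← Real.exp_add]
  congr 1; ring

theorem lintegral_exp_gaussianLaw {N : ℕ} (b d : Fin N → ℝ) :
    ∫⁻ g, ENNReal.ofReal (Real.exp (∑ k, (b k * (g k).1 + d k * (g k).2))) ∂(gaussianLaw N) =
      ENNReal.ofReal (Real.exp ((∑ k, (b k ^ 2 + d k ^ 2)) / 2)) := by
  rw [← integral_exp_gaussianLaw, ofReal_integral_eq_lintegral_ofReal]
  · refine not_imp_comm.1 integral_undef ?_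
    rw [integral_exp_gaussianLaw]
    positivity
  · exact Eventually.of_forall fun _ => by positivity

theorem lintegral_abs_rpow_gaussianLaw_le {N : ℕ} (b d : Fin N → ℝ) {V κ : ℝ} (hV : 0 < V) (hκ : 0 < κ)
    (hbd : ∑ k, (b k ^ 2 + d k ^ 2) ≤ V) :
    ∫⁻ g, ENNReal.ofReal (|∑ k, (b k * (g k).1 + d k * (g k).2)| ^ κ) ∂(gaussianLaw N) ≤
      ENNReal.ofReal (2 * (Real.exp 1 * κ * V) ^ (κ / 2)) := by
  refine lintegral_abs_rpow_le_of_mgf (Measurable.mono (by fun_prop) le_rfl le_rfl) hV hκ fun l => ?_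
  have := lintegral_exp_gaussianLaw (fun k => l * b k) (fun k => l * d k)
  simp_rw [mul_assoc, ← mul_add, ← Finset.mul_sum] at this
  rw [this]
  refine ENNReal.ofReal_le_ofReal (Real.exp_le_exp.2 ?_)
  simp_rw [mul_pow, ← mul_add, ← Finset.mul_sum]
  gcongr

/-- Moments of complex Gaussian sums. -/
theorem lintegral_norm_rpow_gaussianLaw_le {N : ℕ} (z : Fin N → ℂ) {V κ : ℝ} (hV : 0 < V) (hκ : 0 < κ)
    (hz : ∑ k, ‖z k‖ ^ 2 ≤ V) :
    ∫⁻ g, ENNReal.ofReal (‖∑ k, z k * ((g k).1 + Complex.I * (g k).2)‖ ^ κ) ∂(gaussianLaw N) ≤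
      ENNReal.ofReal (4 * (4 * Real.exp 1 * κ * V) ^ (κ / 2)) := by
  have hre : ∀ g : Fin N → ℝ × ℝ, (∑ k, z k * ((g k).1 + Complex.I * (g k).2)).re =
      ∑ k, ((z k).re * (g k).1 + (-(z k).im) * (g k).2) := by
    intro g; simp [Complex.re_sum, sub_eq_add_neg, Finset.sum_add_distrib]
  have him : ∀ g : Fin N → ℝ × ℝ, (∑ k, z k * ((g k).1 + Complex.I * (g k).2)).im =
      ∑ k, ((z k).im * (g k).1 + (z k).re * (g k).2) := by
    intro g; simp [Complex.im_sum, add_comm]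
  have h1 := lintegral_abs_rpow_gaussianLaw_le (fun k => (z k).re) (fun k => -(z k).im) hV hκ (by
    refine le_trans (le_of_eq (Finset.sum_congr rfl fun k _ => ?_)) hz
    rw [Complex.sq_norm, Complex.normSq_apply]; ring)
  have h2 := lintegral_abs_rpow_gaussianLaw_le (fun k => (z k).im) (fun k => (z k).re) hV hκ (by
    refine le_trans (le_of_eq (Finset.sum_congr rfl fun k _ => ?_)) hz
    rw [Complex.sq_norm, Complex.normSq_apply]; ring)
  have hpt : ∀ w : ℂ, ‖w‖ ^ κ ≤ 2 ^ κ * (|w.re| ^ κ + |w.im| ^ κ) := by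
    intro w
    have hmax : ‖w‖ ≤ 2 * max |w.re| |w.im| :=
      (Complex.norm_le_abs_re_add_abs_im w).trans (by
        linarith [le_max_left |w.re| |w.im|, le_max_right |w.re| |w.im|])
    calc ‖w‖ ^ κ ≤ (2 * max |w.re| |w.im|) ^ κ := by gcongr
      _ = 2 ^ κ * (max |w.re| |w.im|) ^ κ := Real.mul_rpow (by norm_num) (by positivity)
      _ ≤ _ := by
        gcongr
        have p1 : 0 ≤ |w.re| ^ κ := by positivity
        have p2 : 0 ≤ |w.im| ^ κ := by positivity
        rcases max_choice |w.re| |w.im| with h | h <;> rw [h] <;> linarith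
  calc _ ≤ ∫⁻ g, ENNReal.ofReal (2 ^ κ) * (
          ENNReal.ofReal (|∑ k, ((z k).re * (g k).1 + (-(z k).im) * (g k).2)| ^ κ) +
          ENNReal.ofReal (|∑ k, ((z k).im * (g k).1 + (z k).re * (g k).2)| ^ κ)) ∂(gaussianLaw N) := by
        refine lintegral_mono fun g => ?_
        rw [← hre, ← him, ← ENNReal.ofReal_add (by positivity) (by positivity),
          ← ENNReal.ofReal_mul (by positivity)]
        exact ENNReal.ofReal_le_ofReal (hpt _)
    _ ≤ ENNReal.ofReal (2 ^ κ) * (ENNReal.ofReal (2 * (Real.exp 1 * κ * V) ^ (κ / 2)) +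
          ENNReal.ofReal (2 * (Real.exp 1 * κ * V) ^ (κ / 2))) := by
        rw [lintegral_const_mul _ (Measurable.mono (by fun_prop) le_rfl le_rfl),
          lintegral_add_left (Measurable.mono (by fun_prop) le_rfl le_rfl)]
        gcongr
    _ = _ := by
        rw [← ENNReal.ofReal_add (by positivity) (by positivity), ← ENNReal.ofReal_mul (by positivity)]
        congr 1
        rw [show 4 * Real.exp 1 * κ * V = 4 * (Real.exp 1 * κ * V) by ring,
          Real.mul_rpow (x := 4) (by norm_num) (by positivity)]
        have : (4 : ℝ) ^ (κ / 2) = 2 ^ κ := by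
          rw [show (4 : ℝ) = 2 ^ (2 : ℝ) by norm_num, ← Real.rpow_mul (by norm_num)]
          congr 1; ring
        rw [this]; ring

theorem exists_sum_rpow_freq_le {β : ℝ} (hβ : 1 < β) :
    ∃ C : ℝ, 0 < C ∧ ∀ N : ℕ, ∑ k : Fin N, freq k ^ (-β) ≤ C := by
  have hs : Summable fun k : ℕ => ((k : ℝ) + 1) ^ (-β) := by
    have := (summable_nat_add_iff 1).2 (Real.summable_nat_rpow.2 (by linarith : -β < -1))
    simpa using this
  refine ⟨∑' k : ℕ, ((k : ℝ) + 1) ^ (-β) + 1, ?_, fun N => ?_⟩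
  · have : 0 ≤ ∑' k : ℕ, ((k : ℝ) + 1) ^ (-β) := tsum_nonneg fun k => by positivity
    linarith
  · have h1 : ∑ k : Fin N, freq k ^ (-β) ≤ ∑ k : Fin N, ((k : ℝ) + 1) ^ (-β) :=
      Finset.sum_le_sum fun k _ =>
        Real.rpow_le_rpow_of_nonpos (by positivity) (succ_le_freq k) (by linarith)
    have h2 : ∑ k : Fin N, ((k : ℝ) + 1) ^ (-β) = ∑ k ∈ Finset.range N, ((k : ℝ) + 1) ^ (-β) :=
      Fin.sum_univ_eq_sum_range (fun k : ℕ => ((k : ℝ) + 1) ^ (-β)) N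
    have h3 := hs.sum_le_tsum (Finset.range N) fun k _ => by positivity
    linarith

/-- Bound for the variance of the Gaussian random series at a point. -/
theorem exists_sum_eigenfun_sq_le {ε : ℝ} (h0 : 0 < ε) (h1 : ε < 1) :
    ∃ C : ℝ, 0 < C ∧ ∀ (N : ℕ) (x : R3), x ≠ 0 →
      ∑ k : Fin N, (|eigenfun (k + 1) x| / freq k) ^ 2 ≤ C * ‖x‖ ^ (-(1 + ε)) := by
  obtain ⟨C, hC0, hC⟩ := exists_sum_rpow_freq_le (β := 1 + ε) (by linarith)
  refine ⟨C, hC0, fun N x hx => ?_⟩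
  have hr : 0 < ‖x‖ := norm_pos_iff.2 hx
  refine le_trans (Finset.sum_le_sum fun k _ => ?_) (by
    rw [← Finset.sum_mul]
    exact mul_le_mul_of_nonneg_right (hC N) (by positivity))
  have hf := freq_pos k
  -- With `θ = (1 - ε) / 2` the squared terms decay like `freq^(-(1 + ε))`, which is summable
  -- uniformly in `N`, and the singularity is only `‖x‖^(-(1 + ε))`.
  have h := abs_eigenfun_le (θ := (1 - ε) / 2) (by linarith) (by linarith) k hx
  calc _ ≤ (freq k ^ ((1 - ε) / 2) * ‖x‖ ^ ((1 - ε) / 2 - 1) / freq k) ^ 2 := by gcongr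
    _ = (freq k ^ ((1 - ε) / 2 - 1) * ‖x‖ ^ ((1 - ε) / 2 - 1)) ^ 2 := by
        rw [Real.rpow_sub_one hf.ne']; ring
    _ = _ := by
        rw [mul_pow, ← Real.rpow_natCast, ← Real.rpow_natCast, ← Real.rpow_mul hf.le, ← Real.rpow_mul hr.le]
        congr 2 <;> push_cast <;> ring

theorem measurable_randomSeries (N : ℕ) : Measurable (randomSeries N) := by
  unfold randomSeries
  have : Continuous fun g : Fin N → ℝ × ℝ => (fun k => (((g k).1 : ℂ) + Complex.I * (g k).2) / (freq k : ℂ)) := by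
    fun_prop
  exact ((PiLp.continuous_toLp 2 _).comp this).measurable

/-- The sign of the nonlinearity makes the Gibbs weight at most `1`, so every moment bound for the
Gaussian series passes to the Gibbs measure with the same constant. -/
theorem gibbsMeasure_le (α : ℝ) (χ : ℝ → ℝ) (N : ℕ) (hα : 0 < α) :
    gibbsMeasure α χ N ≤ (gaussianLaw N).map (randomSeries N) := by
  unfold gibbsMeasure
  refine Measure.map_mono ?_ (measurable_randomSeries N)
  conv_rhs => rw [← withDensity_one (μ := gaussianLaw N)]
  refine withDensity_mono (Eventually.of_forall fun g => ?_)
  rw [Pi.one_apply, ENNReal.ofReal_le_one, Real.exp_le_one_iff]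
  have : 0 ≤ ∫ x in unitBall, ‖toFun (cutoff χ N (toFun (randomSeriesRe N g))) x‖ ^ (α + 2) :=
    integral_nonneg fun x => by positivity
  have h2 : 0 ≤ 1 / (α + 2) := by positivity
  nlinarith

theorem lintegral_gibbsMeasure_le {α : ℝ} (hα : 0 < α) (χ : ℝ → ℝ) (N : ℕ) {F : E N → ℝ≥0∞}
    (hF : Measurable F) :
    ∫⁻ u, F u ∂(gibbsMeasure α χ N) ≤ ∫⁻ g, F (randomSeries N g) ∂(gaussianLaw N) :=
  (lintegral_mono' (gibbsMeasure_le α χ N hα) le_rfl).trans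
    (le_of_eq (lintegral_map hF (measurable_randomSeries N)))

instance (α : ℝ) [Fact (0 < α)] (χ : ℝ → ℝ) (N : ℕ) : IsFiniteMeasure (gibbsMeasure α χ N) := by
  have := Measure.isProbabilityMeasure_map (μ := gaussianLaw N) (measurable_randomSeries N).aemeasurable
  exact isFiniteMeasure_of_le _ (gibbsMeasure_le α χ N (Fact.out))

theorem lintegral_norm_rpow_gibbsMeasure_le {α : ℝ} (hα : 0 < α) (χ : ℝ → ℝ) {N : ℕ} (z : Fin N → ℂ)
    {V κ : ℝ} (hV : 0 < V) (hκ : 0 < κ) (hz : ∑ k, (‖z k‖ / freq k) ^ 2 ≤ V) :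
    ∫⁻ u, ENNReal.ofReal (‖∑ k, z k * u k‖ ^ κ) ∂(gibbsMeasure α χ N) ≤
      ENNReal.ofReal (4 * (4 * Real.exp 1 * κ * V) ^ (κ / 2)) := by
  refine (lintegral_gibbsMeasure_le hα χ N (Measurable.mono (by fun_prop) le_rfl le_rfl)).trans ?_
  have := lintegral_norm_rpow_gaussianLaw_le (fun k => z k / freq k) hV hκ (by
    refine le_trans (le_of_eq (Finset.sum_congr rfl fun k _ => ?_)) hz
    rw [norm_div, Complex.norm_real, Real.norm_of_nonneg (freq_pos k).le])
  refine le_trans (le_of_eq (lintegral_congr fun g => ?_)) this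
  congr 4
  funext k
  simp only [randomSeries]
  ring

/-! ### The nonlinearity in real coordinates and the potential energy -/

/-- The odd power nonlinearity `y ↦ |y|^α y`. -/
def oddPow (α y : ℝ) : ℝ := |y| ^ α * y

theorem continuous_oddPow {α : ℝ} (hα : 0 < α) : Continuous (oddPow α) := by
  unfold oddPow
  exact (continuous_abs.rpow_const fun _ => Or.inr hα.le).mul continuous_id

theorem abs_oddPow {α : ℝ} (hα : 0 < α) (y : ℝ) : |oddPow α y| = |y| ^ (α + 1) := by
  rw [oddPow, abs_mul, abs_of_nonneg (by positivity), Real.rpow_add_one' (abs_nonneg y) (by linarith)]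

theorem abs_rpow_sub_rpow_le {α R : ℝ} (hα : 0 < α) {a b : ℝ} (ha : a ∈ Set.Icc 0 R)
    (hb : b ∈ Set.Icc 0 R) : |a ^ (α + 1) - b ^ (α + 1)| ≤ (α + 1) * R ^ α * |a - b| := by
  have := (convex_Icc 0 R).norm_image_sub_le_of_norm_hasDerivWithin_le (f := fun x : ℝ => x ^ (α + 1))
    (f' := fun x => (α + 1) * x ^ α) (C := (α + 1) * R ^ α) (fun x _ => ?_) (fun x hx => ?_) hb ha
  · simpa [Real.norm_eq_abs] using this
  · have := Real.hasDerivAt_rpow_const (x := x) (p := α + 1) (Or.inr (by linarith))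
    simpa using this.hasDerivWithinAt
  · rw [Real.norm_of_nonneg (mul_nonneg (by linarith) (Real.rpow_nonneg hx.1 _))]
    have := Real.rpow_le_rpow hx.1 hx.2 hα.le
    gcongr

theorem abs_oddPow_sub_le {α R : ℝ} (hα : 0 < α) {a b : ℝ} (ha : |a| ≤ R) (hb : |b| ≤ R) :
    |oddPow α a - oddPow α b| ≤ 2 * ((α + 1) * R ^ α) * |a - b| := by
  -- Writing the odd power as a difference of powers of the positive and negative parts reduces the
  -- estimate to nonnegative arguments; this is where the factor `2` comes from.
  have e : ∀ y : ℝ, oddPow α y = (max y 0) ^ (α + 1) - (max (-y) 0) ^ (α + 1) := by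
    intro y
    have hne : α + 1 ≠ 0 := by linarith
    rcases le_total 0 y with h | h
    · rw [max_eq_left h, max_eq_right (by linarith), Real.zero_rpow hne, sub_zero, oddPow,
        abs_of_nonneg h, Real.rpow_add_one' h hne]
    · rw [max_eq_right h, max_eq_left (by linarith), Real.zero_rpow hne, oddPow,
        abs_of_nonpos h, Real.rpow_add_one' (by linarith) hne]
      ring
  have hmem : ∀ y : ℝ, |y| ≤ R → max y 0 ∈ Set.Icc 0 R := fun y hy =>
    ⟨le_max_right _ _, max_le ((le_abs_self y).trans hy) ((abs_nonneg y).trans hy)⟩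
  have hR : 0 ≤ R := (abs_nonneg a).trans ha
  have h1 := abs_rpow_sub_rpow_le hα (hmem a ha) (hmem b hb)
  have h2 := abs_rpow_sub_rpow_le hα (hmem (-a) (by rwa [abs_neg])) (hmem (-b) (by rwa [abs_neg]))
  have m1 : |max a 0 - max b 0| ≤ |a - b| := abs_max_sub_max_le_abs a b 0
  have m2 : |max (-a) 0 - max (-b) 0| ≤ |a - b| := by
    refine (abs_max_sub_max_le_abs (-a) (-b) 0).trans (le_of_eq ?_)
    rw [← abs_neg]; congr 1; ring
  have hc : 0 ≤ (α + 1) * R ^ α := by positivity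
  rw [e a, e b]
  calc _ = |((max a 0) ^ (α + 1) - (max b 0) ^ (α + 1)) - ((max (-a) 0) ^ (α + 1) - (max (-b) 0) ^ (α + 1))| := by
        congr 1; ring
    _ ≤ _ := abs_sub _ _
    _ ≤ (α + 1) * R ^ α * |a - b| + (α + 1) * R ^ α * |a - b| := by
        gcongr
        · exact h1.trans (by gcongr)
        · exact h2.trans (by gcongr)
    _ = _ := by ring

theorem abs_eigenfun_le_freq {N : ℕ} (k : Fin N) (x : R3) : |eigenfun (k + 1) x| ≤ freq k := by
  have hf := freq_pos k
  have e : eigenfun (k + 1) x = freq k / √(2 * Real.pi) * Real.sinc (freq k * ‖x‖) := by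
    simp [eigenfun, freq]
  have hs : 1 ≤ √(2 * Real.pi) := by
    rw [Real.one_le_sqrt]; linarith [Real.pi_gt_three]
  rw [e, abs_mul, abs_of_nonneg (by positivity)]
  calc _ ≤ freq k * 1 := by
        gcongr
        · exact div_le_self hf.le hs
        · exact Real.abs_sinc_le_one _
    _ = _ := mul_one _

/-- The multiplier of the spectral cut-off. -/
def mult (χ : ℝ → ℝ) (N : ℕ) (k : Fin N) : ℝ := χ (((k : ℝ) + 1) ^ 2 / (N : ℝ) ^ 2)

/-- The function `S_N (∑ h_k / (kπ) e_k)`. -/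
def field (χ : ℝ → ℝ) (N : ℕ) (h : Fin N → ℝ) (x : R3) : ℝ :=
  ∑ k, mult χ N k * (h k / freq k) * eigenfun (k + 1) x

/-- The coefficients of `S_N (|w|^α w)` for `w = S_N (∑ h_k / (kπ) e_k)`. -/
def force (α : ℝ) (χ : ℝ → ℝ) (N : ℕ) (h : Fin N → ℝ) (k : Fin N) : ℝ :=
  mult χ N k * ∫ x in unitBall, oddPow α (field χ N h x) * eigenfun (k + 1) x

/-- The potential energy. -/
def potential (α : ℝ) (χ : ℝ → ℝ) (N : ℕ) (h : Fin N → ℝ) : ℝ :=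
  1 / (α + 2) * ∫ x in unitBall, |field χ N h x| ^ (α + 2)

variable {α : ℝ} {χ : ℝ → ℝ} {N : ℕ}

instance : IsFiniteMeasure (volume.restrict unitBall) :=
  ⟨by rw [Measure.restrict_apply_univ]; exact measure_ball_lt_top⟩

theorem integrable_unitBall_of_bound {F : Type*} [NormedAddCommGroup F] {f : R3 → F}
    (hf : Continuous f) {C : ℝ} (hC : ∀ x, ‖f x‖ ≤ C) : Integrable f (volume.restrict unitBall) :=
  Integrable.of_bound hf.aestronglyMeasurable C (Eventually.of_forall hC)

theorem integrable_eigenfun_mul_eigenfun (m n : Fin N) :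
    Integrable (fun x => eigenfun (m + 1) x * eigenfun (n + 1) x) (volume.restrict unitBall) := by
  refine integrable_unitBall_of_bound ((continuous_eigenfun _).mul (continuous_eigenfun _))
    (C := freq m * freq n) fun x => ?_
  rw [norm_mul]
  exact mul_le_mul (abs_eigenfun_le_freq m x) (abs_eigenfun_le_freq n x) (norm_nonneg _) (freq_pos m).le

theorem cutoff_toFun (c : E N) (k : Fin N) : cutoff χ N (toFun c) k = mult χ N k * c k := by
  have h : ∫ x in unitBall, toFun c x * (eigenfun (k + 1) x : ℂ) = c k := by
    simp_rw [toFun, Finset.sum_mul]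
    rw [integral_finsetSum]
    · have : ∀ j : Fin N, ∫ x in unitBall, c j * (eigenfun (j + 1) x : ℂ) * (eigenfun (k + 1) x : ℂ) =
          c j * (if j = k then 1 else 0) := by
        intro j
        simp_rw [mul_assoc, ← Complex.ofReal_mul]
        rw [integral_const_mul, integral_complex_ofReal, eigenfun_orthonormal (by omega) (by omega)]
        simp only [Nat.add_right_cancel_iff, Fin.ext_iff]
        split_ifs <;> simp
      simp_rw [this]
      simp
    · intro j _
      simp_rw [mul_assoc, ← Complex.ofReal_mul]
      exact (integrable_eigenfun_mul_eigenfun j k).ofReal.const_mul _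
  simp only [cutoff, mult, h]

theorem toFun_cutoff_real (h : Fin N → ℝ) (c : E N) (hc : ∀ k, c k = (h k : ℂ) / freq k) (x : R3) :
    toFun (cutoff χ N (toFun c)) x = (field χ N h x : ℂ) := by
  simp only [toFun.eq_1 (cutoff χ N (toFun c)), cutoff_toFun, hc, field]
  push_cast
  rfl

/-- The nonlinear term is real and depends on `Re u` alone, so it acts only on `l'` and only through
`h`. This is the source of the separable structure on which Liouville's theorem relies. -/
theorem nonlinearity_apply (u : E N) (k : Fin N) :
    nonlinearity α χ N u k = ((force α χ N (fun j => freq j * (u j).re) k / freq k : ℝ) : ℂ) := by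
  have hre : (fun x => ((toFun u x).re : ℂ)) = toFun (WithLp.toLp 2 fun j => ((u j).re : ℂ) : E N) := by
    funext x
    simp [toFun, Complex.re_sum]
  have hw := toFun_cutoff_real (χ := χ) (fun j => freq j * (u j).re) (WithLp.toLp 2 fun j => ((u j).re : ℂ) : E N)
    (fun k => by
      have : (freq k : ℂ) ≠ 0 := by exact_mod_cast (freq_pos k).ne'
      simp [this])
  have e : ∀ x, ((‖(field χ N (fun j => freq j * (u j).re) x : ℂ)‖ ^ α : ℝ) : ℂ) *
      (field χ N (fun j => freq j * (u j).re) x : ℂ) * (eigenfun (k + 1) x : ℂ) =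
      ((oddPow α (field χ N (fun j => freq j * (u j).re) x) * eigenfun (k + 1) x : ℝ) : ℂ) := by
    intro x
    rw [Complex.norm_real, Real.norm_eq_abs, oddPow]
    push_cast
    rfl
  rw [nonlinearity, hre]
  simp_rw [hw]
  simp only [invSqrtLap, cutoff, force, mult, e]
  rw [integral_complex_ofReal]
  push_cast
  ring

theorem norm_toFun_cutoff_randomSeriesRe (g : Fin N → ℝ × ℝ) (x : R3) :
    ‖toFun (cutoff χ N (toFun (randomSeriesRe N g))) x‖ = |field χ N (fun k => (g k).1) x| := by
  rw [toFun_cutoff_real (fun k => (g k).1) _ (fun k => rfl), Complex.norm_real, Real.norm_eq_abs]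

theorem field_sub (h h' : Fin N → ℝ) (x : R3) :
    field χ N h x - field χ N h' x = field χ N (h - h') x := by
  simp only [field, ← Finset.sum_sub_distrib, Pi.sub_apply]
  exact Finset.sum_congr rfl fun k _ => by ring

theorem abs_field_le (h : Fin N → ℝ) (x : R3) : |field χ N h x| ≤ (∑ k, |mult χ N k|) * ‖h‖ := by
  rw [Finset.sum_mul]
  refine (Finset.abs_sum_le_sum_abs _ _).trans (Finset.sum_le_sum fun k _ => ?_)
  have hf := freq_pos k
  rw [abs_mul, abs_mul, mul_assoc]
  gcongr
  rw [abs_div, abs_of_pos hf, div_mul_eq_mul_div, div_le_iff₀ hf]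
  exact mul_le_mul (norm_le_pi_norm h k) (abs_eigenfun_le_freq k x) (abs_nonneg _) (norm_nonneg _)

theorem continuous_field : Continuous fun z : (Fin N → ℝ) × R3 => field χ N z.1 z.2 := by
  unfold field
  have := fun n => continuous_eigenfun n
  fun_prop

theorem continuous_field_right (h : Fin N → ℝ) : Continuous (field χ N h) := by
  unfold field
  have := fun n => continuous_eigenfun n
  fun_prop

theorem integrable_oddPow_field_mul (hα : 0 < α) (h : Fin N → ℝ) (k : Fin N) :
    Integrable (fun x => oddPow α (field χ N h x) * eigenfun (k + 1) x) (volume.restrict unitBall) := by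
  refine integrable_unitBall_of_bound (((continuous_oddPow hα).comp (continuous_field_right h)).mul
    (continuous_eigenfun _)) (C := ((∑ k, |mult χ N k|) * ‖h‖) ^ (α + 1) * freq k) fun x => ?_
  rw [norm_mul, Real.norm_eq_abs, Real.norm_eq_abs, abs_oddPow hα]
  gcongr
  · exact abs_field_le h x
  · exact abs_eigenfun_le_freq k x

theorem abs_force_sub_le (hα : 0 < α) {R : ℝ} {h h' : Fin N → ℝ} (hh : ‖h‖ ≤ R) (hh' : ‖h'‖ ≤ R)
    (k : Fin N) :
    |force α χ N h k - force α χ N h' k| ≤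
      |mult χ N k| * ((2 * ((α + 1) * ((∑ k, |mult χ N k|) * R) ^ α) * (∑ k, |mult χ N k|) * freq k) *
        volume.real unitBall) * ‖h - h'‖ := by
  set B := ∑ k, |mult χ N k| with hB
  have hB0 : 0 ≤ B := Finset.sum_nonneg fun _ _ => abs_nonneg _
  rw [force, force, ← mul_sub, abs_mul, mul_assoc,
    ← integral_sub (integrable_oddPow_field_mul hα h k) (integrable_oddPow_field_mul hα h' k)]
  gcongr
  have := norm_setIntegral_le_of_norm_le_const (μ := volume) (s := unitBall)
    (f := fun x => oddPow α (field χ N h x) * eigenfun (k + 1) x - oddPow α (field χ N h' x) * eigenfun (k + 1) x)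
    (C := 2 * ((α + 1) * (B * R) ^ α) * (B * ‖h - h'‖) * freq k) measure_ball_lt_top (fun x _ => by
      rw [← sub_mul, norm_mul]
      refine mul_le_mul ?_ (abs_eigenfun_le_freq k x) (norm_nonneg _) ?_
      · refine (abs_oddPow_sub_le hα (R := B * R) ?_ ?_).trans ?_
        · exact (abs_field_le h x).trans (by gcongr)
        · exact (abs_field_le h' x).trans (by gcongr)
        · rw [field_sub]
          have hR : 0 ≤ R := (norm_nonneg h).trans hh
          gcongr
          exact abs_field_le _ x
      · have hR : 0 ≤ R := (norm_nonneg h).trans hh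
        positivity)
  refine this.trans (le_of_eq ?_)
  ring

theorem force_zero (k : Fin N) : force α χ N 0 k = 0 := by
  simp [force, field, oddPow]

theorem potential_nonneg (hα : 0 < α) (h : Fin N → ℝ) : 0 ≤ potential α χ N h := by
  have : 0 ≤ ∫ x in unitBall, |field χ N h x| ^ (α + 2) := integral_nonneg fun x => by positivity
  unfold potential
  positivity

/-- The derivative of the potential energy along a `C¹` curve. -/
theorem hasDerivAt_potential (hα : 0 < α) {h h' : ℝ → Fin N → ℝ} (hh : ∀ t, HasDerivAt h (h' t) t)
    (hh' : Continuous h') (t : ℝ) :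
    HasDerivAt (fun t => potential α χ N (h t)) (∑ k, force α χ N (h t) k * (h' t k / freq k)) t := by
  set B := ∑ k, |mult χ N k| with hB
  have hB0 : 0 ≤ B := Finset.sum_nonneg fun _ _ => abs_nonneg _
  have hhc : Continuous h := continuous_iff_continuousAt.2 fun t => (hh t).continuousAt
  obtain ⟨R, hR⟩ := (isCompact_closedBall t 1).exists_bound_of_continuousOn hhc.continuousOn
  obtain ⟨R', hR'⟩ := (isCompact_closedBall t 1).exists_bound_of_continuousOn hh'.continuousOn
  have hR0 : 0 ≤ R := (norm_nonneg _).trans (hR t (Metric.mem_closedBall_self zero_le_one))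
  have hderiv : ∀ s x, HasDerivAt (fun s => |field χ N (h s) x| ^ (α + 2))
      ((α + 2) * oddPow α (field χ N (h s) x) * field χ N (h' s) x) s := by
    intro s x
    have hf : HasDerivAt (fun s => field χ N (h s) x) (field χ N (h' s) x) s := by
      unfold field
      refine HasDerivAt.fun_sum fun k _ => ?_
      exact (((hasDerivAt_pi.1 (hh s) k).div_const _).const_mul _).mul_const _
    have := (hasDerivAt_abs_rpow (field χ N (h s) x) (p := α + 2) (by linarith)).comp s hf
    refine this.congr_deriv ?_
    rw [oddPow, add_sub_cancel_right]; ring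
  have key := hasDerivAt_integral_of_dominated_loc_of_deriv_le (μ := volume.restrict unitBall)
    (F := fun s x => |field χ N (h s) x| ^ (α + 2))
    (F' := fun s x => (α + 2) * oddPow α (field χ N (h s) x) * field χ N (h' s) x)
    (x₀ := t) (s := Metric.closedBall t 1) (bound := fun _ => (α + 2) * (B * R) ^ (α + 1) * (B * R'))
    (Metric.closedBall_mem_nhds t one_pos) ?_ ?_ ?_ ?_ (integrable_const _) ?_
  · have h2 := key.2.const_mul (1 / (α + 2))
    unfold potential
    refine h2.congr_deriv ?_
    have e : ∀ x, (α + 2) * oddPow α (field χ N (h t) x) * field χ N (h' t) x =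
        ∑ k, ((α + 2) * mult χ N k * (h' t k / freq k)) * (oddPow α (field χ N (h t) x) * eigenfun (k + 1) x) := by
      intro x
      simp only [field, Finset.mul_sum]
      exact Finset.sum_congr rfl fun k _ => by ring
    simp only [e]
    rw [integral_finsetSum _ fun k _ => (integrable_oddPow_field_mul hα (h t) k).const_mul _, Finset.mul_sum]
    refine Finset.sum_congr rfl fun k _ => ?_
    rw [integral_const_mul, force]
    field_simp
  · refine Eventually.of_forall fun s => Continuous.aestronglyMeasurable ?_
    exact ((continuous_field_right (h s)).abs).rpow_const fun _ => Or.inr (by linarith)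
  · refine integrable_unitBall_of_bound (((continuous_field_right (h t)).abs).rpow_const
      fun _ => Or.inr (by linarith)) (C := (B * ‖h t‖) ^ (α + 2)) fun x => ?_
    rw [Real.norm_of_nonneg (by positivity)]
    gcongr
    exact abs_field_le _ x
  · refine Continuous.aestronglyMeasurable ?_
    exact (((continuous_oddPow hα).comp (continuous_field_right (h t))).const_mul _).mul
      (continuous_field_right (h' t))
  · refine Eventually.of_forall fun x s hs => ?_
    rw [norm_mul, norm_mul, Real.norm_of_nonneg (by linarith), Real.norm_eq_abs, abs_oddPow hα, Real.norm_eq_abs]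
    gcongr
    · exact (abs_field_le _ x).trans (by gcongr; exact hR s hs)
    · exact (abs_field_le _ x).trans (by gcongr; exact hR' s hs)
  · exact Eventually.of_forall fun x s _ => hderiv s x

/-! ### Energy conservation and the global Hamiltonian flow -/

/-- The vector field of the truncated equation in the coordinates `(h, l)`, `c_k = (h_k + i l_k) / (kπ)`. -/
def hamField (α : ℝ) (χ : ℝ → ℝ) (N : ℕ) (y : (Fin N → ℝ) × (Fin N → ℝ)) : (Fin N → ℝ) × (Fin N → ℝ) :=
  (fun k => freq k * y.2 k, fun k => -(freq k * y.1 k) - force α χ N y.1 k)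

/-- The conserved energy. -/
def energy (α : ℝ) (χ : ℝ → ℝ) (N : ℕ) (y : (Fin N → ℝ) × (Fin N → ℝ)) : ℝ :=
  (∑ k, (y.1 k ^ 2 + y.2 k ^ 2)) / 2 + potential α χ N y.1

/-- The potential is nonnegative, so the quadratic part alone is controlled by the energy. -/
theorem norm_sq_le_energy (hα : 0 < α) (y : (Fin N → ℝ) × (Fin N → ℝ)) :
    ‖y‖ ^ 2 ≤ 2 * energy α χ N y := by
  have hp := potential_nonneg (χ := χ) hα y.1
  have h0 : 0 ≤ 2 * energy α χ N y := by
    have : 0 ≤ ∑ k, (y.1 k ^ 2 + y.2 k ^ 2) := Finset.sum_nonneg fun k _ => by positivity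
    unfold energy; linarith
  rw [← Real.sq_sqrt h0]
  gcongr
  have hk : ∀ k, y.1 k ^ 2 + y.2 k ^ 2 ≤ 2 * energy α χ N y := by
    intro k
    have := Finset.single_le_sum (f := fun k => y.1 k ^ 2 + y.2 k ^ 2) (fun k _ => by positivity)
      (Finset.mem_univ k)
    unfold energy; linarith
  rw [Prod.norm_def]
  refine max_le ((pi_norm_le_iff_of_nonneg (Real.sqrt_nonneg _)).2 fun k => ?_)
    ((pi_norm_le_iff_of_nonneg (Real.sqrt_nonneg _)).2 fun k => ?_)
  · exact Real.abs_le_sqrt (by nlinarith [hk k, sq_nonneg (y.2 k)])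
  · exact Real.abs_le_sqrt (by nlinarith [hk k, sq_nonneg (y.1 k)])

/-- It is stated for an arbitrary `C¹` curve because it is applied both to true solutions and to
solutions of the clamped system. -/
theorem hasDerivAt_energy (hα : 0 < α) {y y' : ℝ → (Fin N → ℝ) × (Fin N → ℝ)}
    (hy : ∀ t, HasDerivAt y (y' t) t) (hy' : Continuous y') (t : ℝ) :
    HasDerivAt (fun t => energy α χ N (y t))
      (∑ k, ((y t).1 k * (y' t).1 k + (y t).2 k * (y' t).2 k +
        force α χ N (y t).1 k * ((y' t).1 k / freq k))) t := by
  have h1 : ∀ t, HasDerivAt (fun t => (y t).1) (y' t).1 t := fun t => (hy t).fst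
  have h2 : ∀ t, HasDerivAt (fun t => (y t).2) (y' t).2 t := fun t => (hy t).snd
  have hp := hasDerivAt_potential (χ := χ) hα h1 hy'.fst t
  have hs : HasDerivAt (fun t => (∑ k, ((y t).1 k ^ 2 + (y t).2 k ^ 2)) / 2)
      ((∑ k, (2 * (y t).1 k * (y' t).1 k + 2 * (y t).2 k * (y' t).2 k)) / 2) t := by
    refine HasDerivAt.div_const (HasDerivAt.fun_sum fun k _ => ?_) 2
    have a := (hasDerivAt_pi.1 (h1 t) k).fun_pow 2
    have b := (hasDerivAt_pi.1 (h2 t) k).fun_pow 2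
    simpa using a.fun_add b
  refine (hs.fun_add hp).congr_deriv ?_
  rw [Finset.sum_div, ← Finset.sum_add_distrib]
  exact Finset.sum_congr rfl fun k _ => by ring

theorem energy_deriv_eq_zero (y : (Fin N → ℝ) × (Fin N → ℝ)) :
    ∑ k, (y.1 k * (hamField α χ N y).1 k + y.2 k * (hamField α χ N y).2 k +
        force α χ N y.1 k * ((hamField α χ N y).1 k / freq k)) = 0 := by
  refine Finset.sum_eq_zero fun k _ => ?_
  have := (freq_pos k).ne'
  simp only [hamField]
  field_simp
  ring

/-! ### The clamped system and its identification with the true one -/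

/-- Coordinatewise truncation to `[-R, R]`. -/
def clamp {N : ℕ} (R : ℝ) (h : Fin N → ℝ) : Fin N → ℝ := fun k => max (-R) (min R (h k))

theorem norm_clamp_le {N : ℕ} {R : ℝ} (hR : 0 ≤ R) (h : Fin N → ℝ) : ‖clamp R h‖ ≤ R := by
  rw [pi_norm_le_iff_of_nonneg hR]
  exact fun k => abs_le.2 ⟨le_max_left _ _, max_le (by linarith) (min_le_left _ _)⟩

theorem clamp_of_norm_le {N : ℕ} {R : ℝ} {h : Fin N → ℝ} (hh : ‖h‖ ≤ R) : clamp R h = h := by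
  funext k
  have := abs_le.1 ((norm_le_pi_norm h k).trans hh)
  rw [clamp, min_eq_right this.2, max_eq_right this.1]

theorem abs_clamp_sub_le {N : ℕ} (R : ℝ) (h h' : Fin N → ℝ) (k : Fin N) :
    |clamp R h k - clamp R h' k| ≤ ‖h - h'‖ := by
  refine (abs_max_sub_max_le_max _ _ _ _).trans ?_
  rw [sub_self, abs_zero]
  refine max_le (norm_nonneg _) ((abs_min_sub_min_le_max _ _ _ _).trans ?_)
  rw [sub_self, abs_zero]
  exact max_le (norm_nonneg _) (norm_le_pi_norm (h - h') k)

theorem norm_clamp_sub_le {N : ℕ} (R : ℝ) (h h' : Fin N → ℝ) :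
    ‖clamp R h - clamp R h'‖ ≤ ‖h - h'‖ :=
  (pi_norm_le_iff_of_nonneg (norm_nonneg _)).2 (abs_clamp_sub_le R h h')

/-- The position component of the truncated Hamiltonian vector field. -/
def clampPos {N : ℕ} (R : ℝ) (l : Fin N → ℝ) : Fin N → ℝ := fun k => freq k * clamp R l k

/-- The momentum component of the truncated Hamiltonian vector field. -/
def clampMom (α : ℝ) (χ : ℝ → ℝ) (N : ℕ) (R : ℝ) (h : Fin N → ℝ) : Fin N → ℝ :=
  fun k => -(freq k * clamp R h k) - force α χ N (clamp R h) k

/-- Clamping `h` and `l` separately makes the field bounded and globally Lipschitz while keeping it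
separable; a cutoff in the norm of the pair would destroy the shear structure. -/
theorem exists_bounds_clamp (hα : 0 < α) (χ : ℝ → ℝ) (N : ℕ) {R : ℝ} (hR : 0 ≤ R) :
    ∃ K M : ℝ≥0, LipschitzWith K (clampPos (N := N) R) ∧ LipschitzWith K (clampMom α χ N R) ∧
      (∀ l, ‖clampPos (N := N) R l‖ ≤ M) ∧ ∀ h, ‖clampMom α χ N R h‖ ≤ M := by
  set B := ∑ k, |mult χ N k| with hB
  have hB0 : 0 ≤ B := Finset.sum_nonneg fun _ _ => abs_nonneg _
  set L : Fin N → ℝ := fun k => |mult χ N k| *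
    ((2 * ((α + 1) * (B * R) ^ α) * B * freq k) * volume.real unitBall) with hL
  have hL0 : ∀ k, 0 ≤ L k := fun k => by have := freq_pos k; positivity
  have hforce : ∀ (h h' : Fin N → ℝ) k, |force α χ N (clamp R h) k - force α χ N (clamp R h') k| ≤
      L k * ‖clamp R h - clamp R h'‖ := fun h h' k =>
    abs_force_sub_le hα (norm_clamp_le hR h) (norm_clamp_le hR h') k
  -- The force vanishes at `0`, so its Lipschitz bound also bounds its size.
  have hforce0 : ∀ (h : Fin N → ℝ) k, |force α χ N (clamp R h) k| ≤ L k * R := by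
    intro h k
    have h0 : clamp R (0 : Fin N → ℝ) = 0 := clamp_of_norm_le (by simpa using hR)
    have := hforce h 0 k
    rw [h0, force_zero, sub_zero, sub_zero] at this
    exact this.trans (by gcongr; exacts [hL0 k, norm_clamp_le hR h])
  set S := ∑ k : Fin N, (freq k + L k) with hS
  have hSk : ∀ k, freq k + L k ≤ S := fun k =>
    Finset.single_le_sum (f := fun k => freq k + L k) (fun k _ => add_nonneg (freq_pos k).le (hL0 k))
      (Finset.mem_univ k)
  have hS0 : 0 ≤ S := Finset.sum_nonneg fun k _ => add_nonneg (freq_pos k).le (hL0 k)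
  have hSR := mul_nonneg hS0 hR
  refine ⟨S.toNNReal, (S * R).toNNReal, ?_, ?_, ?_, ?_⟩
  · refine LipschitzWith.of_dist_le_mul fun l l' => ?_
    rw [dist_eq_norm, dist_eq_norm, pi_norm_le_iff_of_nonneg (by positivity)]
    intro k
    simp only [clampPos, Pi.sub_apply, ← mul_sub, norm_mul, Real.norm_eq_abs, abs_of_pos (freq_pos k),
      Real.coe_toNNReal S hS0]
    exact mul_le_mul (by linarith [hSk k, hL0 k]) (abs_clamp_sub_le R l l' k) (abs_nonneg _) hS0
  · refine LipschitzWith.of_dist_le_mul fun h h' => ?_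
    rw [dist_eq_norm, dist_eq_norm, pi_norm_le_iff_of_nonneg (by positivity)]
    intro k
    have e : (clampMom α χ N R h - clampMom α χ N R h') k = -(freq k * (clamp R h k - clamp R h' k)) -
        (force α χ N (clamp R h) k - force α χ N (clamp R h') k) := by
      simp only [clampMom, Pi.sub_apply]; ring
    rw [e, Real.norm_eq_abs, Real.coe_toNNReal S hS0]
    calc _ ≤ freq k * ‖h - h'‖ + L k * ‖h - h'‖ := by
          refine (abs_sub _ _).trans (add_le_add ?_ ?_)
          · rw [abs_neg, abs_mul, abs_of_pos (freq_pos k)]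
            exact mul_le_mul_of_nonneg_left (abs_clamp_sub_le R h h' k) (freq_pos k).le
          · exact (hforce h h' k).trans (mul_le_mul_of_nonneg_left (norm_clamp_sub_le R h h') (hL0 k))
      _ = (freq k + L k) * ‖h - h'‖ := by ring
      _ ≤ _ := by gcongr; exact hSk k
  · intro l
    rw [Real.coe_toNNReal _ hSR, pi_norm_le_iff_of_nonneg hSR]
    intro k
    rw [clampPos, norm_mul, Real.norm_of_nonneg (freq_pos k).le]
    exact mul_le_mul (by linarith [hSk k, hL0 k])
      ((norm_le_pi_norm _ k).trans (norm_clamp_le hR l)) (norm_nonneg _) hS0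
  · intro h
    rw [Real.coe_toNNReal _ hSR, pi_norm_le_iff_of_nonneg hSR]
    intro k
    calc _ ≤ freq k * R + L k * R := by
          refine (abs_sub _ _).trans (add_le_add ?_ (hforce0 h k))
          rw [abs_neg, abs_mul, abs_of_pos (freq_pos k)]
          exact mul_le_mul_of_nonneg_left ((norm_le_pi_norm _ k).trans (norm_clamp_le hR h)) (freq_pos k).le
      _ = (freq k + L k) * R := by ring
      _ ≤ _ := by gcongr; exact hSk k

theorem clamp_field_eq {R : ℝ} {y : (Fin N → ℝ) × (Fin N → ℝ)} (hy : ‖y‖ ≤ R) :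
    (clampPos R y.2, clampMom α χ N R y.1) = hamField α χ N y := by
  have h1 := (norm_fst_le y).trans hy
  have h2 := (norm_snd_le y).trans hy
  refine Prod.ext (funext fun k => ?_) (funext fun k => ?_)
  · simp only [clampPos, hamField, clamp_of_norm_le h2]
  · simp only [clampMom, hamField, clamp_of_norm_le h1]

/-- Near a given `h` the force is recovered from the clamped momentum field, which is Lipschitz. -/
theorem continuous_force (hα : 0 < α) (k : Fin N) : Continuous fun h : Fin N → ℝ => force α χ N h k := by
  rw [continuous_iff_continuousAt]
  intro h
  obtain ⟨K, M, -, hK, -, -⟩ := exists_bounds_clamp hα χ N (R := ‖h‖ + 1) (by positivity)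
  have hc : Continuous fun h' : Fin N → ℝ =>
      -(clampMom α χ N (‖h‖ + 1) h' k) - freq k * clamp (‖h‖ + 1) h' k := by
    refine Continuous.sub ((continuous_apply k).comp hK.continuous).neg (continuous_const.mul ?_)
    unfold clamp
    fun_prop
  refine hc.continuousAt.congr ?_
  have : ∀ᶠ h' in 𝓝 h, ‖h'‖ < ‖h‖ + 1 := (continuous_norm.tendsto h).eventually (gt_mem_nhds (by linarith))
  filter_upwards [this] with h' hh'
  rw [clampMom, clamp_of_norm_le hh'.le]
  ring

theorem continuous_hamField (hα : 0 < α) : Continuous (hamField α χ N) := by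
  have := fun k => continuous_force (χ := χ) (N := N) hα k
  unfold hamField
  refine Continuous.prodMk (continuous_pi fun k => by fun_prop) (continuous_pi fun k => ?_)
  exact ((continuous_const.mul ((continuous_apply k).comp continuous_fst)).neg).sub
    ((this k).comp continuous_fst)

/-- `y` solves the truncated equation in the coordinates `(h, l)`. -/
def IsHamSolution (α : ℝ) (χ : ℝ → ℝ) (N : ℕ) (y : ℝ → (Fin N → ℝ) × (Fin N → ℝ)) : Prop :=
  ∀ t, HasDerivAt y (hamField α χ N (y t)) t

theorem IsHamSolution.continuous {y : ℝ → (Fin N → ℝ) × (Fin N → ℝ)} (hy : IsHamSolution α χ N y) :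
    Continuous y := continuous_iff_continuousAt.2 fun t => (hy t).continuousAt

theorem IsHamSolution.energy_eq (hα : 0 < α) {y : ℝ → (Fin N → ℝ) × (Fin N → ℝ)}
    (hy : IsHamSolution α χ N y) (t : ℝ) : energy α χ N (y t) = energy α χ N (y 0) := by
  have hd : ∀ t, HasDerivAt (fun t => energy α χ N (y t)) 0 t := by
    intro t
    have := hasDerivAt_energy (χ := χ) hα hy ((continuous_hamField hα).comp hy.continuous) t
    exact this.congr_deriv (energy_deriv_eq_zero (y t))
  exact is_const_of_deriv_eq_zero (fun t => (hd t).differentiableAt) (fun t => (hd t).deriv) t 0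

theorem norm_lt_of_energy_lt (hα : 0 < α) {R : ℝ} (hR : 0 ≤ R) {y : (Fin N → ℝ) × (Fin N → ℝ)}
    (h : 2 * energy α χ N y < R ^ 2) : ‖y‖ < R :=
  lt_of_pow_lt_pow_left₀ 2 hR ((norm_sq_le_energy hα y).trans_lt h)

theorem IsHamSolution.clamp_solution (hα : 0 < α) {R : ℝ} (hR : 0 ≤ R)
    {y : ℝ → (Fin N → ℝ) × (Fin N → ℝ)} (hy : IsHamSolution α χ N y)
    (h : 2 * energy α χ N (y 0) < R ^ 2) (t : ℝ) :
    HasDerivAt y (clampPos R (y t).2, clampMom α χ N R (y t).1) t := by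
  rw [clamp_field_eq]
  · exact hy t
  · exact (norm_lt_of_energy_lt hα hR (by rwa [hy.energy_eq hα t])).le

/-- Continuity argument: while the energy keeps its initial value the solution stays strictly inside
the ball of radius `R`, where the clamp is inactive, so the energy goes on being conserved. -/
theorem isHamSolution_of_clamp_solution (hα : 0 < α) {R : ℝ} (hR : 0 ≤ R)
    {y : ℝ → (Fin N → ℝ) × (Fin N → ℝ)}
    (hy : ∀ t, HasDerivAt y (clampPos R (y t).2, clampMom α χ N R (y t).1) t)
    (h : 2 * energy α χ N (y 0) < R ^ 2) : IsHamSolution α χ N y := by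
  obtain ⟨K, M, h1, h2, -, -⟩ := exists_bounds_clamp hα χ N hR
  have hyc : Continuous y := continuous_iff_continuousAt.2 fun t => (hy t).continuousAt
  have hd := fun t => hasDerivAt_energy (χ := χ) hα hy
    ((h1.continuous.comp hyc.snd).prodMk (h2.continuous.comp hyc.fst)) t
  have hE : Continuous fun t => energy α χ N (y t) := continuous_iff_continuousAt.2 fun t => (hd t).continuousAt
  -- Around such a time the norm stays below `R` on a small interval, where the energy has zero
  -- derivative; this gives openness.
  have hclopen : IsClopen {t | energy α χ N (y t) = energy α χ N (y 0)} := by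
    refine ⟨isClosed_eq hE continuous_const, isOpen_iff_mem_nhds.2 fun t ht => ?_⟩
    replace ht : energy α χ N (y t) = energy α χ N (y 0) := ht
    have hlt : ‖y t‖ < R := norm_lt_of_energy_lt hα hR (by rwa [ht])
    obtain ⟨δ, hδ, hball⟩ := Metric.eventually_nhds_iff_ball.1
      ((hyc.norm.tendsto t).eventually (gt_mem_nhds hlt))
    refine Filter.mem_of_superset (Metric.ball_mem_nhds t hδ) fun s hs => ?_
    have hz : ∀ r ∈ Metric.ball t δ, HasDerivAt (fun t => energy α χ N (y t)) 0 r := by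
      intro r hr
      refine (hd r).congr_deriv ?_
      rw [clamp_field_eq (hball r hr).le]
      exact energy_deriv_eq_zero (y r)
    have := Metric.isOpen_ball.is_const_of_deriv_eq_zero (convex_ball t δ).isPreconnected
      (fun r hr => (hz r hr).differentiableAt.differentiableWithinAt) (fun r hr => (hz r hr).deriv)
      hs (Metric.mem_ball_self hδ)
    exact this.trans ht
  have huniv := hclopen.eq_univ ⟨0, rfl⟩
  intro t
  have ht : energy α χ N (y t) = energy α χ N (y 0) := by
    have : t ∈ {t | energy α χ N (y t) = energy α χ N (y 0)} := huniv ▸ Set.mem_univ t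
    exact this
  rw [← clamp_field_eq (R := R) (norm_lt_of_energy_lt hα hR (by rwa [ht])).le]
  exact hy t

theorem exists_clampFlow (hα : 0 < α) (χ : ℝ → ℝ) (N : ℕ) {R : ℝ} (hR : 0 ≤ R) :
    ∃ Φ : ℝ → (Fin N → ℝ) × (Fin N → ℝ) → (Fin N → ℝ) × (Fin N → ℝ), (∀ y, Φ 0 y = y) ∧
      ∀ y t, HasDerivAt (fun t => Φ t y) (clampPos R (Φ t y).2, clampMom α χ N R (Φ t y).1) t := by
  obtain ⟨K, M, h1, h2, h3, h4⟩ := exists_bounds_clamp hα χ N hR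
  have := fun y => exists_hasDerivAt_of_lipschitz_of_bounded (lipschitzWith_separable h1 h2)
    (M := M) (fun z => max_le (h3 _) (h4 _)) y
  choose Φ hΦ0 hΦ using this
  exact ⟨fun t y => Φ y t, hΦ0, hΦ⟩

theorem exists_isHamSolution (hα : 0 < α) (χ : ℝ → ℝ) (N : ℕ) (y₀ : (Fin N → ℝ) × (Fin N → ℝ)) :
    ∃ y, y 0 = y₀ ∧ IsHamSolution α χ N y := by
  have hE : 0 ≤ 2 * energy α χ N y₀ := (sq_nonneg _).trans (norm_sq_le_energy hα y₀)
  -- For `E ≥ 0` one has `2E < (2E + 1)²`, so this radius is admissible for the initial energy.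
  obtain ⟨Φ, h0, hΦ⟩ := exists_clampFlow hα χ N (R := 2 * energy α χ N y₀ + 1) (by linarith)
  refine ⟨fun t => Φ t y₀, h0 y₀, isHamSolution_of_clamp_solution hα (by linarith) (hΦ y₀) ?_⟩
  rw [h0]
  nlinarith

theorem IsHamSolution.eq_of_clamp_solution (hα : 0 < α) {R : ℝ} (hR : 0 ≤ R)
    {y z : ℝ → (Fin N → ℝ) × (Fin N → ℝ)} (hy : IsHamSolution α χ N y)
    (h : 2 * energy α χ N (y 0) < R ^ 2)
    (hz : ∀ t, HasDerivAt z (clampPos R (z t).2, clampMom α χ N R (z t).1) t) (h0 : y 0 = z 0) :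
    y = z := by
  obtain ⟨K, M, h1, h2, -, -⟩ := exists_bounds_clamp hα χ N hR
  exact ODE_solution_unique_univ (v := fun _ y => (clampPos R y.2, clampMom α χ N R y.1))
    (s := fun _ => Set.univ) (K := K) (t₀ := 0)
    (fun t => (lipschitzWith_separable h1 h2).lipschitzOnWith)
    (fun t => ⟨hy.clamp_solution hα hR h t, trivial⟩) (fun t => ⟨hz t, trivial⟩) h0

theorem IsHamSolution.unique (hα : 0 < α) {y z : ℝ → (Fin N → ℝ) × (Fin N → ℝ)}
    (hy : IsHamSolution α χ N y) (hz : IsHamSolution α χ N z) (h0 : y 0 = z 0) : y = z := by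
  have hE : 0 ≤ 2 * energy α χ N (y 0) := (sq_nonneg _).trans (norm_sq_le_energy hα (y 0))
  have h : 2 * energy α χ N (y 0) < (2 * energy α χ N (y 0) + 1) ^ 2 := by nlinarith
  exact hy.eq_of_clamp_solution hα (by linarith) h
    (hz.clamp_solution hα (by linarith) (by rwa [← h0])) h0

/-- The global flow in the coordinates `(h, l)`. -/
def hamFlow (α : ℝ) (χ : ℝ → ℝ) (N : ℕ) (t : ℝ) (y : (Fin N → ℝ) × (Fin N → ℝ)) :
    (Fin N → ℝ) × (Fin N → ℝ) :=
  Classical.epsilon (fun z : ℝ → (Fin N → ℝ) × (Fin N → ℝ) => z 0 = y ∧ IsHamSolution α χ N z) t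

theorem hamFlow_spec (hα : 0 < α) (y : (Fin N → ℝ) × (Fin N → ℝ)) :
    hamFlow α χ N 0 y = y ∧ IsHamSolution α χ N fun t => hamFlow α χ N t y :=
  Classical.epsilon_spec (exists_isHamSolution hα χ N y)

theorem hamFlow_eq_of_clampFlow (hα : 0 < α) {R : ℝ} (hR : 0 ≤ R)
    {Φ : ℝ → (Fin N → ℝ) × (Fin N → ℝ) → (Fin N → ℝ) × (Fin N → ℝ)} (h0 : ∀ y, Φ 0 y = y)
    (hΦ : ∀ y t, HasDerivAt (fun t => Φ t y) (clampPos R (Φ t y).2, clampMom α χ N R (Φ t y).1) t)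
    {y : (Fin N → ℝ) × (Fin N → ℝ)} (hy : 2 * energy α χ N y < R ^ 2) (t : ℝ) :
    hamFlow α χ N t y = Φ t y := by
  obtain ⟨e0, hs⟩ := hamFlow_spec (χ := χ) hα y
  exact congr_fun (hs.eq_of_clamp_solution hα hR (by rwa [e0]) (hΦ y) (by rw [e0, h0])) t

theorem energy_hamFlow (hα : 0 < α) (t : ℝ) (y : (Fin N → ℝ) × (Fin N → ℝ)) :
    energy α χ N (hamFlow α χ N t y) = energy α χ N y := by
  obtain ⟨e0, hs⟩ := hamFlow_spec (χ := χ) hα y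
  rw [hs.energy_eq hα t, e0]

/-- For each initial point the clamped flows agree with the true flow once `R` is large enough, so
the latter is a pointwise limit of measurable maps. -/
theorem measurable_hamFlow (hα : 0 < α) (t : ℝ) : Measurable (hamFlow α χ N t) := by
  have hex := fun R : ℕ => exists_clampFlow hα χ N (R := (R : ℝ)) R.cast_nonneg
  choose Φ h0 hΦ using hex
  refine measurable_of_tendsto_metrizable (f := fun R : ℕ => Φ R t) (fun R => ?_) ?_
  · obtain ⟨K, M, h1, h2, h3, h4⟩ := exists_bounds_clamp hα χ N (R := (R : ℝ)) R.cast_nonneg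
    exact measurable_flow_of_separable h1 h2 h3 h4 (h0 R) (hΦ R) t
  · rw [tendsto_pi_nhds]
    intro y
    refine tendsto_const_nhds.congr' ?_
    have hE : 0 ≤ 2 * energy α χ N y := (sq_nonneg _).trans (norm_sq_le_energy hα y)
    refine eventually_atTop.2 ⟨⌈2 * energy α χ N y⌉₊ + 1, fun R hR => ?_⟩
    refine hamFlow_eq_of_clampFlow hα R.cast_nonneg (h0 R) (hΦ R) ?_ t
    have h1 := Nat.le_ceil (2 * energy α χ N y)
    have h2 : ((⌈2 * energy α χ N y⌉₊ : ℝ)) + 1 ≤ R := by exact_mod_cast hR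
    nlinarith

/-! ### Transfer of the flow to `E_N` -/

/-- The element of `E_N` with coordinates `(h, l)`. -/
def ofCoord {N : ℕ} (y : (Fin N → ℝ) × (Fin N → ℝ)) : E N :=
  WithLp.toLp 2 fun k => ((y.1 k : ℂ) + Complex.I * y.2 k) / freq k

/-- The coordinates `(h, l)` of an element of `E_N`. -/
def toCoord {N : ℕ} (u : E N) : (Fin N → ℝ) × (Fin N → ℝ) :=
  (fun k => freq k * (u k).re, fun k => freq k * (u k).im)

theorem ofCoord_toCoord (u : E N) : ofCoord (toCoord u) = u := by
  ext k
  have : (freq k : ℂ) ≠ 0 := by exact_mod_cast (freq_pos k).ne'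
  simp only [ofCoord, toCoord]
  rw [div_eq_iff this]
  push_cast
  conv_rhs => rw [← Complex.re_add_im (u k)]
  ring

theorem ofCoord_apply_re (y : (Fin N → ℝ) × (Fin N → ℝ)) (k : Fin N) : (ofCoord y k).re = y.1 k / freq k := by
  simp [ofCoord, Complex.div_ofReal_re]

theorem ofCoord_apply_im (y : (Fin N → ℝ) × (Fin N → ℝ)) (k : Fin N) : (ofCoord y k).im = y.2 k / freq k := by
  simp [ofCoord, Complex.div_ofReal_im]

theorem toCoord_ofCoord (y : (Fin N → ℝ) × (Fin N → ℝ)) : toCoord (ofCoord y) = y := by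
  refine Prod.ext (funext fun k => ?_) (funext fun k => ?_)
  · simp only [toCoord, ofCoord_apply_re, mul_div_cancel₀ _ (freq_pos k).ne']
  · simp only [toCoord, ofCoord_apply_im, mul_div_cancel₀ _ (freq_pos k).ne']

theorem continuous_ofCoord : Continuous (ofCoord (N := N)) := by
  unfold ofCoord
  exact (PiLp.continuous_toLp 2 _).comp (continuous_pi fun k => by fun_prop)

theorem continuous_toCoord : Continuous (toCoord (N := N)) := by
  unfold toCoord
  refine Continuous.prodMk (continuous_pi fun k => ?_) (continuous_pi fun k => ?_)
  · exact continuous_const.mul (Complex.continuous_re.comp (by fun_prop))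
  · exact continuous_const.mul (Complex.continuous_im.comp (by fun_prop))

theorem hasDerivAt_toLp_pi {f : ℝ → Fin N → ℂ} {f' : Fin N → ℂ} {t : ℝ}
    (h : ∀ k, HasDerivAt (fun s => f s k) (f' k) t) :
    HasDerivAt (fun s => (WithLp.toLp 2 (f s) : E N)) (WithLp.toLp 2 f') t :=
  ((PiLp.continuousLinearEquiv 2 ℝ (fun _ : Fin N => ℂ)).symm.toContinuousLinearMap.hasFDerivAt.comp_hasDerivAt
    t (hasDerivAt_pi.2 h))

theorem hasDerivAt_apply {u : ℝ → E N} {u' : E N} {t : ℝ} (h : HasDerivAt u u' t) (k : Fin N) :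
    HasDerivAt (fun s => u s k) (u' k) t :=
  hasDerivAt_pi.1 ((PiLp.continuousLinearEquiv 2 ℝ (fun _ : Fin N => ℂ)).toContinuousLinearMap.hasFDerivAt.comp_hasDerivAt
    t h) k

theorem IsHamSolution.isTruncatedSolution {y : ℝ → (Fin N → ℝ) × (Fin N → ℝ)}
    (hy : IsHamSolution α χ N y) :
    IsTruncatedSolution α χ N (ofCoord (y 0)) fun t => ofCoord (y t) := by
  have hd : ∀ t, HasDerivAt (fun t => ofCoord (y t)) (ofCoord (hamField α χ N (y t))) t := by
    intro t
    refine hasDerivAt_toLp_pi fun k => ?_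
    have a := (hasDerivAt_pi.1 (hy t).fst k).ofReal_comp
    have b := (hasDerivAt_pi.1 (hy t).snd k).ofReal_comp
    exact (a.fun_add (b.const_mul Complex.I)).div_const _
  refine ⟨fun t => (hd t).differentiableAt, fun t => ?_, rfl⟩
  rw [(hd t).deriv]
  ext k
  have hne : (freq k : ℂ) ≠ 0 := by exact_mod_cast (freq_pos k).ne'
  have hh : (fun j => freq j * (ofCoord (y t) j).re) = (y t).1 := congr_arg Prod.fst (toCoord_ofCoord (y t))
  have hn := nonlinearity_apply (α := α) (χ := χ) (ofCoord (y t)) k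
  rw [hh] at hn
  simp only [PiLp.sub_apply, PiLp.smul_apply, PiLp.zero_apply, hn]
  simp only [sqrtLap, ofCoord, hamField, smul_eq_mul]
  push_cast
  field_simp
  linear_combination (-(freq k : ℂ) * (y t).1 k - force α χ N (y t).1 k) * Complex.I_sq

theorem IsTruncatedSolution.hasDerivAt {u₀ : E N} {u : ℝ → E N} (hu : IsTruncatedSolution α χ N u₀ u)
    (t : ℝ) (k : Fin N) : HasDerivAt (fun s => u s k)
      (-Complex.I * (freq k * u t k + nonlinearity α χ N (u t) k)) t := by
  have h := hasDerivAt_apply (hu.differentiable t).hasDerivAt k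
  refine h.congr_deriv ?_
  have e := congr_arg (fun v : E N => v k) (hu.equation t)
  simp only [PiLp.sub_apply, PiLp.smul_apply, PiLp.zero_apply, sqrtLap, smul_eq_mul] at e
  linear_combination (-Complex.I) * e + (deriv u t k) * Complex.I_sq

theorem IsTruncatedSolution.isHamSolution {u₀ : E N} {u : ℝ → E N}
    (hu : IsTruncatedSolution α χ N u₀ u) : IsHamSolution α χ N fun t => toCoord (u t) := by
  intro t
  have hk := fun k => hu.hasDerivAt t k
  have hre : ∀ k, HasDerivAt (fun s => (u s k).re) (freq k * (u t k).im) t := fun k => by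
    have := (Complex.reCLM.hasFDerivAt (x := u t k)).comp_hasDerivAt t (hk k)
    refine this.congr_deriv ?_
    rw [nonlinearity_apply]
    simp
  have him : ∀ k, HasDerivAt (fun s => (u s k).im)
      (-(freq k * (u t k).re) - force α χ N (toCoord (u t)).1 k / freq k) t := fun k => by
    have := (Complex.imCLM.hasFDerivAt (x := u t k)).comp_hasDerivAt t (hk k)
    refine this.congr_deriv ?_
    rw [nonlinearity_apply]
    simp [toCoord, -Complex.ofReal_div]
    ring
  refine HasDerivAt.prodMk (hasDerivAt_pi.2 fun k => ?_) (hasDerivAt_pi.2 fun k => ?_)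
  · exact ((hre k).const_mul (freq k))
  · refine ((him k).const_mul (freq k)).congr_deriv ?_
    have := (freq_pos k).ne'
    simp only [toCoord]
    field_simp

theorem existsUnique_isTruncatedSolution (hα : 0 < α) (u₀ : E N) :
    ∃! u : ℝ → E N, IsTruncatedSolution α χ N u₀ u := by
  refine ⟨fun t => ofCoord (hamFlow α χ N t (toCoord u₀)), ?_, fun v hv => ?_⟩
  · obtain ⟨h0, hs⟩ := hamFlow_spec (χ := χ) hα (toCoord u₀)
    have := hs.isTruncatedSolution
    simpa only [h0, ofCoord_toCoord] using this
  · obtain ⟨h0, hs⟩ := hamFlow_spec (χ := χ) hα (toCoord u₀)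
    have := hv.isHamSolution.unique hα hs (by rw [h0, hv.initial])
    funext t
    rw [← congr_fun this t, ofCoord_toCoord]

theorem truncatedFlow_spec (hα : 0 < α) (u₀ : E N) :
    IsTruncatedSolution α χ N u₀ fun t => truncatedFlow α χ N t u₀ :=
  Classical.epsilon_spec (existsUnique_isTruncatedSolution (χ := χ) hα u₀).exists

theorem truncatedFlow_eq (hα : 0 < α) (t : ℝ) (u₀ : E N) :
    truncatedFlow α χ N t u₀ = ofCoord (hamFlow α χ N t (toCoord u₀)) := by
  have h := (truncatedFlow_spec (χ := χ) hα u₀)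
  obtain ⟨h0, hs⟩ := hamFlow_spec (χ := χ) hα (toCoord u₀)
  have := h.isHamSolution.unique hα hs (by rw [h0, h.initial])
  rw [← congr_fun this t, ofCoord_toCoord]

theorem measurable_truncatedFlow (hα : 0 < α) (t : ℝ) : Measurable (truncatedFlow α χ N t) := by
  have : truncatedFlow α χ N t = ofCoord ∘ hamFlow α χ N t ∘ toCoord :=
    funext fun u => truncatedFlow_eq hα t u
  rw [this]
  exact continuous_ofCoord.measurable.comp ((measurable_hamFlow hα t).comp continuous_toCoord.measurable)

theorem continuous_truncatedFlow_time (hα : 0 < α) (u₀ : E N) :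
    Continuous fun t => truncatedFlow α χ N t u₀ :=
  (truncatedFlow_spec hα u₀).differentiable.continuous

/-- Continuity in time and measurability in the data give joint measurability (Carathéodory). It is
needed for Tonelli when moments of space-time norms of the flow are taken. -/
theorem measurable_uncurry_truncatedFlow (hα : 0 < α) :
    Measurable fun z : ℝ × E N => truncatedFlow α χ N z.1 z.2 := by
  have := measurable_uncurry_of_continuous_of_measurable (u := truncatedFlow α χ N)
    (fun u => continuous_truncatedFlow_time hα u) (fun t => measurable_truncatedFlow hα t)
  exact this

/-! ### The Gibbs density and its invariance -/

theorem pi_gaussianReal_eq_withDensity (N : ℕ) :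
    Measure.pi (fun _ : Fin N => gaussianReal 0 1) =
      (volume : Measure (Fin N → ℝ)).withDensity fun h => ENNReal.ofReal (∏ k, gaussianPDFReal 0 1 (h k)) := by
  refine Measure.pi_eq fun s hs => ?_
  have hmeas : MeasurableSet (Set.univ.pi s) := MeasurableSet.univ_pi hs
  rw [withDensity_apply _ hmeas, ← lintegral_indicator hmeas]
  have e : (Set.univ.pi s).indicator (fun h : Fin N → ℝ => ENNReal.ofReal (∏ k, gaussianPDFReal 0 1 (h k))) =
      fun h => ENNReal.ofReal (∏ k, (s k).indicator (gaussianPDFReal 0 1) (h k)) := by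
    funext h
    by_cases hh : h ∈ Set.univ.pi s
    · rw [Set.indicator_of_mem hh]
      congr 1
      exact Finset.prod_congr rfl fun k _ => (Set.indicator_of_mem (hh k trivial) _).symm
    · rw [Set.indicator_of_notMem hh]
      simp only [Set.mem_univ_pi, not_forall] at hh
      obtain ⟨k, hk⟩ := hh
      rw [Finset.prod_eq_zero (Finset.mem_univ k) (Set.indicator_of_notMem hk _), ENNReal.ofReal_zero]
  have hint : ∀ k, Integrable ((s k).indicator (gaussianPDFReal 0 1)) :=
    fun k => (integrable_gaussianPDFReal 0 1).indicator (hs k)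
  have hnn : ∀ k x, 0 ≤ (s k).indicator (gaussianPDFReal 0 1) x :=
    fun k x => Set.indicator_nonneg (fun y _ => gaussianPDFReal_nonneg 0 1 y) x
  rw [e, ← ofReal_integral_eq_lintegral_ofReal]
  · rw [volume_pi, integral_fintype_prod_eq_prod (𝕜 := ℝ) (fun k => (s k).indicator (gaussianPDFReal 0 1)),
      ENNReal.ofReal_prod_of_nonneg fun k _ => integral_nonneg (hnn k)]
    refine Finset.prod_congr rfl fun k _ => ?_
    rw [integral_indicator (hs k), gaussianReal_apply_eq_integral 0 one_ne_zero]
  · exact Integrable.fintype_prod (f := fun k => (s k).indicator (gaussianPDFReal 0 1)) hint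
  · exact Eventually.of_forall fun h => Finset.prod_nonneg fun k _ => hnn k _

theorem measurable_potential (hα : 0 < α) : Measurable (potential α χ N) := by
  have hc : Continuous fun z : (Fin N → ℝ) × R3 => |field χ N z.1 z.2| ^ (α + 2) :=
    continuous_field.abs.rpow_const fun _ => Or.inr (by linarith)
  exact (hc.stronglyMeasurable.integral_prod_right' (ν := volume.restrict unitBall)).measurable.const_mul _

theorem measurable_energy (hα : 0 < α) : Measurable (energy α χ N) := by
  have : Measurable fun y : (Fin N → ℝ) × (Fin N → ℝ) => potential α χ N y.1 :=
    (measurable_potential hα).comp measurable_fst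
  unfold energy
  exact Measurable.add (by fun_prop) this

/-- The density of the Gibbs measure in the coordinates `(h, l)`. -/
def gibbsDensity (α : ℝ) (χ : ℝ → ℝ) (N : ℕ) (y : (Fin N → ℝ) × (Fin N → ℝ)) : ℝ≥0∞ :=
  ENNReal.ofReal ((√(2 * Real.pi))⁻¹ ^ (2 * N) * Real.exp (-energy α χ N y))

theorem measurable_gibbsDensity (hα : 0 < α) : Measurable (gibbsDensity α χ N) :=
  ((measurable_energy hα).neg.exp.const_mul _).ennreal_ofReal

/-- The Gaussian densities supply the quadratic part of the energy and the Gibbs weight supplies the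
potential. After the pairs `(h_k, l_k)` are regrouped as `(h, l)`, the density depends on the energy
alone. -/
theorem lintegral_gibbsMeasure (hα : 0 < α) {F : E N → ℝ≥0∞} (hF : Measurable F) :
    ∫⁻ u, F u ∂(gibbsMeasure α χ N) =
      ∫⁻ y, gibbsDensity α χ N y * F (ofCoord y) ∂((volume : Measure (Fin N → ℝ)).prod volume) := by
  set e := MeasurableEquiv.arrowProdEquivProdArrow ℝ ℝ (Fin N) with he
  have hpres : MeasurePreserving e (gaussianLaw N)
      ((Measure.pi fun _ : Fin N => gaussianReal 0 1).prod (Measure.pi fun _ : Fin N => gaussianReal 0 1)) :=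
    measurePreserving_arrowProdEquivProdArrow ℝ ℝ (Fin N) _ _
  have hW : Measurable fun y : (Fin N → ℝ) × (Fin N → ℝ) =>
      ENNReal.ofReal (Real.exp (-potential α χ N y.1)) :=
    ((measurable_potential hα).comp measurable_fst).neg.exp.ennreal_ofReal
  have hFc : Measurable fun y : (Fin N → ℝ) × (Fin N → ℝ) => F (ofCoord y) :=
    hF.comp continuous_ofCoord.measurable
  have hweight : (fun g : Fin N → ℝ × ℝ => ENNReal.ofReal (Real.exp (-(1 / (α + 2)) *
      ∫ x in unitBall, ‖toFun (cutoff χ N (toFun (randomSeriesRe N g))) x‖ ^ (α + 2)))) =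
      fun g => ENNReal.ofReal (Real.exp (-potential α χ N (e g).1)) := by
    funext g
    simp_rw [norm_toFun_cutoff_randomSeriesRe]
    rw [neg_mul]
    rfl
  have hpdf : Measurable fun h : Fin N → ℝ => ENNReal.ofReal (∏ k, gaussianPDFReal 0 1 (h k)) := by
    refine (Finset.measurable_prod _ fun k _ => ?_).ennreal_ofReal
    exact (measurable_gaussianPDFReal 0 1).comp (measurable_pi_apply k)
  have hWe : Measurable fun g : Fin N → ℝ × ℝ => ENNReal.ofReal (Real.exp (-potential α χ N (e g).1)) :=
    hW.comp e.measurable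
  have hFr : Measurable fun g : Fin N → ℝ × ℝ => F (randomSeries N g) :=
    hF.comp (measurable_randomSeries N)
  rw [gibbsMeasure, lintegral_map hF (measurable_randomSeries N), hweight,
    lintegral_withDensity_eq_lintegral_mul _ hWe hFr]
  have e1 : ∫⁻ g, ((fun g => ENNReal.ofReal (Real.exp (-potential α χ N (e g).1))) *
      fun g => F (randomSeries N g)) g ∂(gaussianLaw N) =
      ∫⁻ g, (fun y : (Fin N → ℝ) × (Fin N → ℝ) => ENNReal.ofReal (Real.exp (-potential α χ N y.1)) *
        F (ofCoord y)) (e g) ∂(gaussianLaw N) := rfl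
  have hWF : Measurable fun y : (Fin N → ℝ) × (Fin N → ℝ) =>
      ENNReal.ofReal (Real.exp (-potential α χ N y.1)) * F (ofCoord y) := hW.mul hFc
  rw [e1, hpres.lintegral_comp hWF, pi_gaussianReal_eq_withDensity, prod_withDensity hpdf hpdf,
    lintegral_withDensity_eq_lintegral_mul _ (by fun_prop) hWF]
  refine lintegral_congr fun y => ?_
  simp only [Pi.mul_apply]
  rw [← mul_assoc]
  congr 1
  have hprod : ∀ h : Fin N → ℝ, ∏ k, gaussianPDFReal 0 1 (h k) =
      (√(2 * Real.pi))⁻¹ ^ N * Real.exp (-(∑ k, h k ^ 2) / 2) := by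
    intro h
    simp only [gaussianPDFReal, Finset.prod_mul_distrib, Finset.prod_const, Finset.card_univ, Fintype.card_fin]
    rw [← Real.exp_sum, neg_div, Finset.sum_div, ← Finset.sum_neg_distrib]
    simp [neg_div]
  rw [hprod, hprod, ← ENNReal.ofReal_mul (by positivity), ← ENNReal.ofReal_mul (by positivity), gibbsDensity]
  congr 1
  have : -energy α χ N y = -(∑ k, y.1 k ^ 2) / 2 + -(∑ k, y.2 k ^ 2) / 2 + -potential α χ N y.1 := by
    unfold energy
    rw [Finset.sum_add_distrib]; ring
  rw [this, Real.exp_add, Real.exp_add, show 2 * N = N + N from two_mul N, pow_add]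
  ring

/-- (Sub-)invariance of the Gibbs measure under the flow of the truncated equation. -/
theorem lintegral_truncatedFlow_le (hα : 0 < α) {F : E N → ℝ≥0∞} (hF : Measurable F) (t : ℝ) :
    ∫⁻ u, F (truncatedFlow α χ N t u) ∂(gibbsMeasure α χ N) ≤ ∫⁻ u, F u ∂(gibbsMeasure α χ N) := by
  rw [lintegral_gibbsMeasure hα (F := fun u => F (truncatedFlow α χ N t u))
    (hF.comp (measurable_truncatedFlow hα t)), lintegral_gibbsMeasure hα hF]
  simp only [truncatedFlow_eq hα, toCoord_ofCoord]
  set ν := (volume : Measure (Fin N → ℝ)).prod (volume : Measure (Fin N → ℝ)) with hν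
  set S : ℕ → Set ((Fin N → ℝ) × (Fin N → ℝ)) := fun R => {y | 2 * energy α χ N y < (R : ℝ) ^ 2} with hS
  have hSm : ∀ R, MeasurableSet (S R) := fun R =>
    measurableSet_lt ((measurable_energy hα).const_mul 2) measurable_const
  have hSmono : Monotone S := fun R R' hRR y hy => by
    have h1 : 2 * energy α χ N y < (R : ℝ) ^ 2 := hy
    have h2 : (R : ℝ) ≤ R' := by exact_mod_cast hRR
    have h3 : (R : ℝ) ^ 2 ≤ (R' : ℝ) ^ 2 := by gcongr
    exact h1.trans_le h3
  have hSU : ⋃ R, S R = Set.univ := by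
    refine Set.eq_univ_of_forall fun y => Set.mem_iUnion.2 ?_
    refine ⟨⌈2 * energy α χ N y⌉₊ + 1, ?_⟩
    have hE : 0 ≤ 2 * energy α χ N y := (sq_nonneg _).trans (norm_sq_le_energy hα y)
    have h1 := Nat.le_ceil (2 * energy α χ N y)
    change 2 * energy α χ N y < ((⌈2 * energy α χ N y⌉₊ + 1 : ℕ) : ℝ) ^ 2
    push_cast
    nlinarith
  -- Exhaustion by sublevel sets of the energy. On each one the flow coincides with a clamped flow,
  -- which preserves Lebesgue measure, and the energy, hence the density, is constant along it.
  rw [← setLIntegral_univ, ← hSU, setLIntegral_iUnion_of_directed _ hSmono.directed_le]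
  refine iSup_le fun R => ?_
  obtain ⟨Φ, h0, hΦ⟩ := exists_clampFlow hα χ N (R := (R : ℝ)) R.cast_nonneg
  obtain ⟨K, M, h1, h2, h3, h4⟩ := exists_bounds_clamp hα χ N (R := (R : ℝ)) R.cast_nonneg
  have hpres := measurePreserving_flow_of_separable (volume : Measure (Fin N → ℝ)) h1 h2 h3 h4 h0 hΦ t
  have hFc : Measurable fun y : (Fin N → ℝ) × (Fin N → ℝ) => F (ofCoord y) :=
    hF.comp continuous_ofCoord.measurable
  have hG : Measurable ((S R).indicator fun y => gibbsDensity α χ N y * F (ofCoord y)) :=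
    ((measurable_gibbsDensity hα).mul hFc).indicator (hSm R)
  calc _ = ∫⁻ y in S R, ((S R).indicator fun y => gibbsDensity α χ N y * F (ofCoord y)) (Φ t y) ∂ν := by
        refine setLIntegral_congr_fun (hSm R) fun y hy => ?_
        have hfl := hamFlow_eq_of_clampFlow hα R.cast_nonneg h0 hΦ hy t
        have hen := energy_hamFlow (χ := χ) hα t y
        have hmem : Φ t y ∈ S R := by
          change 2 * energy α χ N (Φ t y) < (R : ℝ) ^ 2
          rw [← hfl, hen]
          exact hy
        rw [Set.indicator_of_mem hmem, ← hfl, gibbsDensity, gibbsDensity, hen]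
    _ ≤ ∫⁻ y, ((S R).indicator fun y => gibbsDensity α χ N y * F (ofCoord y)) (Φ t y) ∂ν :=
        setLIntegral_le_lintegral _ _
    _ = ∫⁻ y, ((S R).indicator fun y => gibbsDensity α χ N y * F (ofCoord y)) y ∂ν :=
        hpres.lintegral_comp hG
    _ ≤ _ := lintegral_mono fun y => Set.indicator_le_self _ _ y

/-! ### Duhamel's formula and the inhomogeneous Strichartz estimate -/

theorem freeEvol_freeEvol (σ δ : ℝ) (u : E N) : freeEvol σ (freeEvol δ u) = freeEvol (σ + δ) u := by
  ext k
  simp only [freeEvol]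
  rw [← mul_assoc, ← Complex.exp_add]
  congr 2
  push_cast; ring

theorem freeNorm_freeEvol {p : ℝ} (hp : 0 < p) (a b δ : ℝ) (u : E N) :
    freeNorm p a b (freeEvol δ u) = freeNorm p (a + δ) (b + δ) u := by
  rw [freeNorm_eq_lintegral hp, freeNorm_eq_lintegral hp]
  congr 1
  refine lintegral_congr fun x => ?_
  simp_rw [freeEvol_freeEvol]
  rw [← lintegral_indicator measurableSet_Ioo, ← lintegral_indicator measurableSet_Ioo]
  conv_rhs => rw [← lintegral_add_right_eq_self _ δ]
  refine lintegral_congr fun σ => ?_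
  simp only [Set.indicator, Set.mem_Ioo, add_lt_add_iff_right]

theorem freeNorm_mono {p a b a' b' : ℝ} (ha : a' ≤ a) (hb : b ≤ b') (u : E N) :
    freeNorm p a b u ≤ freeNorm p a' b' u := by
  refine eLpNorm_mono_measure _ (Measure.prod_mono ?_ le_rfl)
  exact Measure.restrict_mono (Set.Ioo_subset_Ioo ha hb) le_rfl

theorem toFun_freeEvol_add (σ : ℝ) (u v : E N) (x : R3) :
    toFun (freeEvol σ (u + v)) x = toFun (freeEvol σ u) x + toFun (freeEvol σ v) x := by
  simp only [toFun_freeEvol, ← Finset.sum_add_distrib, PiLp.add_apply]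
  exact Finset.sum_congr rfl fun k _ => by ring

theorem freeNorm_add_le {p : ℝ} (hp : 1 ≤ p) (a b : ℝ) (u v : E N) :
    freeNorm p a b (u + v) ≤ freeNorm p a b u + freeNorm p a b v := by
  simp only [freeNorm, toFun_freeEvol_add]
  exact eLpNorm_add_le (continuous_toFun_freeEvol_left u).aestronglyMeasurable
    (continuous_toFun_freeEvol_left v).aestronglyMeasurable (ENNReal.one_le_ofReal.2 hp)

theorem sobolevNorm_eq_norm (s : ℝ) (c : E N) :
    sobolevNorm s c = ‖(WithLp.toLp 2 fun k => ((freq k ^ s : ℝ) : ℂ) * c k : E N)‖ := by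
  rw [sobolevNorm, EuclideanSpace.norm_eq]
  congr 1
  refine Finset.sum_congr rfl fun k _ => ?_
  have hf := freq_pos k
  simp only [norm_mul, Complex.norm_real, Real.norm_eq_abs, mul_pow, sq_abs]
  rw [← Real.rpow_natCast (freq k ^ s), ← Real.rpow_mul hf.le]
  congr 2; push_cast; ring

theorem sobolevNorm_nonneg (s : ℝ) (c : E N) : 0 ≤ sobolevNorm s c := Real.sqrt_nonneg _

theorem sobolevNorm_add_le (s : ℝ) (u v : E N) :
    sobolevNorm s (u + v) ≤ sobolevNorm s u + sobolevNorm s v := by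
  simp only [sobolevNorm_eq_norm]
  refine le_trans (le_of_eq ?_) (norm_add_le _ _)
  congr 1
  ext k
  simp [mul_add]

theorem sobolevNorm_congr {s : ℝ} {u v : E N} (h : ∀ k, ‖u k‖ = ‖v k‖) : sobolevNorm s u = sobolevNorm s v := by
  simp only [sobolevNorm, h]

theorem sobolevNorm_freeEvol (s δ : ℝ) (u : E N) : sobolevNorm s (freeEvol δ u) = sobolevNorm s u :=
  sobolevNorm_congr fun k => by simp only [freeEvol]; rw [norm_mul, norm_exp_freq, one_mul]

theorem sobolevNorm_mono {s s' : ℝ} (h : s ≤ s') (u : E N) : sobolevNorm s u ≤ sobolevNorm s' u := by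
  unfold sobolevNorm
  gcongr with k
  exact one_le_freq k

theorem integral_mul_conj_freeEvol (σ : ℝ) (K : E N) {w : R3 → ℝ} (hw : Continuous w)
    {B : ℝ} (hB : ∀ x, |w x| ≤ B) :
    ∫ x in unitBall, (w x : ℂ) * (starRingEnd ℂ) (toFun (freeEvol σ K) x) =
      ∑ k, (starRingEnd ℂ) (K k) * Complex.exp (Complex.I * σ * freq k) *
        ((∫ x in unitBall, w x * eigenfun (k + 1) x : ℝ) : ℂ) := by
  have e : ∀ x, (w x : ℂ) * (starRingEnd ℂ) (toFun (freeEvol σ K) x) =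
      ∑ k, (starRingEnd ℂ) (K k) * Complex.exp (Complex.I * σ * freq k) *
        ((w x * eigenfun (k + 1) x : ℝ) : ℂ) := by
    intro x
    rw [toFun_freeEvol, map_sum, Finset.mul_sum]
    refine Finset.sum_congr rfl fun k _ => ?_
    rw [map_mul, map_mul, ← Complex.exp_conj]
    simp only [map_mul, map_neg, Complex.conj_I, Complex.conj_ofReal]
    push_cast
    ring_nf
  simp_rw [e]
  rw [integral_finsetSum]
  · refine Finset.sum_congr rfl fun k _ => ?_
    rw [integral_const_mul, integral_complex_ofReal]
  · intro k _
    have hi : Integrable (fun x => w x * eigenfun (k + 1) x) (volume.restrict unitBall) := by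
      refine integrable_unitBall_of_bound (hw.mul (continuous_eigenfun _)) (C := B * freq k) fun x => ?_
      rw [norm_mul]
      exact mul_le_mul (hB x) (abs_eigenfun_le_freq k x) (norm_nonneg _) ((abs_nonneg _).trans (hB x))
    exact hi.ofReal.const_mul _

/-- The Duhamel integral of the nonlinearity along `h`, pulled back by the free evolution. -/
def duhamel (α : ℝ) (χ : ℝ → ℝ) (N : ℕ) (h : ℝ → Fin N → ℝ) (t₀ t : ℝ) : E N :=
  WithLp.toLp 2 fun k => ∫ σ in t₀..t,
    Complex.exp (Complex.I * σ * freq k) * ((force α χ N (h σ) k / freq k : ℝ) : ℂ)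

/-- The norm of `|w|^(α+1)` in `L^m((a, b) × Θ)`, `w(σ) = S_N (∑ h_k(σ) / (kπ) e_k)`. -/
def nlNorm (α : ℝ) (χ : ℝ → ℝ) (N : ℕ) (m a b : ℝ) (h : ℝ → Fin N → ℝ) : ℝ≥0∞ :=
  (∫⁻ z, ENNReal.ofReal (|field χ N (h z.1) z.2| ^ (α + 1)) ^ m
    ∂((volume.restrict (Set.Ioo a b)).prod (volume.restrict unitBall))) ^ (1 / m)

/-- The left side is a weighted `ℓ²` norm squared of the Duhamel term. With `K` built from the
Duhamel term itself, it becomes the space-time pairing of the nonlinearity with the free evolution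
of `K`, since `force` already contains one factor `mult` and an inner product with `e_k`. -/
theorem duhamel_dual (hα : 0 < α) {h : ℝ → Fin N → ℝ} (hh : Continuous h) (t₀ t : ℝ) (K : E N)
    {a : Fin N → ℝ} (hK : ∀ k, K k = ((a k * mult χ N k / freq k : ℝ) : ℂ) * duhamel α χ N h t₀ t k) :
    ((∑ k, a k * ‖duhamel α χ N h t₀ t k‖ ^ 2 : ℝ) : ℂ) =
      ∫ σ in t₀..t, ∫ x in unitBall, (oddPow α (field χ N (h σ) x) : ℂ) *
        (starRingEnd ℂ) (toFun (freeEvol σ K) x) := by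
  set G := duhamel α χ N h t₀ t with hG
  have hinner : ∀ σ, ∫ x in unitBall, (oddPow α (field χ N (h σ) x) : ℂ) *
        (starRingEnd ℂ) (toFun (freeEvol σ K) x) =
      ∑ k, ((a k : ℂ) * (starRingEnd ℂ) (G k)) * (Complex.exp (Complex.I * σ * freq k) *
        ((force α χ N (h σ) k / freq k : ℝ) : ℂ)) := by
    intro σ
    rw [integral_mul_conj_freeEvol σ K (w := fun x => oddPow α (field χ N (h σ) x)) ((continuous_oddPow hα).comp (continuous_field_right (h σ)))
      (B := ((∑ k, |mult χ N k|) * ‖h σ‖) ^ (α + 1))]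
    · refine Finset.sum_congr rfl fun k _ => ?_
      rw [hK, map_mul, Complex.conj_ofReal, force]
      push_cast
      ring
    · intro x
      rw [abs_oddPow hα]
      gcongr
      exact abs_field_le _ x
  have hcont : ∀ k, Continuous fun σ : ℝ => Complex.exp (Complex.I * σ * freq k) *
        ((force α χ N (h σ) k / freq k : ℝ) : ℂ) := by
    intro k
    have := (continuous_force (χ := χ) hα k).comp hh
    exact (by fun_prop : Continuous fun σ : ℝ => Complex.exp (Complex.I * σ * freq k)).mul
      (Complex.continuous_ofReal.comp (this.div_const _))
  simp_rw [hinner]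
  rw [intervalIntegral.integral_finsetSum fun k _ => ((hcont k).const_mul _).intervalIntegrable _ _]
  simp_rw [intervalIntegral.integral_const_mul]
  rw [Complex.ofReal_sum]
  refine Finset.sum_congr rfl fun k _ => ?_
  have : ∫ σ in t₀..t, Complex.exp (Complex.I * σ * freq k) * ((force α χ N (h σ) k / freq k : ℝ) : ℂ) = G k := rfl
  rw [this, mul_assoc, Complex.conj_mul', Complex.ofReal_mul, Complex.ofReal_pow]

theorem ofReal_sum_le_of_dual (hα : 0 < α) {h : ℝ → Fin N → ℝ} (hh : Continuous h) {t₀ t : ℝ}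
    (ht₀ : t₀ ≤ t) (ht : t ≤ t₀ + 2) {m q : ℝ} (hmq : m.HolderConjugate q) (K : E N) {T : ℝ}
    (hT : (T : ℂ) = ∫ σ in t₀..t, ∫ x in unitBall, (oddPow α (field χ N (h σ) x) : ℂ) *
        (starRingEnd ℂ) (toFun (freeEvol σ K) x)) :
    ENNReal.ofReal T ≤ nlNorm α χ N m t₀ t h * freeNorm q t₀ (t₀ + 2) K := by
  have hcf : Continuous fun z : ℝ × R3 => field χ N (h z.1) z.2 :=
    continuous_field.comp ((hh.comp continuous_fst).prodMk continuous_snd)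
  have hK := continuous_toFun_freeEvol_left K
  have hf : Measurable fun z : ℝ × R3 => ENNReal.ofReal (|field χ N (h z.1) z.2| ^ (α + 1)) :=
    ((hcf.abs.rpow_const fun _ => Or.inr (by linarith)).measurable).ennreal_ofReal
  have hg : Measurable fun z : ℝ × R3 => ‖toFun (freeEvol z.1 K) z.2‖ₑ := hK.measurable.enorm
  calc ENNReal.ofReal T ≤ ‖(T : ℂ)‖ₑ := by
        rw [← ofReal_norm, Complex.norm_real]
        exact ENNReal.ofReal_le_ofReal (le_abs_self T)
    _ ≤ ∫⁻ σ in Set.Ioc t₀ t, ∫⁻ x in unitBall,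
          ENNReal.ofReal (|field χ N (h σ) x| ^ (α + 1)) * ‖toFun (freeEvol σ K) x‖ₑ := by
        rw [hT, intervalIntegral.integral_of_le ht₀]
        refine (enorm_integral_le_lintegral_enorm _).trans (lintegral_mono fun σ => ?_)
        refine (enorm_integral_le_lintegral_enorm _).trans (lintegral_mono fun x => ?_)
        rw [enorm_mul, RCLike.enorm_conj, ← ofReal_norm (oddPow α _ : ℂ), Complex.norm_real,
          Real.norm_eq_abs, abs_oddPow hα]
    _ = ∫⁻ z, ((fun z : ℝ × R3 => ENNReal.ofReal (|field χ N (h z.1) z.2| ^ (α + 1))) *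
          fun z : ℝ × R3 => ‖toFun (freeEvol z.1 K) z.2‖ₑ) z
          ∂((volume.restrict (Set.Ioo t₀ t)).prod (volume.restrict unitBall)) := by
        rw [lintegral_prod _ (hf.mul hg).aemeasurable, Measure.restrict_congr_set Ioo_ae_eq_Ioc]
        rfl
    _ ≤ _ := by
        refine (ENNReal.lintegral_mul_le_Lp_mul_Lq _ hmq hf.aemeasurable hg.aemeasurable).trans ?_
        refine mul_le_mul' le_rfl (le_trans (le_of_eq ?_) (freeNorm_mono (p := q) le_rfl ht K))
        rw [freeNorm, eLpNorm_eq_lintegral_rpow_enorm_toReal (by simpa using hmq.symm.pos) (by simp),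
          ENNReal.toReal_ofReal hmq.symm.nonneg]

/-- Inhomogeneous Strichartz estimate, by duality. -/
theorem sobolevNorm_duhamel_le (hα : 0 < α) {m q C X : ℝ} (hmq : m.HolderConjugate q)
    (hC0 : 0 ≤ C) (hX0 : 0 ≤ X)
    (hC : ∀ (c : E N) (t₀ : ℝ), freeNorm q t₀ (t₀ + 2) c ≤ ENNReal.ofReal (C * sobolevNorm (1 / 6) c))
    (hX : ∀ k, |mult χ N k| ≤ X) {h : ℝ → Fin N → ℝ} (hh : Continuous h) {t₀ t : ℝ}
    (ht₀ : t₀ ≤ t) (ht : t ≤ t₀ + 2) :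
    ENNReal.ofReal (sobolevNorm (5 / 6) (duhamel α χ N h t₀ t)) ≤
      ENNReal.ofReal (C * X) * nlNorm α χ N m t₀ t h := by
  set G := duhamel α χ N h t₀ t with hG
  set S := sobolevNorm (5 / 6) G with hS
  have hS0 : 0 ≤ S := sobolevNorm_nonneg _ _
  rcases hS0.eq_or_lt with h0 | hpos
  · rw [← h0]; simp
  set a : Fin N → ℝ := fun k => freq k ^ (2 * (5 / 6) : ℝ) with ha
  -- With weight `freq^(5/3)` the pairing equals `S²`, where `S` is the `H^(5/6)` norm. Division by
  -- one frequency leaves `K` with an `H^(1/6)` norm of at most `X S`, because `1/3 + 2 (5/3 - 1) =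
  -- 5/3`. One factor `S` then cancels.
  set K : E N := WithLp.toLp 2 fun k => ((a k * mult χ N k / freq k : ℝ) : ℂ) * G k with hK
  have hT := duhamel_dual hα hh t₀ t K (a := a) (fun k => rfl)
  have hST : ∑ k, a k * ‖G k‖ ^ 2 = S * S := by
    rw [hS, sobolevNorm, Real.mul_self_sqrt (Finset.sum_nonneg fun k _ => by have := freq_pos k; positivity)]
  have hKS : sobolevNorm (1 / 6) K ≤ X * S := by
    rw [hS, sobolevNorm, sobolevNorm]
    refine Real.sqrt_le_iff.2 ⟨by positivity, ?_⟩
    rw [mul_pow, Real.sq_sqrt (Finset.sum_nonneg fun k _ => by have := freq_pos k; positivity), Finset.mul_sum]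
    refine Finset.sum_le_sum fun k _ => ?_
    have hf := freq_pos k
    have hn : ‖K k‖ = a k * |mult χ N k| / freq k * ‖G k‖ := by
      simp only [hK, norm_mul, Complex.norm_real, Real.norm_eq_abs, abs_div, abs_mul, abs_of_pos hf]
      rw [abs_of_nonneg (by positivity : 0 ≤ a k)]
    have he : freq k ^ (2 * (1 / 6) : ℝ) * (a k / freq k) ^ 2 = freq k ^ (2 * (5 / 6) : ℝ) := by
      rw [ha]
      simp only
      rw [← Real.rpow_sub_one hf.ne', ← Real.rpow_natCast, ← Real.rpow_mul hf.le, ← Real.rpow_add hf]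
      norm_num
    calc freq k ^ (2 * (1 / 6) : ℝ) * ‖K k‖ ^ 2 =
          |mult χ N k| ^ 2 * ((freq k ^ (2 * (1 / 6) : ℝ) * (a k / freq k) ^ 2) * ‖G k‖ ^ 2) := by
            rw [hn]; ring
      _ ≤ X ^ 2 * (freq k ^ (2 * (5 / 6) : ℝ) * ‖G k‖ ^ 2) := by
            rw [he]
            gcongr
            exact hX k
  have h1 := ofReal_sum_le_of_dual hα hh ht₀ ht hmq K hT
  rw [hST, ENNReal.ofReal_mul hS0] at h1
  have h2 : ENNReal.ofReal S * ENNReal.ofReal S ≤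
      (ENNReal.ofReal (C * X) * nlNorm α χ N m t₀ t h) * ENNReal.ofReal S := by
    refine h1.trans ?_
    calc _ ≤ nlNorm α χ N m t₀ t h * ENNReal.ofReal (C * (X * S)) := by
          gcongr
          exact (hC K t₀).trans (ENNReal.ofReal_le_ofReal (by gcongr))
      _ = _ := by rw [← mul_assoc, ENNReal.ofReal_mul (by positivity)]; ring
  exact (ENNReal.mul_le_mul_iff_left (by simpa using hpos) ENNReal.ofReal_ne_top).1 h2

/-- Duhamel's formula. -/
theorem IsTruncatedSolution.duhamel_formula (hα : 0 < α) {u₀ : E N} {u : ℝ → E N}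
    (hu : IsTruncatedSolution α χ N u₀ u) (t₀ t : ℝ) :
    u t = freeEvol (t - t₀) (u t₀) + freeEvol t (WithLp.toLp 2 fun k =>
      -Complex.I * duhamel α χ N (fun s => (toCoord (u s)).1) t₀ t k) := by
  have huc := hu.differentiable.continuous
  ext k
  have hd : ∀ σ : ℝ, HasDerivAt (fun σ : ℝ => Complex.exp (Complex.I * σ * freq k) * u σ k)
      (-Complex.I * (Complex.exp (Complex.I * σ * freq k) *
        ((force α χ N (toCoord (u σ)).1 k / freq k : ℝ) : ℂ))) σ := by
    intro σ
    have h1 : HasDerivAt (fun σ : ℝ => Complex.exp (Complex.I * σ * freq k))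
        (Complex.exp (Complex.I * σ * freq k) * (Complex.I * freq k)) σ := by
      have : HasDerivAt (fun σ : ℝ => Complex.I * (σ : ℂ) * freq k) (Complex.I * freq k) σ := by
        simpa using ((hasDerivAt_id σ).ofReal_comp.const_mul Complex.I).mul_const (freq k : ℂ)
      exact this.cexp
    refine (h1.fun_mul (hu.hasDerivAt σ k)).congr_deriv ?_
    rw [nonlinearity_apply]
    simp only [toCoord]
    ring
  have hcont : Continuous fun σ : ℝ => -Complex.I * (Complex.exp (Complex.I * σ * freq k) *
        ((force α χ N (toCoord (u σ)).1 k / freq k : ℝ) : ℂ)) := by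
    have := (continuous_force (χ := χ) hα k).comp (continuous_toCoord.comp huc).fst
    exact continuous_const.mul ((by fun_prop : Continuous fun σ : ℝ => Complex.exp (Complex.I * σ * freq k)).mul
      (Complex.continuous_ofReal.comp (this.div_const _)))
  have hftc := intervalIntegral.integral_eq_sub_of_hasDerivAt (a := t₀) (b := t) (fun σ _ => hd σ)
    (hcont.intervalIntegrable _ _)
  rw [intervalIntegral.integral_const_mul] at hftc
  have hG : duhamel α χ N (fun s => (toCoord (u s)).1) t₀ t k = ∫ σ in t₀..t,
      Complex.exp (Complex.I * σ * freq k) * ((force α χ N (toCoord (u σ)).1 k / freq k : ℝ) : ℂ) := rfl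
  rw [← hG] at hftc
  simp only [PiLp.add_apply, freeEvol]
  rw [hftc, mul_sub, ← mul_assoc, ← mul_assoc, ← Complex.exp_add, ← Complex.exp_add]
  have e1 : -Complex.I * (t : ℂ) * freq k + Complex.I * t * freq k = 0 := by ring
  have e2 : -Complex.I * (t : ℂ) * freq k + Complex.I * t₀ * freq k =
      -Complex.I * ((t - t₀ : ℝ) : ℂ) * freq k := by push_cast; ring
  rw [e1, e2, Complex.exp_zero]
  ring

/-- Control of the flow on a short time interval by the data at its left end point and the nonlinearity. -/
theorem truncatedFlow_local_bound (hα : 0 < α) {p s m q C₁ C₂ X : ℝ} (hp : 1 ≤ p) (hs : s ≤ 5 / 6)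
    (hmq : m.HolderConjugate q) (hC₁ : 0 ≤ C₁) (hC₂ : 0 ≤ C₂) (hX0 : 0 ≤ X)
    (hS₁ : ∀ (c : E N) (t₀ : ℝ), freeNorm p t₀ (t₀ + 2) c ≤ ENNReal.ofReal (C₁ * sobolevNorm (5 / 6) c))
    (hS₂ : ∀ (c : E N) (t₀ : ℝ), freeNorm q t₀ (t₀ + 2) c ≤ ENNReal.ofReal (C₂ * sobolevNorm (1 / 6) c))
    (hX : ∀ k, |mult χ N k| ≤ X) (u₀ : E N) {t₀ t t₁ : ℝ} (ht₀ : t₀ ≤ t) (ht : t ≤ t₁) (ht₁ : t₁ ≤ t₀ + 1) :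
    freeNorm p 0 2 (truncatedFlow α χ N t u₀) + ENNReal.ofReal (sobolevNorm s (truncatedFlow α χ N t u₀)) ≤
      freeNorm p 0 3 (truncatedFlow α χ N t₀ u₀) +
        ENNReal.ofReal (sobolevNorm s (truncatedFlow α χ N t₀ u₀)) +
        ENNReal.ofReal ((C₁ + 1) * (C₂ * X)) *
          nlNorm α χ N m t₀ t₁ fun σ => (toCoord (truncatedFlow α χ N σ u₀)).1 := by
  have hp0 : 0 < p := by linarith
  set h : ℝ → Fin N → ℝ := fun σ => (toCoord (truncatedFlow α χ N σ u₀)).1 with hh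
  have hhc : Continuous h := (continuous_toCoord.comp (continuous_truncatedFlow_time hα u₀)).fst
  set G' : E N := WithLp.toLp 2 fun k => -Complex.I * duhamel α χ N h t₀ t k with hG'
  have hsol : truncatedFlow α χ N t u₀ = freeEvol (t - t₀) (truncatedFlow α χ N t₀ u₀) + freeEvol t G' :=
    (truncatedFlow_spec hα u₀).duhamel_formula hα t₀ t
  have hGG : ∀ r, sobolevNorm r G' = sobolevNorm r (duhamel α χ N h t₀ t) := fun r =>
    sobolevNorm_congr fun k => by simp [hG']
  have hD : ENNReal.ofReal (sobolevNorm (5 / 6) G') ≤ ENNReal.ofReal (C₂ * X) * nlNorm α χ N m t₀ t₁ h := by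
    rw [hGG]
    refine (sobolevNorm_duhamel_le hα hmq hC₂ hX0 hS₂ hX hhc ht₀ (by linarith)).trans ?_
    gcongr
    unfold nlNorm
    have hm := hmq.pos
    gcongr
  -- Free evolution by `t - t₀ ∈ [0, 1]` only shifts the time window, from `(0, 2)` into `(0, 3)`;
  -- hence the longer interval for the data at `t₀`.
  have hA : freeNorm p 0 2 (truncatedFlow α χ N t u₀) ≤ freeNorm p 0 3 (truncatedFlow α χ N t₀ u₀) +
      ENNReal.ofReal C₁ * ENNReal.ofReal (sobolevNorm (5 / 6) G') := by
    rw [hsol]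
    refine (freeNorm_add_le hp _ _ _ _).trans (add_le_add ?_ ?_)
    · rw [freeNorm_freeEvol hp0]
      exact freeNorm_mono (by linarith) (by linarith) _
    · rw [freeNorm_freeEvol hp0, zero_add, add_comm 2 t, ← ENNReal.ofReal_mul hC₁]
      exact hS₁ G' t
  have hB : ENNReal.ofReal (sobolevNorm s (truncatedFlow α χ N t u₀)) ≤
      ENNReal.ofReal (sobolevNorm s (truncatedFlow α χ N t₀ u₀)) + ENNReal.ofReal (sobolevNorm (5 / 6) G') := by
    rw [← ENNReal.ofReal_add (sobolevNorm_nonneg _ _) (sobolevNorm_nonneg _ _)]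
    refine ENNReal.ofReal_le_ofReal ?_
    rw [hsol]
    refine (sobolevNorm_add_le _ _ _).trans ?_
    rw [sobolevNorm_freeEvol, sobolevNorm_freeEvol]
    have := sobolevNorm_mono hs G'
    gcongr
  calc _ ≤ (freeNorm p 0 3 (truncatedFlow α χ N t₀ u₀) +
      ENNReal.ofReal C₁ * ENNReal.ofReal (sobolevNorm (5 / 6) G')) +
      (ENNReal.ofReal (sobolevNorm s (truncatedFlow α χ N t₀ u₀)) + ENNReal.ofReal (sobolevNorm (5 / 6) G')) :=
        add_le_add hA hB
    _ = freeNorm p 0 3 (truncatedFlow α χ N t₀ u₀) +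
        ENNReal.ofReal (sobolevNorm s (truncatedFlow α χ N t₀ u₀)) +
        ENNReal.ofReal (C₁ + 1) * ENNReal.ofReal (sobolevNorm (5 / 6) G') := by
        rw [ENNReal.ofReal_add hC₁ zero_le_one, ENNReal.ofReal_one]; ring
    _ ≤ _ := by
        rw [ENNReal.ofReal_mul (p := C₁ + 1) (by linarith), mul_assoc]
        gcongr

/-! ### Tail bounds along the flow -/

/-- Moments along the flow of a norm with Gaussian sums as entries. -/
theorem lintegral_rpow_lintegral_truncatedFlow_le (hα : 0 < α) {Z : Type*} [MeasurableSpace Z] {ν : Measure Z}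
    [SFinite ν] {T : Z → ℝ} (hT : Measurable T) {a : Z → Fin N → ℂ}
    (ha : ∀ k, Measurable fun z => a z k) {v : Z → ℝ} (hv : Measurable v) (hv0 : ∀ᵐ z ∂ν, 0 < v z)
    {V γ r Q M : ℝ} (hV : 0 < V) (hγ : 0 < γ) (hr : 0 < r) (hrQ : r ≤ Q)
    (hvar : ∀ᵐ z ∂ν, ∑ k, (‖a z k‖ / freq k) ^ 2 ≤ V * v z ^ 2)
    (hM : ∫⁻ z, ENNReal.ofReal (v z ^ (γ * r)) ∂ν ≤ ENNReal.ofReal M) :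
    ∫⁻ u, (∫⁻ z, ENNReal.ofReal (‖∑ k, a z k * truncatedFlow α χ N (T z) u k‖ ^ γ) ^ r ∂ν) ^ (Q / r)
        ∂(gibbsMeasure α χ N) ≤
      ENNReal.ofReal (4 * (4 * Real.exp 1 * (γ * Q) * V) ^ (γ * Q / 2)) * ENNReal.ofReal M ^ (Q / r) := by
  have : Fact (0 < α) := ⟨hα⟩
  have hQ : 0 < Q := hr.trans_le hrQ
  have hmeas : ∀ (S : Z → ℝ), Measurable S → Measurable fun ω : E N × Z =>
      ENNReal.ofReal (‖∑ k, a ω.2 k * truncatedFlow α χ N (S ω.2) ω.1 k‖ ^ γ) := by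
    intro S hS
    have h1 : Measurable fun ω : E N × Z => truncatedFlow α χ N (S ω.2) ω.1 :=
      (measurable_uncurry_truncatedFlow hα).comp ((hS.comp measurable_snd).prodMk measurable_fst)
    have h2 : ∀ k, Measurable fun ω : E N × Z => truncatedFlow α χ N (S ω.2) ω.1 k := fun k =>
      (PiLp.continuous_apply 2 _ k).measurable.comp h1
    have h3 : Measurable fun ω : E N × Z => ∑ k, a ω.2 k * truncatedFlow α χ N (S ω.2) ω.1 k :=
      Finset.measurable_sum _ fun k _ => ((ha k).comp measurable_snd).mul (h2 k)
    exact (h3.norm.pow_const γ).ennreal_ofReal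
  refine lintegral_rpow_lintegral_le (w := fun z => ENNReal.ofReal (v z ^ γ)) (hmeas T hT)
    (hv.pow_const γ).ennreal_ofReal ?_ hr hrQ ?_ ?_
  · filter_upwards [hv0] with z hz
    exact ⟨by simpa using Real.rpow_pos_of_pos hz γ, ENNReal.ofReal_ne_top⟩
  · filter_upwards [hv0, hvar] with z hz hz2
    have hm : Measurable fun u : E N => ENNReal.ofReal (‖∑ k, a z k * u k‖ ^ γ) ^ Q := by
      have : Continuous fun u : E N => ∑ k, a z k * u k := by fun_prop
      exact ((this.norm.measurable.pow_const γ).ennreal_ofReal).pow_const Q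
    -- Here `z` is fixed, so invariance at the single time `T z` removes the flow, although the norm
    -- as a whole involves many times.
    refine (lintegral_truncatedFlow_le hα hm (T z)).trans ?_
    have hκ := lintegral_norm_rpow_gibbsMeasure_le hα χ (a z) (V := V * v z ^ 2) (κ := γ * Q)
      (by positivity) (by positivity) hz2
    have e1 : ∀ u : E N, ENNReal.ofReal (‖∑ k, a z k * u k‖ ^ γ) ^ Q =
        ENNReal.ofReal (‖∑ k, a z k * u k‖ ^ (γ * Q)) := fun u => by
      rw [ENNReal.ofReal_rpow_of_nonneg (by positivity) hQ.le, ← Real.rpow_mul (norm_nonneg _)]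
    simp_rw [e1]
    refine hκ.trans (le_of_eq ?_)
    rw [ENNReal.ofReal_rpow_of_nonneg (by positivity) hQ.le, ← ENNReal.ofReal_mul (by positivity)]
    congr 1
    have e2 : (v z ^ 2) ^ (γ * Q / 2) = (v z ^ γ) ^ Q := by
      rw [← Real.rpow_natCast (v z), ← Real.rpow_mul hz.le, ← Real.rpow_mul hz.le]
      congr 1; push_cast; ring
    rw [← mul_assoc (4 * Real.exp 1 * (γ * Q)) V (v z ^ 2),
      Real.mul_rpow (by positivity : 0 ≤ 4 * Real.exp 1 * (γ * Q) * V) (by positivity), e2]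
    ring
  · refine le_trans (le_of_eq (lintegral_congr_ae ?_)) hM
    filter_upwards [hv0] with z hz
    rw [ENNReal.ofReal_rpow_of_nonneg (by positivity) hr.le, ← Real.rpow_mul hz.le]

/-- Tails along the flow of a norm with Gaussian sums as entries. -/
theorem gibbsMeasure_tail_le (hα : 0 < α) {Z : Type*} [MeasurableSpace Z] {ν : Measure Z}
    [SFinite ν] {T : Z → ℝ} (hT : Measurable T) {a : Z → Fin N → ℂ}
    (ha : ∀ k, Measurable fun z => a z k) {v : Z → ℝ} (hv : Measurable v) (hv0 : ∀ᵐ z ∂ν, 0 < v z)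
    {V γ r Q M L : ℝ} (hV : 0 < V) (hγ : 0 < γ) (hr : 0 < r) (hrQ : r ≤ Q) (hQ1 : 1 ≤ Q) (hM0 : 0 ≤ M)
    (hvar : ∀ᵐ z ∂ν, ∑ k, (‖a z k‖ / freq k) ^ 2 ≤ V * v z ^ 2)
    (hM : ∫⁻ z, ENNReal.ofReal (v z ^ (γ * r)) ∂ν ≤ ENNReal.ofReal M) (hL : 0 < L)
    (hLM : 128 * ((4 * Real.exp 1 * (γ * Q) * V) ^ (γ / 2) * M ^ (1 / r)) ≤ L) :
    gibbsMeasure α χ N {u | ENNReal.ofReal L ≤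
      (∫⁻ z, ENNReal.ofReal (‖∑ k, a z k * truncatedFlow α χ N (T z) u k‖ ^ γ) ^ r ∂ν) ^ (1 / r)} ≤
      ENNReal.ofReal (32 ^ (-Q)) := by
  have hQ : 0 < Q := hr.trans_le hrQ
  have hmom := lintegral_rpow_lintegral_truncatedFlow_le (χ := χ) hα hT ha hv hv0 hV hγ hr hrQ hvar hM
  set A := (4 * Real.exp 1 * (γ * Q) * V) ^ (γ / 2) * M ^ (1 / r) with hA
  have hA0 : 0 ≤ A := by positivity
  set Y : E N → ℝ≥0∞ := fun u =>
    ∫⁻ z, ENNReal.ofReal (‖∑ k, a z k * truncatedFlow α χ N (T z) u k‖ ^ γ) ^ r ∂ν with hY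
  have hYm : Measurable fun u => Y u ^ (Q / r) := by
    have h1 : Measurable fun ω : E N × Z => truncatedFlow α χ N (T ω.2) ω.1 :=
      (measurable_uncurry_truncatedFlow hα).comp ((hT.comp measurable_snd).prodMk measurable_fst)
    have h2 : ∀ k, Measurable fun ω : E N × Z => truncatedFlow α χ N (T ω.2) ω.1 k := fun k =>
      (PiLp.continuous_apply 2 _ k).measurable.comp h1
    have h3 : Measurable fun ω : E N × Z => ∑ k, a ω.2 k * truncatedFlow α χ N (T ω.2) ω.1 k :=
      Finset.measurable_sum _ fun k _ => ((ha k).comp measurable_snd).mul (h2 k)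
    exact (((h3.norm.pow_const γ).ennreal_ofReal.pow_const r).lintegral_prod_right' (ν := ν)).pow_const _
  have hrhs : ENNReal.ofReal (4 * (4 * Real.exp 1 * (γ * Q) * V) ^ (γ * Q / 2)) * ENNReal.ofReal M ^ (Q / r) =
      ENNReal.ofReal (4 * A ^ Q) := by
    have hB : 0 ≤ 4 * Real.exp 1 * (γ * Q) * V := by positivity
    rw [ENNReal.ofReal_rpow_of_nonneg hM0 (by positivity), ← ENNReal.ofReal_mul (by positivity), hA,
      Real.mul_rpow (Real.rpow_nonneg hB _) (by positivity), ← Real.rpow_mul hB, ← Real.rpow_mul hM0, mul_assoc,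
      div_mul_eq_mul_div, one_div_mul_eq_div]
  rw [hrhs] at hmom
  clear_value A
  have hsub : {u | ENNReal.ofReal L ≤ Y u ^ (1 / r)} ⊆ {u | ENNReal.ofReal (L ^ Q) ≤ Y u ^ (Q / r)} := by
    intro u hu
    have := ENNReal.rpow_le_rpow hu hQ.le
    rw [← ENNReal.rpow_mul, ENNReal.ofReal_rpow_of_nonneg hL.le hQ.le, one_div_mul_eq_div] at this
    exact this
  have hLQ : 0 < L ^ Q := Real.rpow_pos_of_pos hL Q
  refine (measure_mono hsub).trans ((meas_ge_le_lintegral_div hYm.aemeasurable (by simpa using hLQ)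
    ENNReal.ofReal_ne_top).trans ((ENNReal.div_le_div_right hmom _).trans ?_))
  rw [← ENNReal.ofReal_div_of_pos hLQ]
  refine ENNReal.ofReal_le_ofReal ?_
  rw [div_le_iff₀ hLQ]
  -- The constant `128 = 4 · 32` splits into a `4` that absorbs the prefactor of the moment bound
  -- and a `32` that produces the decay.
  have h4 : (4 : ℝ) ≤ 4 ^ Q := by simpa using Real.rpow_le_rpow_of_exponent_le (by norm_num : (1 : ℝ) ≤ 4) hQ1
  calc 4 * A ^ Q ≤ 4 ^ Q * A ^ Q := by gcongr
    _ = 32 ^ (-Q) * (128 * A) ^ Q := by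
      rw [Real.mul_rpow (by norm_num) hA0, ← mul_assoc, Real.rpow_neg (by norm_num),
        show (128 : ℝ) = 32 * 4 by norm_num, Real.mul_rpow (by norm_num) (by norm_num),
        inv_mul_cancel_left₀ (by positivity)]
    _ ≤ _ := by gcongr

theorem lintegral_rpow_norm_snd (a b β γ : ℝ) :
    ∫⁻ z, ENNReal.ofReal ((‖z.2‖ ^ β) ^ γ)
      ∂((volume.restrict (Set.Ioo a b)).prod ((volume : Measure R3).restrict unitBall)) =
      ENNReal.ofReal (b - a) * weightMass (-(β * γ)) := by
  have hm : Measurable fun z : ℝ × R3 => ENNReal.ofReal ((‖z.2‖ ^ β) ^ γ) := by fun_prop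
  rw [lintegral_prod _ hm.aemeasurable]
  simp only [lintegral_const, ← Real.rpow_mul (norm_nonneg _), MeasurableSet.univ, Measure.restrict_apply,
    Set.univ_inter, Real.volume_Ioo, weightMass, neg_neg]
  rw [mul_comm]

theorem exists_gibbsMeasure_freeNorm_tail_le (hα : 0 < α) (χ : ℝ → ℝ) {p : ℝ} (hp : 0 < p) (hp6 : p < 6) :
    ∃ D : ℝ, 0 < D ∧ ∀ (N : ℕ) (t Q L : ℝ), p ≤ Q → 1 ≤ Q → D * √Q ≤ L →
      gibbsMeasure α χ N {u | ENNReal.ofReal L ≤ freeNorm p 0 3 (truncatedFlow α χ N t u)} ≤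
        ENNReal.ofReal (32 ^ (-Q)) := by
  -- The variance contributes `‖x‖^(-p(1 + ε)/2)` to the `L^p` integral, and this is integrable in
  -- dimension three precisely when the exponent is below `3`. Some `ε > 0` is left because `p < 6`.
  obtain ⟨ε, h0, h1, hε⟩ : ∃ ε : ℝ, 0 < ε ∧ ε < 1 ∧ p * (1 + ε) / 2 < 3 := by
    refine ⟨(6 - p) / 12, by linarith, by linarith, ?_⟩
    nlinarith
  obtain ⟨V, hV, hVb⟩ := exists_sum_eigenfun_sq_le h0 h1
  set W := (weightMass (p * (1 + ε) / 2)).toReal with hW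
  have hWe : ENNReal.ofReal W = weightMass (p * (1 + ε) / 2) := ENNReal.ofReal_toReal (weightMass_lt_top hε).ne
  refine ⟨128 * ((4 * Real.exp 1 * V) ^ (1 / 2 : ℝ) * (3 * W) ^ (1 / p)) + 1, by positivity,
    fun N t Q L hpQ hQ1 hL => ?_⟩
  have hQ0 : 0 < Q := by linarith
  have hsQ : 0 < √Q := Real.sqrt_pos.2 hQ0
  have hae : ∀ᵐ z ∂((volume.restrict (Set.Ioo (0 : ℝ) 3)).prod (volume.restrict unitBall)), z.2 ≠ 0 :=
    Measure.quasiMeasurePreserving_snd.ae ae_ne_zero_unitBall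
  have key := gibbsMeasure_tail_le (χ := χ) (N := N) hα
    (ν := (volume.restrict (Set.Ioo (0 : ℝ) 3)).prod (volume.restrict unitBall))
    (T := fun _ => t) measurable_const
    (a := fun z k => Complex.exp (-Complex.I * z.1 * freq k) * (eigenfun (k + 1) z.2 : ℂ)) (by
      intro k
      have := continuous_eigenfun
      exact Continuous.measurable (by fun_prop))
    (v := fun z => ‖z.2‖ ^ (-(1 + ε) / 2)) (by fun_prop)
    (by filter_upwards [hae] with z hz; have := norm_pos_iff.2 hz; positivity)
    (γ := 1) (M := 3 * W) (L := L) hV one_pos hp hpQ hQ1 (by positivity)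
    (by
      filter_upwards [hae] with z hz
      refine le_trans (le_of_eq (Finset.sum_congr rfl fun k _ => ?_)) ((hVb N z.2 hz).trans (le_of_eq ?_))
      · rw [norm_mul, norm_exp_freq, one_mul, Complex.norm_real, Real.norm_eq_abs]
      · rw [← Real.rpow_natCast, ← Real.rpow_mul (norm_nonneg _)]
        congr 2; push_cast; ring)
    (by
      rw [lintegral_rpow_norm_snd, ENNReal.ofReal_mul (by norm_num), hWe, sub_zero]
      refine le_of_eq ?_
      congr 2; ring)
    (lt_of_lt_of_le (by positivity) hL) (by
      refine le_trans ?_ hL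
      rw [one_mul, show 4 * Real.exp 1 * Q * V = (4 * Real.exp 1 * V) * Q by ring,
        Real.mul_rpow (by positivity) hQ0.le, ← Real.sqrt_eq_rpow Q, add_mul]
      nlinarith)
  refine le_trans (measure_mono fun u hu => ?_) key
  refine le_trans (Set.mem_ofPred_eq ▸ hu) (le_of_eq ?_)
  rw [freeNorm, eLpNorm_eq_lintegral_rpow_enorm_toReal (by simpa using hp) (by simp), ENNReal.toReal_ofReal hp.le]
  congr 1
  refine lintegral_congr fun z => ?_
  rw [← ofReal_norm, Real.rpow_one, toFun_freeEvol]
  congr 4 with k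
  ring

/-- The Sobolev norm is an `L²` norm over the index `k` with counting measure, each entry being a
single Gaussian of variance proportional to `freq^(2s - 2)`. These variances are summable because `s
< 1/2`. -/
theorem exists_gibbsMeasure_sobolevNorm_tail_le (hα : 0 < α) (χ : ℝ → ℝ) {s : ℝ} (hs : s < 1 / 2) :
    ∃ D : ℝ, 0 < D ∧ ∀ (N : ℕ) (t Q L : ℝ), 2 ≤ Q → D * √Q ≤ L →
      gibbsMeasure α χ N {u | ENNReal.ofReal L ≤ ENNReal.ofReal (sobolevNorm s (truncatedFlow α χ N t u))} ≤
        ENNReal.ofReal (32 ^ (-Q)) := by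
  obtain ⟨M, hM, hMb⟩ := exists_sum_rpow_freq_le (β := 2 - 2 * s) (by linarith)
  refine ⟨128 * ((4 * Real.exp 1) ^ (1 / 2 : ℝ) * M ^ (1 / 2 : ℝ)), by positivity,
    fun N t Q L hQ hL => ?_⟩
  have hQ0 : 0 < Q := by linarith
  have hsQ : 0 < √Q := Real.sqrt_pos.2 hQ0
  have key := gibbsMeasure_tail_le (χ := χ) (N := N) hα (ν := (Measure.count : Measure (Fin N)))
    (T := fun _ => t) measurable_const
    (a := fun j k => if j = k then ((freq j ^ s : ℝ) : ℂ) else 0) (fun k => measurable_of_finite _)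
    (v := fun j => freq j ^ (s - 1)) (measurable_of_finite _)
    (Eventually.of_forall fun j => by have := freq_pos j; positivity)
    (V := 1) (γ := 1) (r := 2) (M := M) (L := L) one_pos one_pos two_pos hQ (by linarith) hM.le
    (Eventually.of_forall fun j => by
      rw [Finset.sum_eq_single j (fun k _ hk => by simp [hk.symm]) (by simp)]
      have := freq_pos j
      rw [if_pos rfl, Complex.norm_real, Real.norm_of_nonneg (by positivity), Real.rpow_sub_one this.ne', one_mul])
    (by
      rw [lintegral_count, tsum_fintype, ← ENNReal.ofReal_sum_of_nonneg fun j _ => by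
        have := freq_pos j; positivity]
      refine ENNReal.ofReal_le_ofReal (le_trans (le_of_eq (Finset.sum_congr rfl fun j _ => ?_)) (hMb N))
      rw [← Real.rpow_mul (freq_pos j).le]
      congr 1; ring)
    (lt_of_lt_of_le (by positivity) hL) (by
      refine le_trans (le_of_eq ?_) hL
      rw [one_mul, mul_one, Real.mul_rpow (by positivity) hQ0.le, ← Real.sqrt_eq_rpow Q]
      ring)
  refine le_trans (measure_mono fun u hu => ?_) key
  refine le_trans (Set.mem_ofPred_eq ▸ hu) (le_of_eq ?_)
  rw [lintegral_count, tsum_fintype, sobolevNorm, Real.sqrt_eq_rpow,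
    ← ENNReal.ofReal_rpow_of_nonneg (Finset.sum_nonneg fun k _ => by have := freq_pos k; positivity) (by norm_num),
    ENNReal.ofReal_sum_of_nonneg fun k _ => by have := freq_pos k; positivity]
  congr 1
  refine Finset.sum_congr rfl fun j _ => ?_
  have := freq_pos j
  rw [Finset.sum_eq_single j (fun k _ hk => by simp [hk.symm]) (by simp), if_pos rfl, Real.rpow_one,
    ENNReal.ofReal_rpow_of_nonneg (by positivity) (by norm_num), norm_mul, Complex.norm_real,
    Real.norm_of_nonneg (by positivity), Real.mul_rpow (by positivity) (by positivity),
    ← Real.rpow_mul this.le, mul_comm s 2]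
  norm_num

/-- A power `α + 1` of a Gaussian field has moments growing like `Q^((α+1)/2)`, which is too fast by
itself. The window of length `Q⁻³` contributes `Q^(-3/m)` to the `L^m` norm and restores the growth
`√Q`. -/
theorem exists_gibbsMeasure_nlNorm_tail_le (hα : 0 < α) {X : ℝ} (hX0 : 0 < X)
    (hX : ∀ y, |χ y| ≤ X) {m : ℝ} (hm0 : 0 < m) (hm : m * (α + 1) < 6) :
    ∃ D : ℝ, 0 < D ∧ ∀ (N : ℕ) (t Q L : ℝ), m ≤ Q → 1 ≤ Q → D * √Q ≤ L →
      gibbsMeasure α χ N {u | ENNReal.ofReal L ≤ nlNorm α χ N m t (t + (Q ^ 3)⁻¹)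
        fun σ => (toCoord (truncatedFlow α χ N σ u)).1} ≤ ENNReal.ofReal (32 ^ (-Q)) := by
  obtain ⟨ε, h0, h1, hε⟩ : ∃ ε : ℝ, 0 < ε ∧ ε < 1 ∧ (α + 1) * m * (1 + ε) / 2 < 3 := by
    have : 0 < m * (α + 1) := by positivity
    refine ⟨(6 - m * (α + 1)) / 12, by linarith, by linarith, ?_⟩
    nlinarith
  obtain ⟨V, hV, hVb⟩ := exists_sum_eigenfun_sq_le h0 h1
  set W := (weightMass ((α + 1) * m * (1 + ε) / 2)).toReal with hW
  have hWe : ENNReal.ofReal W = weightMass ((α + 1) * m * (1 + ε) / 2) :=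
    ENNReal.ofReal_toReal (weightMass_lt_top hε).ne
  have hα1 : 0 < α + 1 := by linarith
  refine ⟨128 * ((4 * Real.exp 1 * (α + 1) * (X ^ 2 * V)) ^ ((α + 1) / 2) * W ^ (1 / m)) + 1, by positivity,
    fun N t Q L hmQ hQ1 hL => ?_⟩
  have hQ0 : 0 < Q := by linarith
  have hsQ : 0 < √Q := Real.sqrt_pos.2 hQ0
  set ν := (volume.restrict (Set.Ioo t (t + (Q ^ 3)⁻¹))).prod (volume.restrict unitBall) with hν
  have hae : ∀ᵐ z ∂ν, z.2 ≠ 0 := Measure.quasiMeasurePreserving_snd.ae ae_ne_zero_unitBall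
  have key := gibbsMeasure_tail_le (χ := χ) (N := N) hα (ν := ν)
    (T := fun z => z.1) measurable_fst
    (a := fun z k => ((mult χ N k * eigenfun (k + 1) z.2 : ℝ) : ℂ)) (by
      intro k
      have := continuous_eigenfun
      exact Continuous.measurable (by fun_prop))
    (v := fun z => ‖z.2‖ ^ (-(1 + ε) / 2)) (by fun_prop)
    (by filter_upwards [hae] with z hz; have := norm_pos_iff.2 hz; positivity)
    (V := X ^ 2 * V) (γ := α + 1) (M := (Q ^ 3)⁻¹ * W) (L := L) (by positivity) hα1 hm0 hmQ hQ1 (by positivity)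
    (by
      filter_upwards [hae] with z hz
      have h2 : V * ‖z.2‖ ^ (-(1 + ε)) = V * (‖z.2‖ ^ (-(1 + ε) / 2)) ^ 2 := by
        rw [← Real.rpow_natCast, ← Real.rpow_mul (norm_nonneg _)]
        congr 2; push_cast; ring
      rw [mul_assoc, ← h2]
      refine le_trans ?_ (mul_le_mul_of_nonneg_left (hVb N z.2 hz) (by positivity))
      rw [Finset.mul_sum]
      refine Finset.sum_le_sum fun k _ => ?_
      have := freq_pos k
      rw [Complex.norm_real, Real.norm_eq_abs, abs_mul, ← mul_pow, ← mul_div_assoc]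
      gcongr
      exact hX _)
    (by
      rw [hν, lintegral_rpow_norm_snd, ENNReal.ofReal_mul (by positivity), hWe, add_sub_cancel_left]
      refine le_of_eq ?_
      congr 2; ring)
    (lt_of_lt_of_le (by positivity) hL) (by
      refine le_trans ?_ hL
      rw [show 4 * Real.exp 1 * ((α + 1) * Q) * (X ^ 2 * V) = (4 * Real.exp 1 * (α + 1) * (X ^ 2 * V)) * Q by ring,
        Real.mul_rpow (by positivity : 0 ≤ 4 * Real.exp 1 * (α + 1) * (X ^ 2 * V)) hQ0.le,
        Real.mul_rpow (by positivity : 0 ≤ (Q ^ 3)⁻¹) (by positivity)]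
      -- The exponents require `(α + 1)/2 - 3/m ≤ 1/2`, that is `mα ≤ 6`, which follows from `m (α +
      -- 1) < 6`.
      have hQQ : Q ^ ((α + 1) / 2) * ((Q ^ 3)⁻¹) ^ (1 / m) ≤ √Q := by
        rw [← Real.rpow_natCast Q 3, ← Real.rpow_neg hQ0.le, ← Real.rpow_mul hQ0.le, ← Real.rpow_add hQ0,
          Real.sqrt_eq_rpow]
        refine Real.rpow_le_rpow_of_exponent_le hQ1 ?_
        have : α / 2 ≤ 3 * (1 / m) := by
          rw [mul_one_div, div_le_div_iff₀ two_pos hm0]; nlinarith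
        push_cast
        linarith
      set A := (4 * Real.exp 1 * (α + 1) * (X ^ 2 * V)) ^ ((α + 1) / 2) with hA
      have hA0 : 0 ≤ A := by positivity
      calc _ = 128 * (A * W ^ (1 / m)) * (Q ^ ((α + 1) / 2) * ((Q ^ 3)⁻¹) ^ (1 / m)) := by ring
        _ ≤ 128 * (A * W ^ (1 / m)) * √Q := by gcongr
        _ ≤ _ := by rw [add_mul]; linarith)
  refine le_trans (measure_mono fun u hu => ?_) key
  refine le_trans (Set.mem_ofPred_eq ▸ hu) ?_
  unfold nlNorm
  gcongr with z
  -- The real field is the real part of a complex Gaussian sum, so the tail bound for complex sums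
  -- applies.
  have : field χ N (toCoord (truncatedFlow α χ N z.1 u)).1 z.2 =
      (∑ k, ((mult χ N k * eigenfun (k + 1) z.2 : ℝ) : ℂ) * truncatedFlow α χ N z.1 u k).re := by
    rw [Complex.re_sum, field]
    refine Finset.sum_congr rfl fun k _ => ?_
    have := (freq_pos k).ne'
    rw [Complex.re_ofReal_mul]
    simp only [toCoord]
    field_simp
  rw [this]
  exact Complex.abs_re_le_norm _

/-! ### The union bound over a grid of times and the conclusion -/

theorem exists_freeNorm_le_freeNorm {p r : ℝ} (hp : 0 < p) (hpr : p ≤ r) (a b : ℝ) :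
    ∃ c : ℝ, 0 ≤ c ∧ ∀ (N : ℕ) (u : E N), freeNorm p a b u ≤ ENNReal.ofReal c * freeNorm r a b u := by
  set μ := (volume.restrict (Set.Ioo a b)).prod ((volume : Measure R3).restrict unitBall) with hμ
  refine ⟨(μ Set.univ ^ (1 / (ENNReal.ofReal p).toReal - 1 / (ENNReal.ofReal r).toReal)).toReal,
    ENNReal.toReal_nonneg, fun N u => ?_⟩
  have hr : 0 < r := hp.trans_le hpr
  rw [ENNReal.ofReal_toReal, mul_comm]
  · exact eLpNorm_le_eLpNorm_mul_rpow_measure_univ (ENNReal.ofReal_le_ofReal hpr)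
      (continuous_toFun_freeEvol_left u).aestronglyMeasurable
  · rw [ENNReal.toReal_ofReal hp.le, ENNReal.toReal_ofReal hr.le]
    exact ENNReal.rpow_ne_top_of_nonneg (sub_nonneg.2 (one_div_le_one_div_of_le hp hpr)) (measure_ne_top μ _)

/-- Data for which, at time `T`, one of the quantities that control the flow on
`[T, T + Q⁻³]` is at least `L`. -/
def largeSet (α : ℝ) (χ : ℝ → ℝ) (N : ℕ) (p s m T Q L : ℝ) : Set (E N) :=
  {u | ENNReal.ofReal L ≤ freeNorm p 0 3 (truncatedFlow α χ N T u)} ∪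
    {u | ENNReal.ofReal L ≤ ENNReal.ofReal (sobolevNorm s (truncatedFlow α χ N T u))} ∪
    {u | ENNReal.ofReal L ≤ nlNorm α χ N m T (T + (Q ^ 3)⁻¹)
      fun σ => (toCoord (truncatedFlow α χ N σ u)).1}

theorem exists_gibbsMeasure_largeSet_le (hα : 0 < α) {p s m X : ℝ} (hp : 0 < p) (hp6 : p < 6) (hs : s < 1 / 2)
    (hX0 : 0 < X) (hX : ∀ y, |χ y| ≤ X) (hm0 : 0 < m) (hm : m * (α + 1) < 6) :
    ∃ D : ℝ, 0 < D ∧ ∀ (N : ℕ) (T Q : ℝ), 6 ≤ Q →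
      gibbsMeasure α χ N (largeSet α χ N p s m T Q (D * √Q)) ≤ 3 * ENNReal.ofReal (32 ^ (-Q)) := by
  obtain ⟨D₁, h1, hD₁⟩ := exists_gibbsMeasure_freeNorm_tail_le hα χ hp hp6
  obtain ⟨D₂, h2, hD₂⟩ := exists_gibbsMeasure_sobolevNorm_tail_le hα χ hs
  obtain ⟨D₃, h3, hD₃⟩ := exists_gibbsMeasure_nlNorm_tail_le hα hX0 hX hm0 hm
  refine ⟨D₁ + D₂ + D₃, by positivity, fun N T Q hQ => ?_⟩
  have hsQ := Real.sqrt_nonneg Q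
  have hm6 : m ≤ 6 := by nlinarith
  have e : (3 : ℝ≥0∞) * ENNReal.ofReal (32 ^ (-Q)) =
      ENNReal.ofReal (32 ^ (-Q)) + ENNReal.ofReal (32 ^ (-Q)) + ENNReal.ofReal (32 ^ (-Q)) := by ring
  rw [e]
  refine (measure_union_le _ _).trans (add_le_add ((measure_union_le _ _).trans (add_le_add ?_ ?_)) ?_)
  · exact hD₁ N T Q _ (by linarith) (by linarith) (by gcongr; linarith)
  · exact hD₂ N T Q _ (by linarith) (by gcongr; linarith)
  · exact hD₃ N T Q _ (by linarith) (by linarith) (by gcongr; linarith)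

/-- The budget behind the base `32 = 8 · 4`: the factor `8^q` pays for the `q³` grid points per unit
of time, and `4^q` pays for the length `2^j`, the three events and the target `2^(-(i+j+1))`. -/
theorem grid_card_mul_le {i j q : ℕ} (hi : 1 ≤ i) (hq : q = 8 * (i + j)) :
    (2 * (2 ^ j * q ^ 3) + 1) * 3 * 2 ^ (i + j + 1) ≤ 32 ^ q := by
  have h1 : q ^ 3 ≤ 8 ^ q := by
    calc q ^ 3 ≤ (2 ^ q) ^ 3 := Nat.pow_le_pow_left q.lt_two_pow_self.le 3
      _ = 8 ^ q := by rw [← pow_mul, mul_comm, pow_mul]; norm_num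
  have h2 : 1 ≤ 2 ^ j * 8 ^ q := Nat.one_le_iff_ne_zero.2 (by positivity)
  calc _ ≤ (2 * (2 ^ j * 8 ^ q) + 2 ^ j * 8 ^ q) * 3 * 2 ^ (i + j + 1) := by gcongr
    _ = 9 * (8 ^ q * 2 ^ (i + 2 * j + 1)) := by ring
    _ ≤ 2 ^ 4 * (8 ^ q * 2 ^ (i + 2 * j + 1)) := by gcongr; norm_num
    _ = 8 ^ q * 2 ^ (i + 2 * j + 5) := by ring
    _ ≤ 8 ^ q * 2 ^ (2 * q) := by gcongr <;> omega
    _ = 32 ^ q := by rw [pow_mul, ← mul_pow]; norm_num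

theorem measure_grid_le {Ω : Type*} [MeasurableSpace Ω] (μ : Measure Ω) {B : ℝ → ℝ → Set Ω}
    (hB : ∀ T Q, 6 ≤ Q → μ (B T Q) ≤ 3 * ENNReal.ofReal (32 ^ (-Q))) {i : ℕ} (hi : 1 ≤ i) :
    μ (⋃ j : ℕ, ⋃ k ∈ Finset.Icc (-(2 ^ j * (8 * (i + j)) ^ 3 : ℕ) : ℤ) (2 ^ j * (8 * (i + j)) ^ 3 : ℕ),
      B (k * (((8 * (i + j) : ℕ) : ℝ) ^ 3)⁻¹) (8 * (i + j) : ℕ)) ≤ 2⁻¹ ^ i := by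
  refine (measure_iUnion_le _).trans ?_
  have hj : ∀ j : ℕ, μ (⋃ k ∈ Finset.Icc (-(2 ^ j * (8 * (i + j)) ^ 3 : ℕ) : ℤ) (2 ^ j * (8 * (i + j)) ^ 3 : ℕ),
      B (k * (((8 * (i + j) : ℕ) : ℝ) ^ 3)⁻¹) (8 * (i + j) : ℕ)) ≤ 2⁻¹ ^ i * 2⁻¹ ^ (j + 1) := by
    intro j
    have hn := grid_card_mul_le (j := j) hi rfl
    set q := 8 * (i + j) with hq
    have hq6 : (6 : ℝ) ≤ q := by
      have : 6 ≤ q := by omega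
      exact_mod_cast this
    refine (measure_biUnion_finset_le _ _).trans ((Finset.sum_le_sum fun k _ => hB _ _ hq6).trans ?_)
    rw [Finset.sum_const, Int.card_Icc, nsmul_eq_mul,
      show (((2 ^ j * q ^ 3 : ℕ) : ℤ) + 1 - -((2 ^ j * q ^ 3 : ℕ) : ℤ)).toNat = 2 * (2 ^ j * q ^ 3) + 1 by omega,
      ← pow_add, Real.rpow_neg (by norm_num), Real.rpow_natCast, ENNReal.ofReal_inv_of_pos (by positivity),
      ENNReal.ofReal_pow (by norm_num), ENNReal.ofReal_ofNat, ENNReal.inv_pow.symm, ← mul_assoc, ← div_eq_mul_inv,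
      ENNReal.div_le_iff (by positivity) (by finiteness), ← add_assoc,
      mul_comm _ ((32 : ℝ≥0∞) ^ q), ← div_eq_mul_inv,
      ENNReal.le_div_iff_mul_le (by left; positivity) (by left; finiteness)]
    exact_mod_cast hn
  refine (ENNReal.tsum_le_tsum hj).trans (le_of_eq ?_)
  rw [ENNReal.tsum_mul_left]
  simp_rw [pow_succ]
  rw [ENNReal.tsum_mul_right, ENNReal.tsum_geometric, ENNReal.one_sub_inv_two, inv_inv,
    ENNReal.mul_inv_cancel (by norm_num) (by norm_num), mul_one]

/-- Every time is within `q⁻³` of the grid. -/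
theorem exists_grid_point {i : ℕ} (hi : 1 ≤ i) (t : ℝ) :
    ∃ (j : ℕ) (k : ℤ), k ∈ Finset.Icc (-(2 ^ j * (8 * (i + j)) ^ 3 : ℕ) : ℤ) (2 ^ j * (8 * (i + j)) ^ 3 : ℕ) ∧
      k * (((8 * (i + j) : ℕ) : ℝ) ^ 3)⁻¹ ≤ t ∧
      t ≤ k * (((8 * (i + j) : ℕ) : ℝ) ^ 3)⁻¹ + (((8 * (i + j) : ℕ) : ℝ) ^ 3)⁻¹ ∧
      √((8 * (i + j) : ℕ) : ℝ) ≤ 4 * √(i + Real.log (1 + |t|)) := by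
  set l := Real.log (1 + |t|) with hl
  have ht0 := abs_nonneg t
  have hl0 : 0 ≤ l := Real.log_nonneg (by linarith)
  have hi' : (1 : ℝ) ≤ i := by exact_mod_cast hi
  -- Since `2 log 2 ≥ 1`, this `j` gives `2^j ≥ 1 + |t|`. It also gives `8 (i + j) ≤ 8 (i + 2l + 1)
  -- ≤ 16 (i + l)` because `i ≥ 1`, hence the factor `4` after the square root.
  set j := ⌈2 * l⌉₊ with hj
  have hj1 : 2 * l ≤ j := Nat.le_ceil _
  have hj2 : (j : ℝ) ≤ 2 * l + 1 := (Nat.ceil_lt_add_one (by positivity)).le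
  have ht : |t| ≤ 2 ^ j := by
    have h1 : Real.exp l = 1 + |t| := Real.exp_log (by linarith)
    have h2 : l ≤ j * Real.log 2 := by nlinarith [Real.log_two_gt_d9]
    have h3 := Real.exp_le_exp.2 h2
    rw [mul_comm, Real.exp_mul, Real.exp_log two_pos, Real.rpow_natCast, h1] at h3
    linarith
  set q := 8 * (i + j) with hq
  have hq0 : 0 < (q : ℝ) ^ 3 := by
    have : 0 < q := by omega
    positivity
  have hqc : 8 * ((i : ℝ) + j) = q := by rw [hq]; push_cast; ring
  refine ⟨j, ⌊t * q ^ 3⌋, ?_, ?_, ?_, ?_⟩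
  · rw [Finset.mem_Icc]
    obtain ⟨h1, h2⟩ := abs_le.1 ht
    constructor
    · rw [Int.le_floor]
      push_cast
      rw [hqc]
      nlinarith
    · rw [Int.floor_le_iff]
      push_cast
      rw [hqc]
      nlinarith
  · rw [← div_eq_mul_inv, div_le_iff₀ hq0]
    exact Int.floor_le _
  · rw [← add_one_mul, ← div_eq_mul_inv, le_div_iff₀ hq0]
    exact (Int.lt_floor_add_one _).le
  · rw [show (4 : ℝ) = √16 by rw [show (16 : ℝ) = 4 ^ 2 by norm_num]; simp, ← Real.sqrt_mul (by norm_num)]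
    refine Real.sqrt_le_sqrt ?_
    push_cast
    linarith

theorem exists_gibbsMeasure_truncatedFlow_bound {α p s X : ℝ} (hα : 0 < α) (hp : 2 * α < p) (hp6 : p < 6)
    (hs : s < 1 / 2) {χ : ℝ → ℝ} (hX0 : 0 < X) (hX : ∀ y, |χ y| ≤ X) :
    ∃ C : ℝ, 0 < C ∧ ∀ i N : ℕ, 1 ≤ i →
      ∃ A : Set (E N), MeasurableSet A ∧ gibbsMeasure α χ N Aᶜ ≤ (2 : ℝ≥0∞)⁻¹ ^ i ∧
        ∀ u₀ ∈ A, ∀ t : ℝ,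
          freeLpNorm p (truncatedFlow α χ N t u₀) +
              ENNReal.ofReal (sobolevNorm s (truncatedFlow α χ N t u₀)) ≤
            ENNReal.ofReal (C * √(i + Real.log (1 + |t|))) := by
  -- The estimates are run with an exponent `r ∈ [5, 6)` above `p`, so that the Strichartz exponents
  -- are admissible; the `L^p` norm is recovered by Hölder on a set of finite measure.
  obtain ⟨r, hpr, hr5, hr6⟩ : ∃ r, p ≤ r ∧ 5 ≤ r ∧ r < 6 :=
    ⟨max p 5, le_max_left _ _, le_max_right _ _, max_lt hp6 (by norm_num)⟩
  have hr0 : 0 < r := by linarith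
  have hr1 : 1 / 3 < 2 / r := by rw [div_lt_div_iff₀ (by norm_num) hr0]; linarith
  have hr2 : 1 / r ≤ 1 / 5 := one_div_le_one_div_of_le (by norm_num) hr5
  have hr3 : 2 / r = 2 * (1 / r) := by ring
  have hr4 : 1 / r * r = 1 := by field_simp
  -- With `θ = 2/3 - 1/r`, the integrability condition reads `r/3 + 1 < 3` and the regularity
  -- condition reads `7/6 - 2/r < 5/6`. Both amount to `r < 6`.
  obtain ⟨C₁, hC₁, hS₁⟩ := exists_freeNorm_le_sobolevNorm (θ := 2 / 3 - 1 / r) (q := r) (a := 5 / 6)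
    (by linarith) (by have : 0 < 1 / r := by positivity
                      linarith) (by linarith) (by nlinarith) (by linarith)
  -- The dual Strichartz estimate needs `3/2 < m < 2` and the nonlinear tail bound needs `m (α + 1)
  -- < 6`. They are compatible because `α < 3`.
  obtain ⟨m, hm1, hm2, hm⟩ : ∃ m : ℝ, 3 / 2 < m ∧ m < 2 ∧ m * (α + 1) < 6 := by
    have h1 : 3 / 2 < min 2 (6 / (α + 1)) :=
      lt_min (by norm_num) (by rw [div_lt_div_iff₀ two_pos (by linarith)]; linarith)
    obtain ⟨m, h2, h3⟩ := exists_between h1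
    exact ⟨m, h2, h3.trans_le (min_le_left _ _),
      (lt_div_iff₀ (by linarith)).1 (h3.trans_le (min_le_right _ _))⟩
  have hmq : m.HolderConjugate m.conjExponent := Real.HolderConjugate.conjExponent (by linarith)
  have hq : 1 / m.conjExponent = 1 - 1 / m := by
    rw [one_div, one_div, ← hmq.inv_add_inv_eq_one]; ring
  have hq0 : 0 < m.conjExponent := hmq.symm.pos
  have hm3 : 1 / m < 2 / 3 := by rw [div_lt_div_iff₀ (by linarith) (by norm_num)]; linarith
  have hm4 : 1 / 2 < 1 / m := one_div_lt_one_div_of_lt (by linarith) hm2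
  have hq1 : m.conjExponent * (1 / m.conjExponent) = 1 := mul_one_div_cancel hq0.ne'
  -- With `θ = 0` both conditions say that the conjugate exponent of `m` is below `3`, that is `m >
  -- 3/2`. The losses `5/6` and `1/6` add up to the one derivative gained from `√(-Δ)⁻¹`.
  obtain ⟨C₂, hC₂, hS₂⟩ := exists_freeNorm_le_sobolevNorm (θ := 0) (q := m.conjExponent) (a := 1 / 6)
    le_rfl zero_le_one (by nlinarith) (by nlinarith) (by linarith)
  obtain ⟨D, hD, hDB⟩ := exists_gibbsMeasure_largeSet_le hα hr0 hr6 hs hX0 hX (by linarith : 0 < m) hm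
  obtain ⟨c, hc, hcb⟩ := exists_freeNorm_le_freeNorm (by linarith : 0 < p) hpr 0 2
  set K := (C₁ + 1) * (C₂ * X) with hK
  have hK0 : 0 ≤ K := by positivity
  refine ⟨(c + 1) * ((2 + K) * (D * 4)), by positivity, fun i N hi => ?_⟩
  have hgrid := measure_grid_le (gibbsMeasure α χ N)
    (B := fun T Q => largeSet α χ N r s m T Q (D * √Q)) (fun T Q hQ => hDB N T Q hQ) hi
  set S := ⋃ j : ℕ, ⋃ k ∈ Finset.Icc (-(2 ^ j * (8 * (i + j)) ^ 3 : ℕ) : ℤ) (2 ^ j * (8 * (i + j)) ^ 3 : ℕ),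
      largeSet α χ N r s m (k * (((8 * (i + j) : ℕ) : ℝ) ^ 3)⁻¹) (8 * (i + j) : ℕ) (D * √((8 * (i + j) : ℕ) : ℝ)) with hS
  -- Replacing the exceptional set by a measurable hull of the same measure avoids proving that it
  -- is measurable.
  refine ⟨(toMeasurable (gibbsMeasure α χ N) S)ᶜ, (measurableSet_toMeasurable _ _).compl, ?_, fun u hu t => ?_⟩
  · rw [compl_compl, measure_toMeasurable]
    exact hgrid
  obtain ⟨j, k, hk, h1, h2, h3⟩ := exists_grid_point hi t
  have huS : u ∉ S := fun h => hu (subset_toMeasurable _ _ h)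
  simp only [hS, Set.mem_iUnion, not_exists] at huS
  have hu' := huS j k hk
  set q : ℝ := ((8 * (i + j) : ℕ) : ℝ) with hqdef
  have hq1 : 1 ≤ q := by
    have : 1 ≤ 8 * (i + j) := by omega
    rw [hqdef]
    exact_mod_cast this
  set T := k * (q ^ 3)⁻¹ with hT
  simp only [largeSet, Set.mem_union, Set.mem_ofPred_eq, not_or, not_le] at hu'
  obtain ⟨⟨b1, b2⟩, b3⟩ := hu'
  have hloc := truncatedFlow_local_bound (χ := χ) hα (by linarith : 1 ≤ r) (by linarith : s ≤ 5 / 6) hmq hC₁.le hC₂.le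
    hX0.le (hS₁ N) (hS₂ N) (fun k => hX _) u h1 h2 (by
      have : (q ^ 3)⁻¹ ≤ 1 := inv_le_one_of_one_le₀ (one_le_pow₀ hq1)
      linarith)
  set Φ := truncatedFlow α χ N t u with hΦ
  have hL : 0 ≤ D * √q := by positivity
  have hsum : freeNorm r 0 2 Φ + ENNReal.ofReal (sobolevNorm s Φ) ≤ ENNReal.ofReal ((2 + K) * (D * √q)) := by
    refine hloc.trans ((add_le_add (add_le_add b1.le b2.le) (mul_le_mul' le_rfl b3.le)).trans (le_of_eq ?_))
    rw [← ENNReal.ofReal_add hL hL, ← ENNReal.ofReal_mul hK0, ← ENNReal.ofReal_add (by positivity) (by positivity)]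
    congr 1; ring
  calc freeLpNorm p Φ + ENNReal.ofReal (sobolevNorm s Φ)
      ≤ ENNReal.ofReal c * freeNorm r 0 2 Φ + ENNReal.ofReal (sobolevNorm s Φ) := by
        gcongr
        exact hcb N Φ
    _ ≤ (ENNReal.ofReal c + 1) * (freeNorm r 0 2 Φ + ENNReal.ofReal (sobolevNorm s Φ)) := by
        rw [add_mul, one_mul, mul_add]
        exact add_le_add le_self_add le_add_self
    _ ≤ ENNReal.ofReal (c + 1) * ENNReal.ofReal ((2 + K) * (D * √q)) := by
        rw [ENNReal.ofReal_add hc zero_le_one, ENNReal.ofReal_one]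
        gcongr
    _ ≤ _ := by
        rw [← ENNReal.ofReal_mul (by positivity)]
        refine ENNReal.ofReal_le_ofReal ?_
        calc _ ≤ (c + 1) * ((2 + K) * (D * (4 * √(i + Real.log (1 + |t|))))) := by gcongr
          _ = _ := by ring

end

end RadialWave

theorem mainTheorem3 (α p s : ℝ) (hα : 0 < α) (hp : 2 * α < p) (hp6 : p < 6) (hs : s < 1 / 2)
    (χ : ℝ → ℝ) (hχ : ContDiff ℝ (⊤ : ℕ∞) χ) (hχc : HasCompactSupport χ)
    (hχs : tsupport χ ⊆ Set.Ioo (-1) 1) (hχ1 : ∀ x ∈ Set.Ioo (-1 / 2 : ℝ) (1 / 2), χ x = 1) :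
    (∀ N : ℕ, 1 ≤ N → ∀ u₀ : RadialWave.E N,
      ∃! u : ℝ → RadialWave.E N, RadialWave.IsTruncatedSolution α χ N u₀ u) ∧
    ∃ C : ℝ, 0 < C ∧ ∀ i N : ℕ, 1 ≤ i → 1 ≤ N →
      ∃ A : Set (RadialWave.E N), MeasurableSet A ∧
        RadialWave.gibbsMeasure α χ N Aᶜ ≤ (2 : ENNReal)⁻¹ ^ i ∧
        ∀ u₀ ∈ A, ∀ t : ℝ,
          RadialWave.freeLpNorm p (RadialWave.truncatedFlow α χ N t u₀) +
              ENNReal.ofReal (RadialWave.sobolevNorm s (RadialWave.truncatedFlow α χ N t u₀)) ≤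
            ENNReal.ofReal (C * √(i + Real.log (1 + |t|))) := by
  refine ⟨fun N _ u₀ => RadialWave.existsUnique_isTruncatedSolution hα u₀, ?_⟩
  obtain ⟨X, hX⟩ := hχ.continuous.bounded_above_of_compact_support hχc
  have hX1 : ∀ y, |χ y| ≤ max X 1 := fun y => (hX y).trans (le_max_left _ _)
  obtain ⟨C, hC, h⟩ := RadialWave.exists_gibbsMeasure_truncatedFlow_bound (s := s) hα hp hp6 hs
    (lt_max_of_lt_right one_pos) hX1
  exact ⟨C, hC, fun i N hi _ => h i N hi⟩
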